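/- **Notation.** For $N\ge 3$ and $\hbar,\varepsilon\in\mathbb C$ let $Y_{\hbar,\varepsilon}(\widehat{\mathfrak{sl}}(N))$ be the associative unital $\mathbb C$-algebra generated by $H_{i,r},X^{+}_{i,r},X^{-}_{i,r}$ ($i\in\{0,\dots,N-1\}=\mathbb Z/N\mathbb Z$, $r\in\{0,1\}$) with defining relations (Guay–Nakajima–Wendland minimalistic presentation), where $[a,b]=ab-ba$, $\{a,b\}=ab+ba$, $\widetilde H_{i,1}=H_{i,1}-\tfrac{\hbar}{2}H_{i,0}^2$, and $a_{ij}=2$ if $i=j$, $-1$ if $j=i\pm1$, $0$ otherwise: $$[H_{i,r},H_{j,s}]=0,\qquad [X^+_{i,0},X^-_{j,0}]=\delta_{ij}H_{i,0},\qquad [X^+_{i,1},X^-_{j,0}]=\delta_{ij}H_{i,1}=[X^+_{i,0},X^-_{j,1}],$$ $$[H_{i,0},X^\pm_{j,r}]=\pm a_{ij}X^\pm_{j,r},\qquad [\widetilde H_{i,1},X^\pm_{j,0}]=\pm a_{ij}X^\pm_{j,1}\ \text{ if }(i,j)\ne(0,N-1),(N-1,0),$$ $$[\widetilde H_{0,1},X^\pm_{N-1,0}]=\mp\bigl(X^\pm_{N-1,1}+(\varepsilon+\tfrac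 N2\hbar)X^\pm_{N-1,0}\bigr),\qquad [\widetilde H_{N-1,1},X^\pm_{0,0}]=\mp\bigl(X^\pm_{0,1}-(\varepsilon+\tfrac N2\hbar)X^\pm_{0,0}\bigr),$$ $$[X^\pm_{i,1},X^\pm_{j,0}]-[X^\pm_{i,0},X^\pm_{j,1}]=\pm a_{ij}\tfrac{\hbar}{2}\{X^\pm_{i,0},X^\pm_{j,0}\}\ \text{ if }(i,j)\ne(0,N-1),(N-1,0),$$ $$[X^\pm_{0,1},X^\pm_{N-1,0}]-[X^\pm_{0,0},X^\pm_{N-1,1}]=\mp\tfrac{\hbar}{2}\{X^\pm_{0,0},X^\pm_{N-1,0}\}+(\varepsilon+\tfrac N2\hbar)[X^\pm_{0,0},X^\pm_{N-1,0}],$$ $$(\operatorname{ad}X^\pm_{i,0})^{1+|a_{ij}|}(X^\pm_{j,0})=0\ \text{ if }i\ne j.$$ Let $\widehat{\mathfrak{sl}}(N)=\mathfrak{sl}(N)\otimes\mathbb C[t^{\pm1}]\oplus\mathbb Cc$ with $c$ central and $[xt^a,yt^b]=[x,y]t^{a+b}+a\,\delta_{a+b,0}\operatorname{tr}(xy)\,c$.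 There is a natural algebra homomorphism $U(\widehat{\mathfrak{sl}}(N))\to Y_{\hbar,\varepsilon}(\widehat{\mathfrak{sl}}(N))$, determined by $E_{i,i+1}\mapsto X^+_{i,0}$, $E_{i+1,i}\mapsto X^-_{i,0}$, $E_{i,i}-E_{i+1,i+1}\mapsto H_{i,0}$ for $1\le i\le N-1$, and $E_{N,1}t\mapsto X^+_{0,0}$, $E_{1,N}t^{-1}\mapsto X^-_{0,0}$, $E_{N,N}-E_{1,1}+c\mapsto H_{0,0}$; the image of $x$ is again written $x$. Grade $Y=Y_{\hbar,\varepsilon}(\widehat{\mathfrak{sl}}(N))=\bigoplus_{d\in\mathbb Z}Y(d)$ by $\deg H_{i,r}=0$, $\deg X^\pm_{0,r}=\pm1$, $\deg X^\pm_{i,r}=0$ for $i\ne0$, and let $\widetilde Y_{\hbar,\varepsilon}(\widehat{\mathfrak{sl}}(N))=\bigoplus_d\varprojlim_k Y(d)\big/\sum_{r\ge k}Y(d-r)Y(r)$ be the degreewise completion, with its natural topology. **Theorem.** Let $n\ge3$ and $\hbar,\varepsilon\in\mathbb C$. In $\widetilde Y_{\hbar,\varepsilon}(\widehat{\mathfrak{sl}}(n+1))$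 the series $$P_{i,j}=\sum_{s\ge0}E_{i,n+1}t^{-s-1}\,E_{n+1,j}t^{s+1}\qquad(1\le i,j\le n)$$ converge, and there is a unique algebra homomorphism $$\Psi\colon Y_{\hbar,\varepsilon}(\widehat{\mathfrak{sl}}(n))\to\widetilde Y_{\hbar,\varepsilon}(\widehat{\mathfrak{sl}}(n+1))$$ such that $$\Psi(H_{0,0})=H_{0,0}+H_{n,0},\qquad \Psi(X^+_{0,0})=E_{n,1}t,\qquad \Psi(X^-_{0,0})=E_{1,n}t^{-1},$$ and, for $1\le i\le n-1$, $$\Psi(H_{i,0})=H_{i,0},\qquad \Psi(X^+_{i,0})=E_{i,i+1},\qquad \Psi(X^-_{i,0})=E_{i+1,i},$$ $$\Psi(H_{i,1})=H_{i,1}-\hbar P_{i,i}+\hbar P_{i+1,i+1},\qquad \Psi(X^+_{i,1})=X^+_{i,1}-\hbar P_{i,i+1},\qquad \Psi(X^-_{i,1})=X^-_{i,1}-\hbar P_{i+1,i}.$$ In particular, $\Psi(\widetilde H_{i,1})=\widetilde H_{i,1}-\hbar P_{i,i}+\hbar P_{i+1,i+1}$ for $1\le i\le n-1$. -/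

import Mathlib

open scoped Topology

noncomputable section

/-! ### The affine Lie algebra `sl(N)^` (without derivation)

Rows and columns of `N × N` matrices are labelled by `1, …, N`, identified with `ZMod N`
(so the label `N` is `0`). -/

namespace AffineSl

variable (N : ℕ) [NeZero N]

/-- The special linear Lie algebra `sl(N)` over `ℂ`. -/
abbrev Base : Type := LieAlgebra.SpecialLinear.sl (ZMod N) ℂ

/-- The bilinear form `(x, y) ↦ -tr(xy)` on `sl(N)`. -/
def negTraceForm : LinearMap.BilinForm ℂ (Base N) :=
  LinearMap.mk₂ ℂ (fun x y => -Matrix.trace (x.val * y.val))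
    (by intro x y z; simp [add_mul]; ring)
    (by intro c x y; simp)
    (by intro x y z; simp [mul_add]; ring)
    (by intro c x y; simp)

lemma negTraceForm_symm : (negTraceForm N).IsSymm := by
  constructor
  intro x y
  simp [negTraceForm, Matrix.trace_mul_comm x.val y.val]

lemma negTraceForm_invariant : (negTraceForm N).lieInvariant (Base N) := by
  intro x y z
  have h : Matrix.trace (y.val * x.val * z.val) = Matrix.trace (y.val * (x.val * z.val)) := by
    rw [mul_assoc]
  have h' : Matrix.trace (x.val * y.val * z.val) = Matrix.trace (y.val * (z.val * x.val)) := by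
    rw [Matrix.trace_mul_comm, ← mul_assoc, Matrix.trace_mul_comm, ← mul_assoc,
      ← Matrix.trace_mul_comm]
  simp only [negTraceForm, LinearMap.mk₂_apply, LieSubalgebra.coe_bracket,
    Ring.lie_def, sub_mul, mul_sub, Matrix.trace_sub, h, h']
  ring

/-- The two-cocycle `(x t^a, y t^b) ↦ a δ_{a+b,0} tr(xy)` of the loop algebra `sl(N)[t, t⁻¹]`
(Mathlib's cocycle of a form `B` is `b δ_{a+b,0} B(x, y)`, whence the sign of the form). -/
abbrev cocycle :=
  LieAlgebra.LoopAlgebra.twoCocycleOfBilinear ℂ ℤ (Base N) (negTraceForm N)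
    (negTraceForm_invariant N) (negTraceForm_symm N)

end AffineSl

/-- The affine Lie algebra `sl(N)^ = sl(N) ⊗ ℂ[t, t⁻¹] ⊕ ℂ c`, with `c` central and
`[x t^a, y t^b] = [x, y] t^(a+b) + a δ_{a+b,0} tr(xy) c`. -/
abbrev AffineSl (N : ℕ) [NeZero N] : Type := LieAlgebra.ofTwoCocycle (AffineSl.cocycle N)

namespace AffineSl

variable (N : ℕ) [NeZero N]

/-- The element `x t^s` of the affine Lie algebra. -/
def loop (x : Base N) (s : ℤ) : AffineSl N :=
  LieAlgebra.ofProd _ (AddMonoidAlgebra.single s 1 ⊗ₜ[ℂ] x, 0)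

/-- The central element `c`. -/
def central : AffineSl N :=
  LieAlgebra.ofProd _ (0, (TrivialLieModule.equiv ℂ _ ℂ).symm 1)

/-- The bracket is the usual one. -/
lemma loop_lie_loop (x y : Base N) (a b : ℤ) :
    ⁅loop N x a, loop N y b⁆ =
      loop N ⁅x, y⁆ (a + b) +
        (if a + b = 0 then (a : ℂ) * Matrix.trace (x.val * y.val) else 0) • central N := by
  have hF (z : Base N) (c : ℤ) : LieAlgebra.LoopAlgebra.toFinsupp ℂ ℤ (Base N)
      (AddMonoidAlgebra.single c 1 ⊗ₜ[ℂ] z) = Finsupp.single c z :=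
    LieAlgebra.LoopAlgebra.toFinsupp_single_tmul ..
  have hr : LieAlgebra.LoopAlgebra.residuePairing ℂ ℤ (Base N) (negTraceForm N)
      (AddMonoidAlgebra.single a 1 ⊗ₜ[ℂ] x) (AddMonoidAlgebra.single b 1 ⊗ₜ[ℂ] y) =
      if a + b = 0 then (a : ℂ) * Matrix.trace (x.val * y.val) else 0 := by
    rw [LieAlgebra.LoopAlgebra.residuePairing_apply_apply, hF, hF,
      Finsupp.sum_single_index (by simp)]
    by_cases h : a + b = 0
    · obtain rfl : b = -a := by omega
      simp [negTraceForm]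
    · rw [Finsupp.single_eq_of_ne (by omega), if_neg h]
      simp
  rw [LieAlgebra.bracket_ofTwoCocycle, ← hr, loop, loop, loop, central, ← LieAlgebra.of_smul,
    ← LieAlgebra.of_add]
  refine congrArg (LieAlgebra.ofProd (cocycle N)) (Prod.ext ?_ ?_)
  · simp only [Equiv.symm_apply_apply, Prod.fst_add, Prod.smul_fst, smul_zero, add_zero,
      LieAlgebra.ExtendScalars.bracket_tmul, AddMonoidAlgebra.single_mul_single, mul_one]
  · simp only [Equiv.symm_apply_apply, Prod.snd_add, Prod.smul_snd, lie_zero, sub_zero, add_zero,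
      zero_add]
    rw [← map_smul, smul_eq_mul, mul_one]
    rfl

lemma central_lie (x : AffineSl N) : ⁅central N, x⁆ = 0 := by
  rw [LieAlgebra.bracket_ofTwoCocycle, central, ← LieAlgebra.of_zero]
  refine congrArg (LieAlgebra.ofProd (cocycle N)) (Prod.ext ?_ ?_)
  · simp
  · simp only [Equiv.symm_apply_apply, map_zero, LinearMap.zero_apply, zero_add,
      LieModule.IsTrivial.trivial, sub_zero, Prod.snd_zero]

/-- `E_{i,j} t^s` for `i ≠ j` (and the default value `0` for `i = j`, which is never used). -/
def E (i j : ZMod N) (s : ℤ) : AffineSl N :=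
  if h : i ≠ j then loop N (LieAlgebra.SpecialLinear.single i j h 1) s else 0

/-- The Chevalley generators `e_i`: `e_0 = E_{N,1} t` and `e_i = E_{i,i+1}` for `i ≠ 0`. -/
def e (i : ZMod N) : AffineSl N := E N i (i + 1) (if i = 0 then 1 else 0)

/-- The Chevalley generators `f_i`: `f_0 = E_{1,N} t⁻¹` and `f_i = E_{i+1,i}` for `i ≠ 0`. -/
def f (i : ZMod N) : AffineSl N := E N (i + 1) i (if i = 0 then -1 else 0)

/-- The Chevalley generators `h_i`: `h_0 = E_{N,N} - E_{1,1} + c` and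
`h_i = E_{i,i} - E_{i+1,i+1}` for `i ≠ 0`. -/
def h (i : ZMod N) : AffineSl N :=
  loop N (LieAlgebra.SpecialLinear.singleSubSingle i (i + 1) 1) 0 +
    (if i = 0 then central N else 0)

end AffineSl

/-! ### The affine Yangian in the minimalistic presentation -/

namespace AffineYangian

/-- The entries `a_{i,j}` of the Cartan matrix of type `A_{n-1}^{(1)}` (for `n ≥ 3`). -/
def cartan (n : ℕ) (i j : ZMod n) : ℤ :=
  if i = j then 2 else if j = i + 1 ∨ j = i - 1 then -1 else 0

/-- The generators `H_{i,r}`, `X^+_{i,r} = X 1 i r`, `X^-_{i,r} = X (-1) i r`,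
`i ∈ ℤ/nℤ`, `r ∈ {0, 1}`. -/
inductive Gen (n : ℕ) : Type
  | H (i : ZMod n) (r : Fin 2) : Gen n
  | X (σ : ℤˣ) (i : ZMod n) (r : Fin 2) : Gen n

variable (n : ℕ) (ħ ε : ℂ)

/-- The free associative algebra on the generators. -/
abbrev Free : Type := FreeAlgebra ℂ (Gen n)

variable {n} in
/-- `H_{i,r}` in the free algebra. -/
def fH (i : ZMod n) (r : Fin 2) : Free n := FreeAlgebra.ι ℂ (Gen.H i r)

variable {n} in
/-- `X^σ_{i,r}` in the free algebra. -/
def fX (σ : ℤˣ) (i : ZMod n) (r : Fin 2) : Free n := FreeAlgebra.ι ℂ (Gen.X σ i r)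

variable {n} in
/-- `H̃_{i,1} = H_{i,1} - (ħ/2) H_{i,0}²` in the free algebra. -/
def fHt (i : ZMod n) : Free n := fH i 1 - (ħ / 2) • fH i 0 ^ 2

/-- The sign `σ = ±1` as a complex number. -/
def sgn (σ : ℤˣ) : ℂ := ((σ : ℤ) : ℂ)

/-- The defining relations; `[a, b] = ab - ba` and the node `n - 1` is `-1 : ZMod n`. -/
inductive Rel : Free n → Free n → Prop
  | H_H (i j : ZMod n) (r s : Fin 2) : Rel ⁅fH i r, fH j s⁆ 0
  | X0_X0 (i j : ZMod n) : Rel ⁅fX 1 i 0, fX (-1) j 0⁆ (if i = j then fH i 0 else 0)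
  | X1_X0 (i j : ZMod n) : Rel ⁅fX 1 i 1, fX (-1) j 0⁆ (if i = j then fH i 1 else 0)
  | X0_X1 (i j : ZMod n) : Rel ⁅fX 1 i 0, fX (-1) j 1⁆ (if i = j then fH i 1 else 0)
  | H0_X (σ : ℤˣ) (i j : ZMod n) (r : Fin 2) :
      Rel ⁅fH i 0, fX σ j r⁆ ((sgn σ * cartan n i j) • fX σ j r)
  | Ht_X (σ : ℤˣ) (i j : ZMod n) (h₁ : (i, j) ≠ (0, -1)) (h₂ : (i, j) ≠ (-1, 0)) :
      Rel ⁅fHt ħ i, fX σ j 0⁆ ((sgn σ * cartan n i j) • fX σ j 1)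
  | Ht_X_zero_last (σ : ℤˣ) :
      Rel ⁅fHt ħ (0 : ZMod n), fX σ (-1 : ZMod n) 0⁆
        ((-sgn σ) • (fX σ (-1) 1 + (ε + n / 2 * ħ) • fX σ (-1) 0))
  | Ht_X_last_zero (σ : ℤˣ) :
      Rel ⁅fHt ħ (-1 : ZMod n), fX σ (0 : ZMod n) 0⁆
        ((-sgn σ) • (fX σ 0 1 - (ε + n / 2 * ħ) • fX σ 0 0))
  | X_X (σ : ℤˣ) (i j : ZMod n) (h₁ : (i, j) ≠ (0, -1)) (h₂ : (i, j) ≠ (-1, 0)) :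
      Rel (⁅fX σ i 1, fX σ j 0⁆ - ⁅fX σ i 0, fX σ j 1⁆)
        ((sgn σ * cartan n i j * (ħ / 2)) • (fX σ i 0 * fX σ j 0 + fX σ j 0 * fX σ i 0))
  | X_X_zero_last (σ : ℤˣ) :
      Rel (⁅fX σ (0 : ZMod n) 1, fX σ (-1 : ZMod n) 0⁆ - ⁅fX σ (0 : ZMod n) 0, fX σ (-1 : ZMod n) 1⁆)
        ((-sgn σ * (ħ / 2)) • (fX σ 0 0 * fX σ (-1) 0 + fX σ (-1) 0 * fX σ 0 0)
          + (ε + n / 2 * ħ) • ⁅fX σ (0 : ZMod n) 0, fX σ (-1 : ZMod n) 0⁆)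
  | serre (σ : ℤˣ) (i j : ZMod n) (h : i ≠ j) :
      Rel ((fun y => ⁅fX σ i 0, y⁆)^[1 + (cartan n i j).natAbs] (fX σ j 0)) 0

end AffineYangian

/-- The affine Yangian `Y_{ħ,ε}(sl(n)^)` in the minimalistic presentation (for `n ≥ 3`). -/
def AffineYangian (n : ℕ) (ħ ε : ℂ) : Type := RingQuot (AffineYangian.Rel n ħ ε)

namespace AffineYangian

variable (n : ℕ) (ħ ε : ℂ)

instance : Ring (AffineYangian n ħ ε) := inferInstanceAs (Ring (RingQuot (Rel n ħ ε)))

instance : Algebra ℂ (AffineYangian n ħ ε) :=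
  inferInstanceAs (Algebra ℂ (RingQuot (Rel n ħ ε)))

/-- The quotient map from the free algebra. -/
def mk : Free n →ₐ[ℂ] AffineYangian n ħ ε := RingQuot.mkAlgHom ℂ (Rel n ħ ε)

lemma mk_surjective : Function.Surjective (mk n ħ ε) := RingQuot.mkAlgHom_surjective ℂ _

/-- The image of a generator in the Yangian. -/
def gen (g : Gen n) : AffineYangian n ħ ε := mk n ħ ε (FreeAlgebra.ι ℂ g)

variable {n} in
/-- The generator `H_{i,r}`. -/
def H (i : ZMod n) (r : Fin 2) : AffineYangian n ħ ε := gen n ħ ε (Gen.H i r)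

variable {n} in
/-- The generator `X^σ_{i,r}`. -/
def X (σ : ℤˣ) (i : ZMod n) (r : Fin 2) : AffineYangian n ħ ε := gen n ħ ε (Gen.X σ i r)

variable {n} in
/-- `H̃_{i,1} = H_{i,1} - (ħ/2) H_{i,0}²`. -/
def Ht (i : ZMod n) : AffineYangian n ħ ε := H ħ ε i 1 - (ħ / 2) • H ħ ε i 0 ^ 2

/-- A property that holds for scalars and generators, and is stable under sums and products,
holds on the whole Yangian. -/
lemma induction {P : AffineYangian n ħ ε → Prop} (hs : ∀ c : ℂ, P (algebraMap ℂ _ c))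
    (hg : ∀ g, P (gen n ħ ε g)) (hm : ∀ x y, P x → P y → P (x * y))
    (ha : ∀ x y, P x → P y → P (x + y)) (x : AffineYangian n ħ ε) : P x := by
  obtain ⟨y, rfl⟩ := mk_surjective n ħ ε x
  induction y using FreeAlgebra.induction with
  | grade0 r => rw [AlgHom.commutes]; exact hs r
  | grade1 g => exact hg g
  | mul a b h₁ h₂ => rw [map_mul]; exact hm _ _ h₁ h₂
  | add a b h₁ h₂ => rw [map_add]; exact ha _ _ h₁ h₂

/-! ### The grading -/

/-- The degrees of the generators: `X^±_{0,r}` has degree `±1`, the others have degree `0`. -/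
def Gen.degree {n : ℕ} : Gen n → ℤ
  | .H _ _ => 0
  | .X σ i _ => if i = 0 then (σ : ℤ) else 0

/-- The homogeneous part of degree `d`: the span of the words of degree `d` in the generators. -/
def homogeneous (d : ℤ) : Submodule ℂ (AffineYangian n ħ ε) :=
  Submodule.span ℂ {x | ∃ w : List (Gen n),
    (w.map Gen.degree).sum = d ∧ x = (w.map (gen n ħ ε)).prod}

lemma mul_mem_homogeneous {d d' : ℤ} {x y : AffineYangian n ħ ε}
    (hx : x ∈ homogeneous n ħ ε d) (hy : y ∈ homogeneous n ħ ε d') :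
    x * y ∈ homogeneous n ħ ε (d + d') := by
  have h := Submodule.mul_mem_mul hx hy
  rw [homogeneous, homogeneous, Submodule.span_mul_span] at h
  refine Submodule.span_mono ?_ h
  rintro _ ⟨_, ⟨w, hw, rfl⟩, _, ⟨w', hw', rfl⟩, rfl⟩
  exact ⟨w ++ w', by simp [hw, hw'], by simp⟩

lemma gen_mem_homogeneous (g : Gen n) : gen n ħ ε g ∈ homogeneous n ħ ε g.degree :=
  Submodule.subset_span ⟨[g], by simp, by simp⟩

lemma one_mem_homogeneous : (1 : AffineYangian n ħ ε) ∈ homogeneous n ħ ε 0 :=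
  Submodule.subset_span ⟨[], by simp, by simp⟩

/-! ### The degreewise completion

With `Y = ⨁ Y(d)` and `I_k(d) = ∑_{r ≥ k} Y(d - r) Y(r)`, the degreewise completion is
`⨁_d lim_k Y(d) / I_k(d)`. It is realized inside the completion of `Y` for the ring topology given
by the left ideals `J_k = ∑_{r ≥ k} Y Y(r)`, for which `J_k ∩ Y(d) = I_k(d)`: the closure of `Y(d)`
is `lim_k Y(d) / I_k(d)`, and the degreewise completion is the sum of these closures. -/

/-- The left ideal `J_k` generated by the homogeneous elements of degree at least `k`. -/
def J (k : ℕ) : Ideal (AffineYangian n ħ ε) :=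
  Ideal.span {x | ∃ r : ℤ, (k : ℤ) ≤ r ∧ x ∈ homogeneous n ħ ε r}

lemma J_antitone {k l : ℕ} (h : k ≤ l) : J n ħ ε l ≤ J n ħ ε k := by
  refine Ideal.span_mono ?_
  rintro x ⟨r, hr, hx⟩
  exact ⟨r, by omega, hx⟩

lemma J_mul_right (x : AffineYangian n ħ ε) :
    ∀ k : ℕ, ∃ l : ℕ, ∀ y ∈ J n ħ ε l, y * x ∈ J n ħ ε k := by
  induction x using induction with
  | hs c =>
    intro k
    refine ⟨k, fun y hy => ?_⟩
    rw [← Algebra.commutes]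
    exact Ideal.mul_mem_left _ _ hy
  | hg g =>
    intro k
    refine ⟨k + g.degree.natAbs, fun y hy => ?_⟩
    refine Submodule.span_induction (p := fun y _ => y * gen n ħ ε g ∈ J n ħ ε k)
      ?_ ?_ ?_ ?_ hy
    · rintro z ⟨r, hr, hz⟩
      refine Ideal.subset_span ⟨r + g.degree, ?_,
        mul_mem_homogeneous n ħ ε hz (gen_mem_homogeneous n ħ ε g)⟩
      push_cast at hr
      have := neg_abs_le g.degree
      omega
    · simp
    · intro a b _ _ h₁ h₂
      rw [add_mul]
      exact add_mem h₁ h₂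
    · intro a b _ h₁
      rw [smul_eq_mul, mul_assoc]
      exact Ideal.mul_mem_left _ _ h₁
  | hm a b ha hb =>
    intro k
    obtain ⟨l, hl⟩ := hb k
    obtain ⟨m, hm⟩ := ha l
    refine ⟨m, fun y hy => ?_⟩
    rw [← mul_assoc]
    exact hl _ (hm _ hy)
  | ha a b ha hb =>
    intro k
    obtain ⟨l, hl⟩ := ha k
    obtain ⟨m, hm⟩ := hb k
    refine ⟨max l m, fun y hy => ?_⟩
    rw [mul_add]
    exact add_mem (hl _ (J_antitone n ħ ε (le_max_left _ _) hy))
      (hm _ (J_antitone n ħ ε (le_max_right _ _) hy))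

lemma J_basis : RingSubgroupsBasis fun k : ℕ => (J n ħ ε k).toAddSubgroup where
  inter i j := ⟨max i j, le_inf (J_antitone n ħ ε (le_max_left _ _))
    (J_antitone n ħ ε (le_max_right _ _))⟩
  mul i := by
    refine ⟨i, ?_⟩
    rintro _ ⟨x, -, y, hy, rfl⟩
    exact Ideal.mul_mem_left _ _ hy
  leftMul x i := ⟨i, fun y hy => Ideal.mul_mem_left _ _ hy⟩
  rightMul x i := J_mul_right n ħ ε x i

/-- The topology with the basis `J_k` of neighbourhoods of zero, as a uniform structure. -/
instance : UniformSpace (AffineYangian n ħ ε) :=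
  @IsTopologicalAddGroup.rightUniformSpace _ _ (J_basis n ħ ε).topology
    (@IsTopologicalRing.to_topologicalAddGroup _ _ (J_basis n ħ ε).topology
      (J_basis n ħ ε).toRingFilterBasis.isTopologicalRing)

instance : IsTopologicalRing (AffineYangian n ħ ε) :=
  (J_basis n ħ ε).toRingFilterBasis.isTopologicalRing

instance : IsUniformAddGroup (AffineYangian n ħ ε) := isUniformAddGroup_of_addCommGroup

/-- The topology is the one generated by the left ideals `J_k`. -/
lemma hasBasis_nhds_zero :
    (𝓝 (0 : AffineYangian n ħ ε)).HasBasis (fun _ => True)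
      fun k : ℕ => (J n ħ ε k : Set (AffineYangian n ħ ε)) :=
  (J_basis n ħ ε).hasBasis_nhds_zero

instance : ContinuousConstSMul ℂ (AffineYangian n ħ ε) where
  continuous_const_smul c := by
    simp only [Algebra.smul_def]
    exact continuous_const_mul _

instance : UniformContinuousConstSMul ℂ (AffineYangian n ħ ε) :=
  uniformContinuousConstSMul_of_continuousConstSMul _ _

/-- The completion for the topology given by the left ideals `J_k`. -/
abbrev BigCompletion : Type := UniformSpace.Completion (AffineYangian n ħ ε)

/-- The canonical map to the completion. -/
def toBig : AffineYangian n ħ ε →ₐ[ℂ] BigCompletion n ħ ε where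
  __ := UniformSpace.Completion.coeRingHom
  commutes' _ := rfl

lemma continuous_toBig : Continuous (toBig n ħ ε) :=
  UniformSpace.Completion.continuous_coe _

/-- The completed homogeneous part of degree `d`. -/
def completedPart (d : ℤ) : Submodule ℂ (BigCompletion n ħ ε) :=
  ((homogeneous n ħ ε d).map (toBig n ħ ε).toLinearMap).topologicalClosure

lemma toBig_mem_completedPart {d : ℤ} {x : AffineYangian n ħ ε}
    (hx : x ∈ homogeneous n ħ ε d) : toBig n ħ ε x ∈ completedPart n ħ ε d :=
  Submodule.le_topologicalClosure _ ⟨x, hx, rfl⟩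

lemma mul_mem_completedPart {d d' : ℤ} {x y : BigCompletion n ħ ε}
    (hx : x ∈ completedPart n ħ ε d) (hy : y ∈ completedPart n ħ ε d') :
    x * y ∈ completedPart n ħ ε (d + d') := by
  refine map_mem_closure₂ continuous_mul hx hy ?_
  rintro _ ⟨a, ha, rfl⟩ _ ⟨b, hb, rfl⟩
  exact ⟨a * b, mul_mem_homogeneous n ħ ε ha hb, by simp⟩

/-- The degreewise completion `Ỹ_{ħ,ε}(sl(n)^)`, with the subspace topology. -/
def DegreewiseCompletion : Subalgebra ℂ (BigCompletion n ħ ε) :=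
  Submodule.toSubalgebra (⨆ d : ℤ, completedPart n ħ ε d)
    (Submodule.mem_iSup_of_mem 0 (by
      simpa using toBig_mem_completedPart n ħ ε (one_mem_homogeneous n ħ ε)))
    (by
      intro x y hx hy
      have h := Submodule.mul_mem_mul hx hy
      rw [Submodule.iSup_mul] at h
      refine (iSup_le fun d => ?_ :
        (⨆ d, completedPart n ħ ε d * ⨆ d', completedPart n ħ ε d') ≤ _) h
      rw [Submodule.mul_iSup]
      refine iSup_le fun d' => ?_
      rw [Submodule.mul_le]
      intro a ha b hb
      exact Submodule.mem_iSup_of_mem (d + d') (mul_mem_completedPart n ħ ε ha hb))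

lemma toBig_mem (x : AffineYangian n ħ ε) : toBig n ħ ε x ∈ DegreewiseCompletion n ħ ε := by
  induction x using induction with
  | hs c => rw [AlgHom.commutes]; exact Subalgebra.algebraMap_mem _ _
  | hg g =>
    exact Submodule.mem_iSup_of_mem g.degree
      (toBig_mem_completedPart n ħ ε (gen_mem_homogeneous n ħ ε g))
  | hm a b ha hb => rw [map_mul]; exact mul_mem ha hb
  | ha a b ha hb => rw [map_add]; exact add_mem ha hb

/-- The canonical map from the Yangian to its degreewise completion. -/
def toCompletion : AffineYangian n ħ ε →ₐ[ℂ] DegreewiseCompletion n ħ ε :=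
  (toBig n ħ ε).codRestrict _ (toBig_mem n ħ ε)

/-! ### The natural homomorphism and the homomorphism `Ψ` -/

variable {n ħ ε}

/-- The universal enveloping algebra of `sl(N)^`. -/
abbrev Env (N : ℕ) [NeZero N] : Type := UniversalEnvelopingAlgebra ℂ (AffineSl N)

/-- `φ` is the natural homomorphism from `U(sl(N)^)` to the Yangian: it sends the Chevalley generators `e_i, f_i, h_i` to
`X^+_{i,0}, X^-_{i,0}, H_{i,0}`. -/
def IsNatural {N : ℕ} [NeZero N] (φ : Env N →ₐ[ℂ] AffineYangian N ħ ε) : Prop :=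
  ∀ i : ZMod N, φ (UniversalEnvelopingAlgebra.ι ℂ (AffineSl.e N i)) = X ħ ε 1 i 0 ∧
    φ (UniversalEnvelopingAlgebra.ι ℂ (AffineSl.f N i)) = X ħ ε (-1) i 0 ∧
    φ (UniversalEnvelopingAlgebra.ι ℂ (AffineSl.h N i)) = H ħ ε i 0

/-- The image of `E_{i,j} t^s` (`i ≠ j`) in the completed Yangian. -/
def root {N : ℕ} [NeZero N] (φ : Env N →ₐ[ℂ] AffineYangian N ħ ε) (i j : ℕ) (s : ℤ) :
    DegreewiseCompletion N ħ ε :=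
  toCompletion N ħ ε (φ (UniversalEnvelopingAlgebra.ι ℂ (AffineSl.E N i j s)))

/-- The term `E_{i,n+1} t^(-s-1) E_{n+1,j} t^(s+1)`. -/
def term (φ : Env (n + 1) →ₐ[ℂ] AffineYangian (n + 1) ħ ε) (i j : ℕ) (s : ℕ) :
    DegreewiseCompletion (n + 1) ħ ε :=
  root φ i (n + 1) (-s - 1) * root φ (n + 1) j (s + 1)

/-- The infinite sum `∑_{s ≥ 0} E_{i,n+1} t^(-s-1) E_{n+1,j} t^(s+1)`. -/
def termSum (φ : Env (n + 1) →ₐ[ℂ] AffineYangian (n + 1) ħ ε) (i j : ℕ) :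
    DegreewiseCompletion (n + 1) ħ ε :=
  ∑' s : ℕ, term φ i j s

/-- The formulas that determine `Ψ`. Here `i = 1, …, n - 1` stands for a node of both diagrams. -/
structure IsPsi (φ : Env (n + 1) →ₐ[ℂ] AffineYangian (n + 1) ħ ε)
    (Ψ : AffineYangian n ħ ε →ₐ[ℂ] DegreewiseCompletion (n + 1) ħ ε) : Prop where
  H_zero : Ψ (H ħ ε 0 0) = toCompletion _ ħ ε (H ħ ε 0 0 + H ħ ε (n : ZMod (n + 1)) 0)
  H_ne_zero : ∀ i : ℕ, 1 ≤ i → i < n →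
    Ψ (H ħ ε i 0) = toCompletion _ ħ ε (H ħ ε i 0)
  Xp_zero : Ψ (X ħ ε 1 0 0) = root φ n 1 1
  Xp_ne_zero : ∀ i : ℕ, 1 ≤ i → i < n → Ψ (X ħ ε 1 i 0) = root φ i (i + 1) 0
  Xm_zero : Ψ (X ħ ε (-1) 0 0) = root φ 1 n (-1)
  Xm_ne_zero : ∀ i : ℕ, 1 ≤ i → i < n → Ψ (X ħ ε (-1) i 0) = root φ (i + 1) i 0
  H_one : ∀ i : ℕ, 1 ≤ i → i < n →
    Ψ (H ħ ε i 1) = toCompletion _ ħ ε (H ħ ε i 1)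
      - ħ • termSum φ i i + ħ • termSum φ (i + 1) (i + 1)
  Xp_one : ∀ i : ℕ, 1 ≤ i → i < n →
    Ψ (X ħ ε 1 i 1) = toCompletion _ ħ ε (X ħ ε 1 i 1) - ħ • termSum φ i (i + 1)
  Xm_one : ∀ i : ℕ, 1 ≤ i → i < n →
    Ψ (X ħ ε (-1) i 1) = toCompletion _ ħ ε (X ħ ε (-1) i 1) - ħ • termSum φ (i + 1) i

end AffineYangian

end

/-!
The statement has two independent parts: the homomorphism from the affine Lie algebra exists, and
the images prescribed for the generators of the smaller Yangian satisfy its relations.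

**The homomorphism from the affine Lie algebra.** The generators `X^±_{i,0}` satisfy the Serre
relations of `sl(N)^`, so a homomorphism from the affine Lie algebra amounts to the theorem that
these relations present it. For `N ≥ 4` this is proved by constructing the root vectors
`E_ij t^r`, `i ≠ j`, as a family `Z r i j` of elements of an arbitrary complex Lie algebra with
`[Z r i j, Z s k l] = δ_jk Z (r + s) i l - δ_il Z (r + s) k j` whenever `(k, l) ≠ (j, i)`
(`Steinberg.MatProd`). The `X^±_{i,0}` with `i ≠ 0` generate `Z 0`
(`Steinberg.ChevalleySl.exists_matProd`), the vectors `X^±_{0,0}` are extremal vectors of copies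
of the adjoint representation (`Steinberg.exists_family`), which are `Z 1` and `Z (-1)`, and all
other powers arise as products (`Steinberg.exists_loop`). The remaining brackets
`[Z r i j, Z s j i]` are governed by a central element: their deviation from
`[Z (r + s) i j, Z 0 j i]` does not depend on the labels and is a cocycle in `(r, s)`, hence a
multiple of `r δ_{r+s,0}` (`Steinberg.centralTerm_eq_smul`). So the family extends to a
homomorphism (`AffineSl.affineHom`).

**Convergence.** The image of `E_ij t^r` has degree `r`
(`AffineYangian.loopE_mem_homogeneous`). The terms of `P_ij` therefore tend to zero in a complete
nonarchimedean group, and their sum stays in the completion of the part of degree zero.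

**The relations.** With `Ψ(X^±_{i,r})` and `Ψ(H_{i,r})` prescribed except for the generators
`H_{0,1}` and `X^±_{0,1}`, the latter are forced:
`X^±_{0,1} = ∓[H̃_{1,1}, X^±_{0,0}]` and `H_{0,1} = [X^+_{0,1}, X^-_{0,0}]`. This gives uniqueness
(`AffineYangian.algHom_ext_of_ne_zero`), and it defines the images whose relations have to be
checked. Interchanging `X^+` and `X^-` is an anti-automorphism compatible with all the images, so
that only the relations of `X^+` need a computation (`AffineYangian.HalfRelations`).

The brackets of `P_ij` with root vectors of `sl(n)` are those of matrix units, term by term. With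
the root vector `E_n1 t` of the node `0` the brackets with `P_11` and `P_nn` are infinite sums,
but these nearly cancel: by telescoping, `[P_11 + P_nn, E_n1 t] = -E_{n,n+1} E_{n+1,1} t`
(`AffineYangian.SumRep.P_one_add_P_last_lie`). This is what reconciles the two expressions of the
image of `X^+_{0,1}`, through `[X^+_{n,0}, X^+_{0,1}]` and through `[X^+_{n,1}, X^+_{0,0}]`, and it
accounts for the shift of the parameter from `(n + 1)ħ/2` to `nħ/2`.

The main point is that the images of the `H̃_{i,1}` commute. For `i ≠ 0` this holds already for
the finite partial sums of the series, ordered lexicographically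
(`AffineYangian.LoopRep.lie_partialSum`): adding the term `E_{l,n+1} t^(-m-1) E_{n+1,l} t^(m+1)` to
two commuting partial sums keeps them commuting, because the linear combination in which this term
cancels acts on `E_{n+1,l} t^(m+1)` by a scalar and on `E_{l,n+1} t^(-m-1)` by the opposite one, and
hence commutes with their product. The first of these actions is computed by induction on `m` in
`AffineYangian.LoopRep.lie_row`. For the node `0`, commutation follows formally from the relations
that are known by then (`AffineYangian.SumRep.imHt_one_lie_imH₁_zero_eq_zero`); the case `n = 3`,
where no node is far from the node `0`, needs a separate argument.
-/

noncomputable section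

/-! ### Families that multiply like matrix units -/

namespace Steinberg

variable {L : Type*} [LieRing L]

/-- The families `F`, `G`, `H` of elements of a Lie ring multiply like off-diagonal matrix units
with labels in `[a, b]`: `[F_ij, G_kl] = δ_jk H_il - δ_il H_kj` whenever the right-hand side has
no diagonal term. -/
def MatProd (a b : ℕ) (F G H : ℕ → ℕ → L) : Prop :=
  ∀ i j k l : ℕ, (a ≤ i ∧ i ≤ b ∧ a ≤ j ∧ j ≤ b ∧ a ≤ k ∧ k ≤ b ∧ a ≤ l ∧ l ≤ b ∧
    i ≠ j ∧ k ≠ l ∧ ¬(j = k ∧ i = l)) →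
    ⁅F i j, G k l⁆ = (if j = k then H i l else 0) - (if i = l then H k j else 0)

namespace MatProd

variable {a b : ℕ} {F G H : ℕ → ℕ → L}

lemma of_cases
    (h₁ : ∀ i j l, (a ≤ i ∧ i ≤ b ∧ a ≤ j ∧ j ≤ b ∧ a ≤ l ∧ l ≤ b ∧ i ≠ j ∧ j ≠ l ∧ i ≠ l) →
      ⁅F i j, G j l⁆ = H i l)
    (h₂ : ∀ i j k, (a ≤ i ∧ i ≤ b ∧ a ≤ j ∧ j ≤ b ∧ a ≤ k ∧ k ≤ b ∧ i ≠ j ∧ j ≠ k ∧ i ≠ k) →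
      ⁅F i j, G k i⁆ = -H k j)
    (h₃ : ∀ i j k l, (a ≤ i ∧ i ≤ b ∧ a ≤ j ∧ j ≤ b ∧ a ≤ k ∧ k ≤ b ∧ a ≤ l ∧ l ≤ b ∧
      i ≠ j ∧ k ≠ l ∧ j ≠ k ∧ i ≠ l) → ⁅F i j, G k l⁆ = 0) : MatProd a b F G H := by
  intro i j k l h
  by_cases hjk : j = k
  · subst hjk
    rw [if_pos rfl, if_neg (by omega), sub_zero, h₁ _ _ _ (by omega)]
  · rw [if_neg hjk, zero_sub]
    by_cases hil : i = l
    · subst hil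
      rw [if_pos rfl, h₂ _ _ _ (by omega)]
    · rw [if_neg hil, neg_zero, h₃ _ _ _ _ (by omega)]

lemma mul (h : MatProd a b F G H) {i j l : ℕ}
    (hi : a ≤ i ∧ i ≤ b ∧ a ≤ j ∧ j ≤ b ∧ a ≤ l ∧ l ≤ b ∧ i ≠ j ∧ j ≠ l ∧ i ≠ l := by omega) :
    ⁅F i j, G j l⁆ = H i l := by
  rw [h i j j l (by omega), if_pos rfl, if_neg (by omega), sub_zero]

lemma mul_neg (h : MatProd a b F G H) {i j k : ℕ}
    (hi : a ≤ i ∧ i ≤ b ∧ a ≤ j ∧ j ≤ b ∧ a ≤ k ∧ k ≤ b ∧ i ≠ j ∧ j ≠ k ∧ i ≠ k := by omega) :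
    ⁅F i j, G k i⁆ = -H k j := by
  rw [h i j k i (by omega), if_pos rfl, if_neg (by omega), zero_sub]

lemma zero (h : MatProd a b F G H) {i j k l : ℕ}
    (hi : a ≤ i ∧ i ≤ b ∧ a ≤ j ∧ j ≤ b ∧ a ≤ k ∧ k ≤ b ∧ a ≤ l ∧ l ≤ b ∧
      i ≠ j ∧ k ≠ l ∧ j ≠ k ∧ i ≠ l := by omega) :
    ⁅F i j, G k l⁆ = 0 := by
  rw [h i j k l (by omega), if_neg (by omega), if_neg (by omega), sub_zero]

lemma symm (h : MatProd a b F G H) : MatProd a b G F H := by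
  intro i j k l hi
  rw [← lie_skew, h k l i j (by omega), neg_sub]
  simp only [eq_comm]

/-- The automorphism `x ↦ -xᵀ`. -/
lemma dual (h : MatProd a b F G H) :
    MatProd a b (fun i j => -F j i) (fun i j => -G j i) (fun i j => -H j i) := by
  intro i j k l hi
  rw [lie_neg, neg_lie, neg_neg, h j i l k (by omega)]
  split_ifs <;> simp_all

lemma mono {a' b' : ℕ} (h : MatProd a b F G H) (ha : a ≤ a') (hb : b' ≤ b) :
    MatProd a' b' F G H := fun i j k l hi => h i j k l (by omega)

end MatProd

/-- Among four labels there is one different from three given ones. -/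
lemma exists_label {N : ℕ} (hN : 4 ≤ N) (i j k : ℕ) :
    ∃ m, 1 ≤ m ∧ m ≤ N ∧ m ≠ i ∧ m ≠ j ∧ m ≠ k := by
  by_contra! h
  have h₁ := h 1
  have h₂ := h 2
  have h₃ := h 3
  have h₄ := h 4
  omega

lemma eq_zero_of_add_self {V : Type*} [AddCommGroup V] [Module ℂ V] {x : V} (h : x + x = 0) :
    x = 0 := by
  have : (2 : ℂ) • x = 0 := by rw [two_smul, h]
  simpa using this

/-- The column `c_m = w`, `c_i = [E_im, w]` through `w`. -/
def column (E : ℕ → ℕ → L) (m : ℕ) (w : L) (i : ℕ) : L := if i = m then w else ⁅E i m, w⁆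

lemma column_self (E : ℕ → ℕ → L) (m : ℕ) (w : L) : column E m w m = w := if_pos rfl

lemma column_of_ne (E : ℕ → ℕ → L) {m i : ℕ} (w : L) (h : i ≠ m) : column E m w i = ⁅E i m, w⁆ :=
  if_neg h

variable [LieAlgebra ℂ L]

/-- If `w` behaves like the `m`-th basis vector under `sl₂` for one pair of labels and is
annihilated by all `E_kl`, `l ≠ m`, then it generates the vector representation. -/
lemma lie_column {a b : ℕ} {E : ℕ → ℕ → L} (hE : MatProd a b E E E) {w : L} {m p : ℕ}
    (hm : a ≤ m ∧ m ≤ b) (hp : a ≤ p ∧ p ≤ b ∧ p ≠ m)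
    (w₁ : ∀ k l, (a ≤ k ∧ k ≤ b ∧ a ≤ l ∧ l ≤ b ∧ k ≠ l ∧ l ≠ m) → ⁅E k l, w⁆ = 0)
    (w₀ : ⁅E m p, ⁅E p m, w⁆⁆ = w) (w₂ : ⁅E p m, ⁅E p m, w⁆⁆ = 0)
    {k l i : ℕ} (h : a ≤ k ∧ k ≤ b ∧ a ≤ l ∧ l ≤ b ∧ a ≤ i ∧ i ≤ b ∧ k ≠ l) :
    ⁅E k l, column E m w i⁆ = if l = i then column E m w k else 0 := by
  -- one application of `E_kp`
  have w₂' : ∀ k, a ≤ k → k ≤ b → k ≠ m → ⁅E k m, ⁅E p m, w⁆⁆ = 0 := by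
    intro k hk hk' hkm
    by_cases hkp : k = p
    · rw [hkp, w₂]
    have h₀ := congrArg (fun z => ⁅E k p, z⁆) w₂
    simp only [leibniz_lie (E k p), hE.mul (i := k) (j := p) (l := m), w₁ k p (by omega),
      lie_zero, add_zero] at h₀
    rw [leibniz_lie (E p m), hE.zero (i := p) (j := m) (k := k) (l := m), zero_lie, zero_add] at h₀
    exact eq_zero_of_add_self h₀
  have w₂'' : ∀ k i, (a ≤ k ∧ k ≤ b ∧ k ≠ m ∧ a ≤ i ∧ i ≤ b ∧ i ≠ m) →
      ⁅E k m, ⁅E i m, w⁆⁆ = 0 := by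
    intro k i h
    by_cases hip : i = p
    · rw [hip, w₂' k] <;> omega
    have h₀ := congrArg (fun z => ⁅E i p, z⁆) (w₂' k (by omega) (by omega) (by omega))
    by_cases hkp : k = p
    · subst hkp
      rw [leibniz_lie, hE.zero (i := k) (j := m) (k := i) (l := m), zero_lie, zero_add,
        w₂' i (by omega) (by omega) (by omega)]
    · simpa only [leibniz_lie (E i p), hE.mul (i := i) (j := p) (l := m),
        hE.zero (i := i) (j := p) (k := k) (l := m), w₁ i p (by omega), zero_lie, zero_add,
        lie_zero, add_zero] using h₀
  have w₀' : ∀ q, (a ≤ q ∧ q ≤ b ∧ q ≠ m) → ⁅E m q, ⁅E q m, w⁆⁆ = w := by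
    intro q hq
    by_cases hqp : q = p
    · rw [hqp, w₀]
    have h₁ : ⁅E q m, w⁆ = ⁅E q p, ⁅E p m, w⁆⁆ := by
      rw [leibniz_lie, hE.mul (i := q) (j := p) (l := m), w₁ q p (by omega), lie_zero, add_zero]
    have h₂ : ⁅E m q, ⁅E p m, w⁆⁆ = 0 := by
      rw [leibniz_lie, hE.mul_neg (i := m) (j := q) (k := p), neg_lie, w₁ p q (by omega),
        w₁ m q (by omega), lie_zero, neg_zero, add_zero]
    rw [h₁, leibniz_lie, hE.mul (i := m) (j := q) (l := p), h₂, lie_zero, add_zero, w₀]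
  by_cases him : i = m
  · subst him
    rw [column_self]
    by_cases hl : l = i
    · subst hl
      rw [if_pos rfl, column_of_ne _ _ (by omega)]
    · rw [if_neg hl, w₁ k l (by omega)]
  rw [column_of_ne _ _ him]
  by_cases hl : l = i
  · subst hl
    rw [if_pos rfl]
    by_cases hk : k = m
    · subst hk
      rw [column_self, w₀' l (by omega)]
    · rw [column_of_ne _ _ hk, leibniz_lie, hE.mul (i := k) (j := l) (l := m),
        w₁ k l (by omega), lie_zero, add_zero]
  · rw [if_neg hl]
    by_cases hlm : l = m
    · subst hlm
      exact w₂'' k i (by omega)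
    rw [leibniz_lie, w₁ k l (by omega), lie_zero, add_zero]
    by_cases hkm : k = m
    · subst hkm
      rw [hE.mul_neg (i := k) (j := l) (k := i), neg_lie, w₁ i l (by omega), neg_zero]
    · rw [hE.zero (i := k) (j := l) (k := i) (l := m), zero_lie]

end Steinberg
end

noncomputable section

/-! ### Matrix units from the Chevalley generators of `sl(N)` -/

namespace Steinberg
variable {L : Type*} [LieRing L]

lemma lie_eq_zero_of_lt {a b : ℕ} {E : ℕ → ℕ → L} (hE : MatProd a b E E E) {z : L} {k l : ℕ}
    (hk : a ≤ k) (hkl : k < l) (hl : l ≤ b) (h : ∀ i, k ≤ i → i < l → ⁅E i (i + 1), z⁆ = 0) :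
    ⁅E k l, z⁆ = 0 := by
  induction l, hkl using Nat.le_induction with
  | base => exact h k le_rfl (by omega)
  | succ l hkl ih =>
    rw [← hE.mul (i := k) (j := l) (l := l + 1), lie_lie, h l (by omega) (by omega),
      ih (by omega) fun i hi hi' => h i hi (by omega), lie_zero, lie_zero, sub_zero]

lemma lie_eq_zero_of_gt {a b : ℕ} {E : ℕ → ℕ → L} (hE : MatProd a b E E E) {z : L} {k l : ℕ}
    (hk : a ≤ k) (hkl : k < l) (hl : l ≤ b) (h : ∀ i, k ≤ i → i < l → ⁅E (i + 1) i, z⁆ = 0) :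
    ⁅E l k, z⁆ = 0 := by
  have := lie_eq_zero_of_lt hE.dual (z := z) hk hkl hl fun i hi hi' => by
    rw [neg_lie, h i hi hi', neg_zero]
  rwa [neg_lie, neg_eq_zero] at this

/-- The relations between the Chevalley generators `e_1, …, e_{N-1}`, `f_1, …, f_{N-1}` of
`sl(N)`. -/
structure ChevalleySl (N : ℕ) (e f : ℕ → L) : Prop where
  ef : ∀ i j, (1 ≤ i ∧ i < N ∧ 1 ≤ j ∧ j < N ∧ i ≠ j) → ⁅e i, f j⁆ = 0
  he : ∀ i j, (1 ≤ i ∧ i < N ∧ 1 ≤ j ∧ j < N ∧ (j = i + 1 ∨ i = j + 1)) → ⁅⁅e i, f i⁆, e j⁆ = -e j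
  hf : ∀ i j, (1 ≤ i ∧ i < N ∧ 1 ≤ j ∧ j < N ∧ (j = i + 1 ∨ i = j + 1)) → ⁅⁅e i, f i⁆, f j⁆ = f j
  ee : ∀ i j, (1 ≤ i ∧ i < N ∧ 1 ≤ j ∧ j < N ∧ i ≠ j ∧ ¬(j = i + 1 ∨ i = j + 1)) → ⁅e i, e j⁆ = 0
  ff : ∀ i j, (1 ≤ i ∧ i < N ∧ 1 ≤ j ∧ j < N ∧ i ≠ j ∧ ¬(j = i + 1 ∨ i = j + 1)) → ⁅f i, f j⁆ = 0
  eee : ∀ i j, (1 ≤ i ∧ i < N ∧ 1 ≤ j ∧ j < N ∧ (j = i + 1 ∨ i = j + 1)) → ⁅e i, ⁅e i, e j⁆⁆ = 0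
  fff : ∀ i j, (1 ≤ i ∧ i < N ∧ 1 ≤ j ∧ j < N ∧ (j = i + 1 ∨ i = j + 1)) → ⁅f i, ⁅f i, f j⁆⁆ = 0

namespace ChevalleySl

variable {N : ℕ} {e f : ℕ → L}

lemma dual (h : ChevalleySl N e f) : ChevalleySl N (fun i => -f i) fun i => -e i where
  ef i j hi := by rw [neg_lie, lie_neg, neg_neg, ← lie_skew, h.ef j i (by omega), neg_zero]
  he i j hi := by
    have hh : ⁅-f i, -e i⁆ = -⁅e i, f i⁆ := by rw [neg_lie, lie_neg, neg_neg, lie_skew]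
    rw [hh, neg_lie, lie_neg, neg_neg, h.hf i j hi, neg_neg]
  hf i j hi := by
    have hh : ⁅-f i, -e i⁆ = -⁅e i, f i⁆ := by rw [neg_lie, lie_neg, neg_neg, lie_skew]
    rw [hh, neg_lie, lie_neg, neg_neg, h.he i j hi]
  ee i j hi := by rw [neg_lie, lie_neg, neg_neg, h.ff i j hi]
  ff i j hi := by rw [neg_lie, lie_neg, neg_neg, h.ee i j hi]
  eee i j hi := by simp [h.fff i j hi]
  fff i j hi := by simp [h.eee i j hi]

end ChevalleySl

/-- The entries of a column commute. -/
lemma column_lie_column {a b : ℕ} {E : ℕ → ℕ → L} {w : L} {m p : ℕ}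
    (hm : a ≤ m ∧ m ≤ b) (hp : a ≤ p ∧ p ≤ b ∧ p ≠ m)
    (hc : ∀ k l i, (a ≤ k ∧ k ≤ b ∧ a ≤ l ∧ l ≤ b ∧ a ≤ i ∧ i ≤ b ∧ k ≠ l) →
      ⁅E k l, column E m w i⁆ = if l = i then column E m w k else 0)
    (hw : ⁅w, ⁅E p m, w⁆⁆ = 0) {i j : ℕ} (hi : a ≤ i ∧ i ≤ b ∧ a ≤ j ∧ j ≤ b) :
    ⁅column E m w i, column E m w j⁆ = 0 := by
  have hs := column_self E m w
  have h₁ : ∀ i, a ≤ i → i ≤ b → ⁅column E m w m, column E m w i⁆ = 0 := by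
    intro i hi hi'
    by_cases him : i = m
    · rw [him, lie_self]
    have hwp : ⁅column E m w m, column E m w p⁆ = 0 := by
      rw [hs, column_of_ne _ _ hp.2.2, hw]
    by_cases hip : i = p
    · rw [hip, hwp]
    have := congrArg (fun z => ⁅E i p, z⁆) hwp
    simpa only [leibniz_lie (E i p), hc i p m (by omega), hc i p p (by omega), if_neg hp.2.2,
      if_true, zero_lie, zero_add, lie_zero] using this
  by_cases hjm : j = m
  · rw [hjm, ← lie_skew, h₁ i (by omega) (by omega), neg_zero]
  by_cases him : i = m
  · rw [him, h₁ j (by omega) (by omega)]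
  have := congrArg (fun z => ⁅E j m, z⁆) (h₁ i (by omega) (by omega))
  simp only [leibniz_lie (E j m), hc j m m (by omega), hc j m i (by omega), if_neg (Ne.symm him),
      if_true, add_zero, lie_zero] at this
  rw [← lie_skew, this, neg_zero]

variable [LieAlgebra ℂ L]

/-- The vectors `e_m` and `f_m` are the first entries of a column and of a row that extend matrix
units with labels in `[1, m]` to the label `m + 1`. -/
lemma ChevalleySl.lie_column {N : ℕ} {e f : ℕ → L} (h : ChevalleySl N e f) {m : ℕ} (hm : 2 ≤ m)
    (hmN : m < N) {E : ℕ → ℕ → L} (hE : MatProd 1 m E E E)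
    (he : ∀ i, 1 ≤ i → i < m → E i (i + 1) = e i) (hf : ∀ i, 1 ≤ i → i < m → E (i + 1) i = f i) :
    (∀ k l i, (1 ≤ k ∧ k ≤ m ∧ 1 ≤ l ∧ l ≤ m ∧ 1 ≤ i ∧ i ≤ m ∧ k ≠ l) →
      ⁅E k l, column E m (e m) i⁆ = if l = i then column E m (e m) k else 0) ∧
    ∀ i j, (1 ≤ i ∧ i ≤ m ∧ 1 ≤ j ∧ j ≤ m) →
      ⁅column E m (e m) i, column E m (e m) j⁆ = 0 := by
  obtain ⟨p, rfl⟩ : ∃ p, m = p + 1 := ⟨m - 1, by omega⟩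
  have hEp : E p (p + 1) = e p := he p (by omega) (by omega)
  have hFp : E (p + 1) p = f p := hf p (by omega) (by omega)
  have w₁ : ∀ k l, (1 ≤ k ∧ k ≤ p + 1 ∧ 1 ≤ l ∧ l ≤ p + 1 ∧ k ≠ l ∧ l ≠ p + 1) →
      ⁅E k l, e (p + 1)⁆ = 0 := by
    intro k l hkl
    rcases Nat.lt_or_gt_of_ne hkl.2.2.2.2.1 with hlt | hlt
    · refine lie_eq_zero_of_lt hE (by omega) hlt (by omega) fun i hi hi' => ?_
      rw [he i (by omega) (by omega), h.ee i (p + 1) (by omega)]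
    · refine lie_eq_zero_of_gt hE (by omega) hlt (by omega) fun i hi hi' => ?_
      rw [hf i (by omega) (by omega), ← lie_skew, h.ef (p + 1) i (by omega), neg_zero]
  have hc := fun k l i hi => Steinberg.lie_column hE (w := e (p + 1)) (m := p + 1) (p := p) (by omega) (by omega) w₁
    (by rw [hEp, hFp, leibniz_lie, ← lie_skew (f p) (e (p + 1)), h.ef (p + 1) p (by omega),
          neg_zero, lie_zero, add_zero, ← lie_skew (f p) (e p), neg_lie, h.he p (p + 1) (by omega),
          neg_neg])
    (by rw [hEp, h.eee p (p + 1) (by omega)]) (k := k) (l := l) (i := i) hi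
  refine ⟨hc, fun i j hi => column_lie_column (p := p) (by omega) (by omega) hc ?_ hi⟩
  rw [hEp, ← lie_skew (e p), lie_neg, h.eee (p + 1) p (by omega), neg_zero]

/-- The Chevalley generators of `sl(N)` generate matrix units. -/
theorem ChevalleySl.exists_matProd {N : ℕ} {e f : ℕ → L} (h : ChevalleySl N e f) {m : ℕ}
    (hm : 2 ≤ m) (hmN : m ≤ N) : ∃ E : ℕ → ℕ → L, MatProd 1 m E E E ∧
      (∀ i, 1 ≤ i → i < m → E i (i + 1) = e i) ∧ ∀ i, 1 ≤ i → i < m → E (i + 1) i = f i := by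
  induction m, hm using Nat.le_induction with
  | base =>
    refine ⟨fun i j => if i = 1 then e 1 else f 1, ?_, ?_, ?_⟩
    · refine MatProd.of_cases (fun _ _ _ _ => by omega) (fun _ _ _ _ => by omega) ?_
      intro i j k l hi
      obtain ⟨rfl, rfl⟩ : k = i ∧ l = j := by omega
      simp
    · intro i h₁ h₂
      obtain rfl : i = 1 := by omega
      simp
    · intro i h₁ h₂
      obtain rfl : i = 1 := by omega
      simp
  | succ m hm ih =>
    obtain ⟨E, hE, he, hf⟩ := ih (by omega)
    obtain ⟨hc, hcc⟩ := h.lie_column hm (by omega) hE he hf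
    obtain ⟨hd', hdd'⟩ := h.dual.lie_column hm (by omega) hE.dual
      (fun i h₁ h₂ => by rw [hf i h₁ h₂]) (fun i h₁ h₂ => by rw [he i h₁ h₂])
    set c := column E m (e m) with hc_def
    set d' := column (fun i j => -E j i) m (-f m) with hd_def
    have hd : ∀ k l i, (1 ≤ k ∧ k ≤ m ∧ 1 ≤ l ∧ l ≤ m ∧ 1 ≤ i ∧ i ≤ m ∧ k ≠ l) →
        ⁅E k l, -d' i⁆ = -if k = i then -d' l else 0 := by
      intro k l i hi
      have := hd' l k i (by omega)
      rw [neg_lie] at this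
      rw [lie_neg, this]
      split_ifs <;> simp
    have hdm : d' m = -f m := column_self _ _ _
    have hdn : ∀ j, j ≠ m → d' j = ⁅E m j, f m⁆ := fun j hj => by
      rw [hd_def, column_of_ne _ _ hj, neg_lie, lie_neg, neg_neg]
    have hcm : c m = e m := column_self _ _ _
    have hcn : ∀ j, j ≠ m → c j = ⁅E j m, e m⁆ := fun j hj => column_of_ne _ _ hj
    have hhd : ∀ j, (1 ≤ j ∧ j < m) → ⁅⁅e m, f m⁆, E m j⁆ = E m j := by
      intro j hj
      obtain ⟨p, rfl⟩ : ∃ p, m = p + 1 := ⟨m - 1, by omega⟩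
      have h₀ : ⁅⁅e (p + 1), f (p + 1)⁆, f p⁆ = f p := h.hf (p + 1) p (by omega)
      by_cases hjp : j = p
      · rw [hjp, hf p (by omega) (by omega), h₀]
      have h₁ : ⁅E p j, ⁅e (p + 1), f (p + 1)⁆⁆ = 0 := by
        refine lie_eq_zero_of_gt hE (by omega) (by omega) (by omega) fun i hi hi' => ?_
        rw [hf i (by omega) (by omega), leibniz_lie, ← lie_skew (f i), h.ef _ _ (by omega),
          h.ff _ _ (by omega), neg_zero, zero_lie, lie_zero, add_zero]
      rw [← hE.mul (i := p + 1) (j := p) (l := j), leibniz_lie, hf p (by omega) (by omega), h₀,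
        ← lie_skew ⁅e (p + 1), f (p + 1)⁆ (E p j), h₁, neg_zero, lie_zero, add_zero]
    have hcd₀ : ∀ j, (1 ≤ j ∧ j < m) → ⁅c m, -d' j⁆ = E m j := by
      intro j hj
      have h₁ : ⁅E m j, e m⁆ = 0 := by rw [← hcm, hc m j m (by omega), if_neg (by omega)]
      rw [hdn j (by omega), hcm, lie_skew, leibniz_lie, hhd j hj,
        ← lie_skew (e m) (E m j), h₁, neg_zero, lie_zero, add_zero]
    have hhc : ∀ i, (1 ≤ i ∧ i < m) → ⁅E i m, ⁅e m, f m⁆⁆ = E i m := by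
      intro i hi
      obtain ⟨p, rfl⟩ : ∃ p, m = p + 1 := ⟨m - 1, by omega⟩
      have h₀ : ⁅⁅e (p + 1), f (p + 1)⁆, e p⁆ = -e p := h.he (p + 1) p (by omega)
      rw [← lie_skew, neg_eq_iff_eq_neg]
      by_cases hjp : i = p
      · rw [hjp, he p (by omega) (by omega), h₀]
      have h₁ : ⁅E i p, ⁅e (p + 1), f (p + 1)⁆⁆ = 0 := by
        refine lie_eq_zero_of_lt hE (by omega) (by omega) (by omega) fun i hi hi' => ?_
        rw [he i (by omega) (by omega), leibniz_lie, h.ee i (p + 1) (by omega),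
          h.ef i (p + 1) (by omega), zero_lie, lie_zero, add_zero]
      rw [← hE.mul (i := i) (j := p) (l := p + 1), leibniz_lie, he p (by omega) (by omega), h₀,
        ← lie_skew ⁅e (p + 1), f (p + 1)⁆ (E i p), h₁, neg_zero, zero_lie, zero_add, lie_neg]
    have hcd : ∀ i j, (1 ≤ i ∧ i ≤ m ∧ 1 ≤ j ∧ j ≤ m ∧ i ≠ j) → ⁅c i, -d' j⁆ = E i j := by
      intro i j hi
      by_cases him : i = m
      · rw [him, hcd₀ j (by omega)]
      rw [hcn i him]
      by_cases hjm : j = m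
      · rw [hjm, lie_lie, hd i m m (by omega), if_neg him, neg_zero, lie_zero, sub_zero, hdm,
          neg_neg, hhc i (by omega)]
      · rw [lie_lie, hd i m j (by omega), if_neg (by omega), neg_zero, lie_zero, sub_zero, ← hcm,
          hcd₀ j (by omega), hE.mul (i := i) (j := m) (l := j)]
    refine ⟨fun i j => if i = m + 1 then -d' j else if j = m + 1 then c i else E i j, ?_, ?_, ?_⟩
    · intro i j k l hi
      by_cases hi1 : i = m + 1
      · by_cases hk1 : k = m + 1
        · simp only [if_pos hi1, if_pos hk1]
          rw [if_neg (by omega), if_neg (by omega), sub_zero, lie_neg, neg_lie, neg_neg,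
            hdd' j l (by omega)]
        · simp only [if_pos hi1, if_neg hk1]
          by_cases hl1 : l = m + 1
          · rw [if_pos hl1, if_neg (by omega : ¬ j = k), if_pos (by omega : i = l),
              if_neg (by omega : ¬ j = m + 1), zero_sub, ← lie_skew, hcd k j (by omega)]
          · rw [if_neg hl1, if_neg (by omega : ¬ i = l), ← lie_skew, hd k l j (by omega), neg_neg,
              sub_zero]
            simp only [eq_comm]
      · simp only [if_neg hi1]
        by_cases hj1 : j = m + 1
        · simp only [if_pos hj1]
          by_cases hk1 : k = m + 1
          · rw [if_pos hk1, if_pos (by omega), if_neg (by omega), if_neg (by omega), sub_zero,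
              hcd i l (by omega)]
          · rw [if_neg hk1, if_neg (by omega : ¬ j = k)]
            by_cases hl1 : l = m + 1
            · rw [if_pos hl1, if_neg (by omega), sub_zero, hcc i k (by omega)]
            · rw [if_neg hl1, ← lie_skew, hc k l i (by omega), if_neg hk1, zero_sub]
              simp only [eq_comm]
        · simp only [if_neg hj1]
          by_cases hk1 : k = m + 1
          · rw [if_pos hk1, hd i j l (by omega), if_pos hk1, if_neg (by omega : ¬ j = k), zero_sub]
          · simp only [if_neg hk1]
            by_cases hl1 : l = m + 1
            · rw [if_pos hl1, hc i j k (by omega), if_pos hl1, if_neg (by omega : ¬ i = l), sub_zero]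
            · rw [if_neg hl1, if_neg hl1, hE i j k l (by omega)]
    · intro i h₁ h₂
      by_cases him : i = m
      · simp [him, hcm]
      · simp only [if_neg (by omega : ¬ i = m + 1), if_neg (by omega : ¬ i + 1 = m + 1)]
        exact he i h₁ (by omega)
    · intro i h₁ h₂
      by_cases him : i = m
      · simp [him, hdm]
      · simp only [if_neg (by omega : ¬ i = m + 1), if_neg (by omega : ¬ i + 1 = m + 1)]
        exact hf i h₁ (by omega)

end Steinberg
end

noncomputable section

/-! ### Copies of the adjoint representation -/

namespace Steinberg
variable {L : Type*} [LieRing L]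
variable [LieAlgebra ℂ L]

/-- A vector that behaves like `E_N1` generates the adjoint representation of `sl(N)`: it is the
lowest entry of a family on which the matrix units act as on matrix units. -/
theorem exists_family {N : ℕ} (hN : 4 ≤ N) {E : ℕ → ℕ → L} (hE : MatProd 1 N E E E) {v : L}
    (v₁ : ∀ k l, (1 ≤ k ∧ k ≤ N ∧ 1 ≤ l ∧ l ≤ N ∧ k ≠ l ∧ l ≠ N ∧ k ≠ 1) → ⁅E k l, v⁆ = 0)
    (hrow₀ : ⁅E N (N - 1), ⁅E (N - 1) N, v⁆⁆ = v) (hrow₂ : ⁅E (N - 1) N, ⁅E (N - 1) N, v⁆⁆ = 0)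
    (hcol₀ : ⁅E 2 1, ⁅E 1 2, v⁆⁆ = v) (hcol₂ : ⁅E 1 2, ⁅E 1 2, v⁆⁆ = 0) :
    ∃ T : ℕ → ℕ → L, MatProd 1 N E T T ∧ T N 1 = v := by
  set r := column E N v with hr_def
  have hrN : r N = v := column_self _ _ _
  have hrn : ∀ i, i ≠ N → r i = ⁅E i N, v⁆ := fun i hi => column_of_ne _ _ hi
  -- the entries `r_i` of the first column of the family
  have hr : ∀ k l i, (2 ≤ k ∧ k ≤ N ∧ 2 ≤ l ∧ l ≤ N ∧ 2 ≤ i ∧ i ≤ N ∧ k ≠ l) →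
      ⁅E k l, r i⁆ = if l = i then r k else 0 := fun k l i hi =>
    lie_column (hE.mono (by omega) le_rfl : MatProd 2 N E E E) (m := N) (p := N - 1)
      (by omega) (by omega) (fun k l hkl => v₁ k l (by omega)) hrow₀ hrow₂ hi
  have hr₁ : ∀ k i, (2 ≤ k ∧ k ≤ N ∧ 2 ≤ i ∧ i ≤ N) → ⁅E k 1, r i⁆ = 0 := by
    intro k i hi
    have h₁ := v₁ k 1 (by omega)
    by_cases hiN : i = N
    · rw [hiN, hrN, h₁]
    rw [hrn i hiN, leibniz_lie, h₁, lie_zero, add_zero]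
    by_cases hkN : k = N
    · rw [hkN, hE.mul_neg, neg_lie, v₁ i 1 (by omega), neg_zero]
    · rw [hE.zero, zero_lie]
  have hd : ∀ k l i, (1 ≤ k ∧ k ≤ N - 1 ∧ 1 ≤ l ∧ l ≤ N - 1 ∧ 1 ≤ i ∧ i ≤ N - 1 ∧ k ≠ l) →
      ⁅-E l k, column (fun i j => -E j i) 1 v i⁆ =
        if l = i then column (fun i j => -E j i) 1 v k else 0 := fun k l i hi =>
    lie_column (hE.mono le_rfl (by omega) : MatProd 1 (N - 1) E E E).dual (m := 1) (p := 2)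
      (by omega) (by omega) (fun k l hkl => by rw [neg_lie, v₁ l k (by omega), neg_zero])
      (by simp only [neg_lie, lie_neg, neg_neg, hcol₀]) (by simp only [neg_lie, lie_neg, neg_neg, hcol₂]) hi
  have hrr : ∀ i j k, (2 ≤ i ∧ i ≤ N ∧ 2 ≤ j ∧ j ≤ N ∧ 2 ≤ k ∧ k ≤ N ∧ i ≠ j ∧ i ≠ k) →
      ⁅E 1 j, ⁅E 1 k, r i⁆⁆ = 0 := by
    have h₁ : ∀ i j k, (2 ≤ i ∧ i ≤ N ∧ 2 ≤ j ∧ j ≤ N - 1 ∧ 2 ≤ k ∧ k ≤ N - 1 ∧ i ≠ j ∧ i ≠ k) →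
        ⁅E 1 j, ⁅E 1 k, r i⁆⁆ = 0 := by
      intro i j k hi
      have h₀ := hd j 1 k (by omega)
      rw [column_of_ne _ _ (by omega), if_neg (by omega), neg_lie, neg_lie, lie_neg, neg_neg] at h₀
      by_cases hiN : i = N
      · rw [hiN, hrN, h₀]
      · rw [hrn i hiN, leibniz_lie (E 1 k), hE.zero (i := 1) (j := k) (k := i) (l := N), zero_lie,
          zero_add, leibniz_lie (E 1 j), hE.zero (i := 1) (j := j) (k := i) (l := N), zero_lie,
          zero_add, h₀, lie_zero]
    have h₂ : ∀ i j, (2 ≤ i ∧ i ≤ N - 1 ∧ 2 ≤ j ∧ j ≤ N - 1 ∧ i ≠ j) →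
        ⁅E 1 N, ⁅E 1 j, r i⁆⁆ = 0 := by
      intro i j hi
      have h₀ := congrArg (fun z => ⁅E j N, z⁆) (h₁ i j j (by omega))
      simp only [leibniz_lie (E j N), hE.mul_neg (i := j) (j := N) (k := 1), hr j N i (by omega),
        if_neg (by omega : ¬ N = i), lie_zero, add_zero, neg_lie, lie_neg] at h₀
      rw [leibniz_lie (E 1 j), hE.zero (i := 1) (j := j) (k := 1) (l := N), zero_lie,
        zero_add, ← neg_add, neg_eq_zero] at h₀
      exact eq_zero_of_add_self h₀
    have h₃ : ∀ i, (2 ≤ i ∧ i ≤ N - 1) → ⁅E 1 N, ⁅E 1 N, r i⁆⁆ = 0 := by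
      intro i hi
      obtain ⟨j, hj⟩ := exists_label hN 1 i N
      have h₀ := congrArg (fun z => ⁅E j N, z⁆) (h₂ i j (by omega))
      simpa only [leibniz_lie (E j N), hE.mul_neg (i := j) (j := N) (k := 1), hr j N i (by omega),
        if_neg (by omega : ¬ N = i), lie_zero, add_zero, neg_lie, lie_neg,
        hE.zero (i := j) (j := N) (k := 1) (l := N), zero_lie, zero_add, neg_eq_zero] using h₀
    intro i j k hi
    by_cases hj : j = N
    · subst hj
      by_cases hk : k = j
      · subst hk
        exact h₃ i (by omega)
      · exact h₂ i k (by omega)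
    · by_cases hk : k = N
      · subst hk
        rw [leibniz_lie, hE.zero, zero_lie, zero_add]
        exact h₂ i j (by omega)
      · exact h₁ i j k (by omega)
  have hw : ∀ i j, (2 ≤ i ∧ i ≤ N ∧ 2 ≤ j ∧ j ≤ N ∧ i ≠ j) → ⁅E j 1, ⁅E 1 j, r i⁆⁆ = r i := by
    have h₁ : ∀ i j, (2 ≤ i ∧ i ≤ N ∧ 2 ≤ j ∧ j ≤ N - 1 ∧ i ≠ j) →
        ⁅E j 1, ⁅E 1 j, r i⁆⁆ = r i := by
      intro i j hi
      have h₀ := hd 1 j j (by omega)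
      rw [column_of_ne _ _ (by omega), if_pos rfl, neg_lie, neg_lie, lie_neg, neg_neg,
        column_self] at h₀
      by_cases hiN : i = N
      · rw [hiN, hrN, h₀]
      · rw [hrn i hiN, leibniz_lie (E 1 j), hE.zero (i := 1) (j := j) (k := i) (l := N), zero_lie,
          zero_add, leibniz_lie (E j 1), hE.zero (i := j) (j := 1) (k := i) (l := N), zero_lie,
          zero_add, h₀]
    intro i j hi
    by_cases hj : j = N
    · subst hj
      obtain ⟨p, hp⟩ := exists_label hN 1 i j
      have h₂ : ⁅E 1 j, r i⁆ = -⁅E p j, ⁅E 1 p, r i⁆⁆ := by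
        rw [← hE.mul (i := 1) (j := p) (l := j), lie_lie, hr p j i (by omega), if_neg (by omega),
          lie_zero, zero_sub]
      have h₃ : ⁅E j 1, ⁅E 1 p, r i⁆⁆ = 0 := by
        rw [leibniz_lie, hE.mul, hr j p i (by omega), if_neg (by omega), hr₁ j i (by omega),
          lie_zero, add_zero]
      rw [h₂, lie_neg, leibniz_lie, hE.mul_neg, h₃, lie_zero, add_zero, neg_lie, neg_neg,
        h₁ i p (by omega)]
    · exact h₁ i j (by omega)
  -- the other entries
  set S : ℕ → ℕ → L := fun i j => if j = 1 then r i else ⁅r i, E 1 j⁆ with hS_def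
  have hS₁ : ∀ i, S i 1 = r i := fun i => if_pos rfl
  have hS : ∀ i j, j ≠ 1 → S i j = ⁅r i, E 1 j⁆ := fun i j hj => if_neg hj
  have hES : ∀ k l i j, (2 ≤ k ∧ k ≤ N ∧ 2 ≤ l ∧ l ≤ N ∧ 2 ≤ i ∧ i ≤ N ∧ 2 ≤ j ∧ j ≤ N ∧ k ≠ l ∧
      i ≠ j ∧ ¬(l = i ∧ k = j)) →
      ⁅E k l, S i j⁆ = (if l = i then S k j else 0) - if k = j then S i l else 0 := by
    intro k l i j hi
    rw [hS i j (by omega), hS k j (by omega), hS i l (by omega), leibniz_lie, hr k l i (by omega)]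
    by_cases hkj : k = j
    · subst hkj
      rw [hE.mul_neg (i := k) (j := l) (k := 1), lie_neg, if_neg (by omega), if_neg (by omega),
        if_pos rfl, zero_lie, zero_add, zero_sub]
    · rw [hE.zero (i := k) (j := l) (k := 1) (l := j), lie_zero, add_zero, if_neg hkj, sub_zero]
      split_ifs
      · rfl
      · rw [zero_lie]
  have hE1S : ∀ k i j, (2 ≤ k ∧ k ≤ N ∧ 2 ≤ i ∧ i ≤ N ∧ 2 ≤ j ∧ j ≤ N ∧ i ≠ j) →
      ⁅E k 1, S i j⁆ = if k = j then -r i else 0 := by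
    intro k i j hi
    rw [hS i j (by omega)]
    by_cases hkj : k = j
    · subst hkj
      rw [if_pos rfl, ← lie_skew (r i), lie_neg, hw i k (by omega)]
    · rw [if_neg hkj, leibniz_lie, hr₁ k i (by omega), zero_lie, zero_add,
        hE.mul (i := k) (j := 1) (l := j), ← lie_skew, hr k j i (by omega), if_neg (by omega),
        neg_zero]
  have h1ES : ∀ l i j, (2 ≤ l ∧ l ≤ N ∧ 2 ≤ i ∧ i ≤ N ∧ 2 ≤ j ∧ j ≤ N ∧ i ≠ j ∧ l ≠ i) →
      ⁅E 1 l, S i j⁆ = 0 := by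
    intro l i j hi
    rw [hS i j (by omega), ← lie_skew (r i), lie_neg, hrr i l j (by omega), neg_zero]
  set q : ℕ → ℕ := fun j => if j = 2 then 3 else 2
  have hq : ∀ j, 2 ≤ q j ∧ q j ≤ N ∧ q j ≠ j := by
    intro j
    simp only [q]
    split_ifs <;> omega
  set T₁ : ℕ → L := fun j => ⁅E 1 (q j), S (q j) j⁆ with hT₁_def
  have hT₁ : ∀ i j, (2 ≤ i ∧ i ≤ N ∧ 2 ≤ j ∧ j ≤ N ∧ i ≠ j) → ⁅E 1 i, S i j⁆ = T₁ j := by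
    intro i j hi
    have := hq j
    by_cases hiq : i = q j
    · rw [hiq]
    have h₀ := hES i (q j) (q j) j (by omega)
    rw [if_pos rfl, if_neg (by omega), sub_zero] at h₀
    rw [← h₀, leibniz_lie, hE.mul (i := 1) (j := i) (l := q j), h1ES i (q j) j (by omega),
      lie_zero, add_zero]
  refine ⟨fun i j => if i = 1 then T₁ j else S i j, ?_, ?_⟩
  swap
  · dsimp only
    rw [if_neg (by omega), hS₁, hrN]
  intro k l i j hi
  by_cases hi1 : i = 1
  · subst hi1
    simp only [if_true]
    by_cases hl1 : l = 1
    · subst hl1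
      rw [if_pos rfl, if_neg (by omega), if_neg (by omega), sub_zero]
      obtain ⟨p, hp⟩ := exists_label hN 1 j k
      rw [← hT₁ p j (by omega), leibniz_lie, hE.mul (i := k) (j := 1) (l := p),
        hE1S k p j (by omega), if_neg (by omega), lie_zero, add_zero, hES k p p j (by omega),
        if_pos rfl, if_neg (by omega), sub_zero]
    rw [if_neg hl1, zero_sub]
    by_cases hk1 : k = 1
    · subst hk1
      rw [if_neg (by omega), neg_zero]
      obtain ⟨p, hp⟩ := exists_label hN 1 j l
      rw [← hT₁ p j (by omega), leibniz_lie, hE.zero (i := 1) (j := l) (k := 1) (l := p), zero_lie,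
        zero_add, h1ES l p j (by omega), lie_zero]
    · by_cases hkj : k = j
      · subst hkj
        rw [if_pos rfl]
        obtain ⟨p, hp⟩ := exists_label hN 1 k l
        rw [← hT₁ p k (by omega), ← hT₁ p l (by omega), leibniz_lie,
          hE.zero (i := k) (j := l) (k := 1) (l := p), zero_lie, zero_add, hES k l p k (by omega),
          if_neg (by omega), if_pos rfl, zero_sub, lie_neg]
      · rw [if_neg hkj, neg_zero, ← hT₁ k j (by omega), leibniz_lie,
          hE.mul_neg (i := k) (j := l) (k := 1), neg_lie, h1ES l k j (by omega), neg_zero, zero_add,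
          hES k l k j (by omega), if_neg (by omega), if_neg hkj, sub_zero, lie_zero]
  · simp only [if_neg hi1]
    by_cases hk1 : k = 1
    · subst hk1
      simp only [if_true]
      by_cases hj1 : j = 1
      · subst hj1
        rw [if_pos rfl, if_neg (by omega), zero_sub, hS₁, hS i l (by omega), lie_skew]
      · rw [if_neg (by omega : ¬ 1 = j), sub_zero]
        split_ifs with h
        · subst h
          exact hT₁ l j (by omega)
        · exact h1ES l i j (by omega)
    · rw [if_neg hk1]
      by_cases hj1 : j = 1
      · subst hj1
        rw [if_neg hk1, sub_zero, hS₁, hS₁]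
        by_cases hl1 : l = 1
        · subst hl1
          rw [if_neg (by omega), hr₁ k i (by omega)]
        · exact hr k l i (by omega)
      · by_cases hl1 : l = 1
        · subst hl1
          rw [if_neg (by omega), zero_sub, hE1S k i j (by omega), hS₁]
          split_ifs <;> simp
        · exact hES k l i j (by omega)

end Steinberg
end

noncomputable section

/-! ### Products and powers of families -/

namespace Steinberg
variable {L : Type*} [LieRing L]

/-- The products `F_ij G_kl` of two families that vanish for matrix units do vanish. -/
def Compat (N : ℕ) (F G : ℕ → ℕ → L) : Prop :=
  ∀ i j k l : ℕ, (1 ≤ i ∧ i ≤ N ∧ 1 ≤ j ∧ j ≤ N ∧ 1 ≤ k ∧ k ≤ N ∧ 1 ≤ l ∧ l ≤ N ∧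
    i ≠ j ∧ k ≠ l ∧ j ≠ k ∧ i ≠ l) → ⁅F i j, G k l⁆ = 0

/-- Pairs of labels can be connected by changing one label at a time. -/
lemma reach {N : ℕ} (hN : 4 ≤ N) {P : ℕ → ℕ → Prop} (h : P N 1)
    (h₁ : ∀ i i' j, (1 ≤ i ∧ i ≤ N ∧ 1 ≤ i' ∧ i' ≤ N ∧ 1 ≤ j ∧ j ≤ N ∧ i ≠ j ∧ i' ≠ j ∧ i' ≠ i) →
      P i j → P i' j)
    (h₂ : ∀ i j j', (1 ≤ i ∧ i ≤ N ∧ 1 ≤ j' ∧ j' ≤ N ∧ 1 ≤ j ∧ j ≤ N ∧ i ≠ j ∧ i ≠ j' ∧ j' ≠ j) →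
      P i j → P i j')
    {i j : ℕ} (hi : 1 ≤ i ∧ i ≤ N ∧ 1 ≤ j ∧ j ≤ N ∧ i ≠ j) : P i j := by
  by_cases hi1 : i = 1
  · subst hi1
    obtain ⟨m, hm⟩ := exists_label hN 1 N j
    exact h₂ 1 m j (by omega) (h₁ N 1 m (by omega) (h₂ N 1 m (by omega) h))
  · have h₃ : P i 1 := by
      by_cases hiN : i = N
      · rwa [hiN]
      · exact h₁ N i 1 (by omega) h
    by_cases hj1 : j = 1
    · rwa [hj1]
    · exact h₂ i 1 j (by omega) h₃

section
variable [LieAlgebra ℂ L]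

lemma compat_step {N : ℕ} (hN : 4 ≤ N) {E F G : ℕ → ℕ → L} (hF : MatProd 1 N E F F)
    (hG : MatProd 1 N E G G) {i i' j : ℕ}
    (hi : 1 ≤ i ∧ i ≤ N ∧ 1 ≤ i' ∧ i' ≤ N ∧ 1 ≤ j ∧ j ≤ N ∧ i ≠ j ∧ i' ≠ j ∧ i' ≠ i)
    (h : ∀ k l, (1 ≤ k ∧ k ≤ N ∧ 1 ≤ l ∧ l ≤ N ∧ k ≠ l ∧ k ≠ j ∧ l ≠ i) → ⁅F i j, G k l⁆ = 0) :
    ∀ k l, (1 ≤ k ∧ k ≤ N ∧ 1 ≤ l ∧ l ≤ N ∧ k ≠ l ∧ k ≠ j ∧ l ≠ i') → ⁅F i' j, G k l⁆ = 0 := by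
  have h₁ : ∀ k l, (1 ≤ k ∧ k ≤ N ∧ 1 ≤ l ∧ l ≤ N ∧ k ≠ l ∧ k ≠ j ∧ l ≠ i' ∧ l ≠ i) →
      ⁅F i' j, G k l⁆ = 0 := by
    intro k l hk
    rw [← hF.mul (i := i') (j := i) (l := j), lie_lie, h k l (by omega), lie_zero, zero_sub,
      neg_eq_zero]
    by_cases hki : k = i
    · subst hki
      rw [hG.mul, h i' l (by omega)]
    · rw [hG.zero, lie_zero]
  intro k l hk
  by_cases hl : l = i
  · subst hl
    by_cases hki : k = i'
    · subst hki
      obtain ⟨m, hm⟩ := exists_label hN k l j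
      rw [← neg_neg (G k l), ← hG.mul_neg (i := m) (j := l) (k := k), lie_neg, leibniz_lie,
        h₁ k m (by omega), hF.symm.zero, zero_lie, lie_zero, add_zero, neg_zero]
    · have h₀ := congrArg (fun z => ⁅E i' l, ⁅E i' l, z⁆⁆) (h k i' (by omega))
      simp only [leibniz_lie (E i' l), hF.mul (i := i') (j := l) (l := j),
        hF.zero (i := i') (j := l) (k := i') (l := j), hG.mul_neg (i := i') (j := l) (k := k),
        hG.zero (i := i') (j := l) (k := k) (l := l), lie_zero, lie_neg, zero_lie, zero_add,
        add_zero, lie_add] at h₀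
      rw [← neg_add, neg_eq_zero] at h₀
      exact eq_zero_of_add_self h₀
  · exact h₁ k l (by omega)

/-- It is enough to know the vanishing products with one element of a family. -/
theorem compat_of_row {N : ℕ} (hN : 4 ≤ N) {E F G : ℕ → ℕ → L} (hF : MatProd 1 N E F F)
    (hG : MatProd 1 N E G G)
    (h : ∀ k l, (1 ≤ k ∧ k ≤ N ∧ 1 ≤ l ∧ l ≤ N ∧ k ≠ l ∧ k ≠ 1 ∧ l ≠ N) → ⁅F N 1, G k l⁆ = 0) :
    Compat N F G := by
  intro i j k l hi
  refine reach hN (P := fun i j => ∀ k l, (1 ≤ k ∧ k ≤ N ∧ 1 ≤ l ∧ l ≤ N ∧ k ≠ l ∧ k ≠ j ∧ l ≠ i) →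
    ⁅F i j, G k l⁆ = 0) h (fun i i' j hi h => compat_step hN hF hG hi h) ?_ (i := i) (j := j)
    (by omega) k l (by omega)
  intro i j j' hi h k l hk
  have := compat_step hN hF.dual hG.dual (i := j) (i' := j') (j := i) (by omega)
    (fun k l hk => by rw [neg_lie, lie_neg, neg_neg, h l k (by omega)]) l k (by omega)
  rwa [neg_lie, lie_neg, neg_neg] at this

end

lemma matProd_step {N : ℕ} (hN : 4 ≤ N) {E F G H : ℕ → ℕ → L} (hF : MatProd 1 N E F F)
    (hG : MatProd 1 N E G G) (hH : MatProd 1 N E H H) {i i' j : ℕ}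
    (hi : 1 ≤ i ∧ i ≤ N ∧ 1 ≤ i' ∧ i' ≤ N ∧ 1 ≤ j ∧ j ≤ N ∧ i ≠ j ∧ i' ≠ j ∧ i' ≠ i)
    (h : ∀ k l, (1 ≤ k ∧ k ≤ N ∧ 1 ≤ l ∧ l ≤ N ∧ k ≠ l ∧ ¬(j = k ∧ i = l)) →
      ⁅F i j, G k l⁆ = (if j = k then H i l else 0) - if i = l then H k j else 0) :
    ∀ k l, (1 ≤ k ∧ k ≤ N ∧ 1 ≤ l ∧ l ≤ N ∧ k ≠ l ∧ ¬(j = k ∧ i' = l)) →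
      ⁅F i' j, G k l⁆ = (if j = k then H i' l else 0) - if i' = l then H k j else 0 := by
  have h₁ : ∀ k l, (1 ≤ k ∧ k ≤ N ∧ 1 ≤ l ∧ l ≤ N ∧ k ≠ l ∧ ¬(j = k ∧ i' = l) ∧
      ¬(j = k ∧ i = l) ∧ ¬(k = i ∧ l = i')) →
      ⁅F i' j, G k l⁆ = (if j = k then H i' l else 0) - if i' = l then H k j else 0 := by
    intro k l hk
    rw [← hF.mul (i := i') (j := i) (l := j), lie_lie, h k l (by omega)]
    by_cases hjk : j = k
    · subst hjk
      rw [hG.zero, lie_zero, if_pos rfl, if_neg (by omega), if_pos rfl, if_neg (by omega)]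
      simp only [sub_zero]
      exact hH.mul
    · rw [if_neg hjk, if_neg hjk]
      by_cases hil : i = l
      · subst hil
        rw [if_pos rfl, zero_sub, lie_neg, hH.zero, hG.zero, if_neg (by omega), lie_zero, neg_zero]
      · rw [if_neg hil, sub_zero, lie_zero, zero_sub, zero_sub, neg_inj]
        by_cases hil' : i' = l
        · subst hil'
          rw [if_pos rfl, hG.mul_neg, lie_neg, h k i (by omega), if_neg (by omega), if_pos rfl,
            zero_sub, neg_neg]
        · rw [if_neg hil']
          by_cases hki : k = i
          · subst hki
            rw [hG.mul, h i' l (by omega), if_neg (by omega), if_neg (by omega), sub_zero]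
          · rw [hG.zero, lie_zero]
  intro k l hk
  by_cases hb : j = k ∧ i = l
  · obtain ⟨rfl, rfl⟩ := hb
    obtain ⟨m, hm⟩ := exists_label hN i i' j
    rw [if_pos rfl, if_neg (by omega), sub_zero, ← neg_neg (G j i),
      ← hG.mul_neg (i := m) (j := i) (k := j), lie_neg, leibniz_lie,
      h₁ j m (by omega), if_pos rfl, if_neg (by omega), sub_zero, hF.symm.zero, zero_lie, zero_add, hH.mul_neg, neg_neg]
  · by_cases hb' : k = i ∧ l = i'
    · obtain ⟨rfl, rfl⟩ := hb'
      obtain ⟨m, hm⟩ := exists_label hN k l j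
      rw [if_neg (by omega), if_pos rfl, zero_sub, ← hG.mul (i := k) (j := m) (l := l),
        leibniz_lie, hF.symm.zero, zero_lie, zero_add, h₁ m l (by omega),
        if_neg (by omega), if_pos rfl, zero_sub, lie_neg, hH.mul]
    · exact h₁ k l (by omega)

/-- It is enough to know the products with one element of a family. -/
theorem matProd_of_row {N : ℕ} (hN : 4 ≤ N) {E F G H : ℕ → ℕ → L} (hF : MatProd 1 N E F F)
    (hG : MatProd 1 N E G G) (hH : MatProd 1 N E H H)
    (h : ∀ k l, (1 ≤ k ∧ k ≤ N ∧ 1 ≤ l ∧ l ≤ N ∧ k ≠ l ∧ ¬(1 = k ∧ N = l)) →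
      ⁅F N 1, G k l⁆ = (if 1 = k then H N l else 0) - if N = l then H k 1 else 0) :
    MatProd 1 N F G H := by
  intro i j k l hi
  refine reach hN (P := fun i j => ∀ k l, (1 ≤ k ∧ k ≤ N ∧ 1 ≤ l ∧ l ≤ N ∧ k ≠ l ∧
    ¬(j = k ∧ i = l)) → ⁅F i j, G k l⁆ = (if j = k then H i l else 0) - if i = l then H k j else 0)
    h (fun i i' j hi h => matProd_step hN hF hG hH hi h) ?_ (i := i) (j := j)
    (by omega) k l (by omega)
  intro i j j' hi h k l hk
  have := matProd_step hN hF.dual hG.dual (H := fun i j => -H j i) hH.dual (i := j) (i' := j') (j := i) (by omega)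
    (fun k l hk => by
      rw [neg_lie, lie_neg, neg_neg, h l k (by omega)]
      split_ifs <;> simp_all) l k (by omega)
  rw [neg_lie, lie_neg, neg_neg] at this
  rw [this]
  split_ifs <;> simp_all

/-- Two compatible families have a product. -/
theorem exists_prod {N : ℕ} (hN : 4 ≤ N) {E F G : ℕ → ℕ → L} (hF : MatProd 1 N E F F)
    (hG : MatProd 1 N E G G) (hFG : Compat N F G) :
    ∃ H : ℕ → ℕ → L, MatProd 1 N E H H ∧
      ∀ i j k, (1 ≤ i ∧ i ≤ N ∧ 1 ≤ j ∧ j ≤ N ∧ 1 ≤ k ∧ k ≤ N ∧ i ≠ j ∧ j ≠ k ∧ i ≠ k) →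
        ⁅F i j, G j k⁆ = H i k := by
  choose q hq using fun i k => exists_label hN i k k
  have hH : ∀ i j k, (1 ≤ i ∧ i ≤ N ∧ 1 ≤ j ∧ j ≤ N ∧ 1 ≤ k ∧ k ≤ N ∧ i ≠ j ∧ j ≠ k ∧ i ≠ k) →
      ⁅F i j, G j k⁆ = ⁅F i (q i k), G (q i k) k⁆ := by
    intro i j k hi
    have := hq i k
    by_cases hj : j = q i k
    · rw [hj]
    rw [← hG.mul (i := j) (j := q i k) (l := k), leibniz_lie, hF.symm.mul, hFG i j (q i k) k (by omega), lie_zero,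
      add_zero]
  refine ⟨fun i k => ⁅F i (q i k), G (q i k) k⁆, ?_, hH⟩
  refine MatProd.of_cases ?_ ?_ ?_
  · intro a i k h
    obtain ⟨j, hj⟩ := exists_label hN a i k
    rw [← hH i j k (by omega), ← hH a j k (by omega), leibniz_lie, hF.mul, hG.zero, lie_zero,
      add_zero]
  · intro k b i h
    obtain ⟨j, hj⟩ := exists_label hN k b i
    rw [← hH i j k (by omega), ← hH i j b (by omega), leibniz_lie, hF.zero, hG.mul_neg, zero_lie,
      zero_add, lie_neg]
  · intro c d i k h
    by_cases hci : c = i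
    · obtain ⟨j, hj⟩ := exists_label hN i k d
      rw [← hH i j k (by omega), leibniz_lie, hF.zero, hG.zero, zero_lie, lie_zero, add_zero]
    · rw [← hH i c k (by omega), leibniz_lie, hF.mul_neg, hG.zero, lie_zero, add_zero, neg_lie,
        hFG _ _ _ _ (by omega), neg_zero]

/-- Associativity: the product of `A` with `H = F G` is determined by `(A F) G` and `F (A G)`. -/
theorem MatProd.assoc {N : ℕ} (hN : 4 ≤ N) {A F G H AF AG K : ℕ → ℕ → L}
    (hAF : MatProd 1 N A F AF) (hAG : MatProd 1 N A G AG) (hFG : MatProd 1 N F G H)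
    (h₁ : MatProd 1 N F AG K) (h₂ : MatProd 1 N AF G K) : MatProd 1 N A H K := by
  refine MatProd.of_cases ?_ ?_ ?_
  · intro i j l h
    obtain ⟨m, hm⟩ := exists_label hN i j l
    rw [← hFG.mul (i := j) (j := m) (l := l), leibniz_lie, hAF.mul, hAG.zero, lie_zero, add_zero,
      h₂.mul]
  · intro i j k h
    obtain ⟨m, hm⟩ := exists_label hN i j k
    rw [← hFG.mul (i := k) (j := m) (l := i), leibniz_lie, hAF.zero, hAG.mul_neg, zero_lie,
      zero_add, lie_neg, h₁.mul]
  · intro i j k l h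
    by_cases hjl : j = l
    · obtain ⟨m, hm⟩ := exists_label hN i j k
      rw [← hFG.mul (i := k) (j := m) (l := l), leibniz_lie, hAF.zero, hAG.zero, zero_lie, zero_add,
        lie_zero]
    · rw [← hFG.mul (i := k) (j := j) (l := l), leibniz_lie, hAF.zero, hAG.mul, zero_lie, zero_add,
        h₁.zero]

section
variable [LieAlgebra ℂ L]

/-- The next power of a family `T` that is compatible with itself: if `G' = T G`, then `T` and
`G'` have a product. -/
lemma exists_next {N : ℕ} (hN : 4 ≤ N) {E T G G' : ℕ → ℕ → L} (hT : MatProd 1 N E T T)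
    (hTT : Compat N T T) (hG' : MatProd 1 N E G' G') (hTG : MatProd 1 N T G G') :
    ∃ H : ℕ → ℕ → L, MatProd 1 N E H H ∧ MatProd 1 N T G' H := by
  -- A fifth label is not available if `i, j, k, l` are distinct and `N = 4`.
  have h₁ : ∀ i j k l : ℕ, (1 ≤ i ∧ i ≤ N ∧ 1 ≤ j ∧ j ≤ N ∧ 1 ≤ k ∧ k ≤ N ∧ 1 ≤ l ∧ l ≤ N ∧
      i ≠ j ∧ k ≠ l ∧ j ≠ k ∧ i ≠ l ∧ (i = k ∨ j = l)) → ⁅T i j, G' k l⁆ = 0 := by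
    intro i j k l h
    obtain ⟨m, hm, hm'⟩ : ∃ m, (1 ≤ m ∧ m ≤ N) ∧ m ≠ i ∧ m ≠ j ∧ m ≠ k ∧ m ≠ l := by
      rcases h with ⟨-, -, -, -, -, -, -, -, -, -, -, -, rfl | rfl⟩
      · obtain ⟨m, hm⟩ := exists_label hN i j l
        exact ⟨m, by omega⟩
      · obtain ⟨m, hm⟩ := exists_label hN i j k
        exact ⟨m, by omega⟩
    rw [← hTG.mul (i := k) (j := m) (l := l), leibniz_lie, hTT _ _ _ _ (by omega), hTG.zero,
      zero_lie, lie_zero, add_zero]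
  have hc : Compat N T G' := by
    intro i j k l h
    by_cases hd : i = k ∨ j = l
    · exact h₁ i j k l (by omega)
    have ha : ⁅T i j, G' k l⁆ = ⁅T k j, G' i l⁆ := by
      rw [← hTG.mul (i := k) (j := j) (l := l), leibniz_lie, hTT _ _ _ _ (by omega), hTG.mul,
        zero_lie, zero_add]
    have hb : ⁅T i j, G' k l⁆ = -⁅T k j, G' i l⁆ := by
      rw [← hG'.mul (i := k) (j := i) (l := l), leibniz_lie, ← lie_skew (T i j), hT.mul,
        h₁ i j i l (by omega), lie_zero, add_zero, neg_lie]
    -- The two expressions of `[T_ij, G'_kl]` by `[T_kj, G'_il]` differ by a sign.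
    refine eq_zero_of_add_self (x := ⁅T i j, G' k l⁆) ?_
    nth_rewrite 1 [ha]
    rw [hb, add_neg_cancel]
  obtain ⟨H, hH, hH'⟩ := exists_prod hN hT hG' hc
  refine ⟨H, hH, MatProd.of_cases (fun i j l h => hH' i j l (by omega)) ?_
    fun i j k l h => hc i j k l (by omega)⟩
  intro i j k h
  obtain ⟨m, hm⟩ := exists_label hN i j k
  rw [← hTG.mul (i := k) (j := m) (l := i), leibniz_lie, hTT _ _ _ _ (by omega), hTG.mul_neg,
    zero_lie, zero_add, lie_neg, hH' k m j (by omega)]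

/-- The nonnegative powers of a family that is compatible with itself. -/
lemma exists_powers {N : ℕ} (hN : 4 ≤ N) {E T : ℕ → ℕ → L} (hE : MatProd 1 N E E E)
    (hT : MatProd 1 N E T T) (hTT : Compat N T T) :
    ∃ P : ℕ → ℕ → ℕ → L, P 0 = E ∧ P 1 = T ∧ ∀ r, MatProd 1 N E (P r) (P r) ∧
      MatProd 1 N T (P r) (P (r + 1)) := by
  let X := {x : (ℕ → ℕ → L) × (ℕ → ℕ → L) // MatProd 1 N E x.1 x.1 ∧ MatProd 1 N E x.2 x.2 ∧
    MatProd 1 N T x.1 x.2}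
  choose next hnext using fun x : X => exists_next hN hT hTT x.2.2.1 x.2.2.2
  let s : ℕ → X := fun r => Nat.rec ⟨(E, T), hE, hT, hT.symm⟩
    (fun _ x => ⟨(x.1.2, next x), x.2.2.1, (hnext x).1, (hnext x).2⟩) r
  exact ⟨fun r => (s r).1.1, rfl, rfl, fun r => ⟨(s r).2.1, (s r).2.2.2⟩⟩

/-- All powers of an invertible family. -/
theorem exists_loop {N : ℕ} (hN : 4 ≤ N) {E T T' : ℕ → ℕ → L} (hE : MatProd 1 N E E E)
    (hT : MatProd 1 N E T T) (hTT : Compat N T T) (hT' : MatProd 1 N E T' T')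
    (hTT' : Compat N T' T') (hinv : MatProd 1 N T T' E) :
    ∃ Z : ℤ → ℕ → ℕ → L, Z 0 = E ∧ Z 1 = T ∧ Z (-1) = T' ∧
      ∀ r s, MatProd 1 N (Z r) (Z s) (Z (r + s)) := by
  obtain ⟨P, hP₀, hP₁, hP⟩ := exists_powers hN hE hT hTT
  obtain ⟨Q, hQ₀, hQ₁, hQ⟩ := exists_powers hN hE hT' hTT'
  let Z : ℤ → ℕ → ℕ → L := fun r => if 0 ≤ r then P r.toNat else Q (-r).toNat
  have hZp : ∀ r : ℕ, Z r = P r := fun r => by simp [Z]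
  have hZn : ∀ r : ℕ, Z (-r) = Q r := fun r => by
    by_cases h : r = 0
    · subst h
      simp [Z, hP₀, hQ₀]
    · have : ¬(0 : ℤ) ≤ -r := by omega
      simp only [Z, if_neg this, neg_neg, Int.toNat_natCast]
  -- Associativity moves the factor `T'` past one factor `T` of `P (r + 1) = T * P r`.
  have hT'P : ∀ r : ℕ, MatProd 1 N T' (P r) (Z (r - 1)) := by
    intro r
    induction r with
    | zero =>
      have : Z ((0 : ℕ) - 1) = T' := by
        rw [show ((0 : ℕ) - 1 : ℤ) = -(1 : ℕ) by norm_num, hZn, hQ₁]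
      rw [this, hP₀]
      exact hT'.symm
    | succ r ih =>
      rw [show ((r + 1 : ℕ) : ℤ) - 1 = (r : ℕ) by push_cast; ring, hZp]
      refine MatProd.assoc hN hinv.symm ih (hP r).2 ?_ (hP r).1
      cases r with
      | zero =>
        rw [show ((0 : ℕ) - 1 : ℤ) = -(1 : ℕ) by norm_num, hZn, hQ₁, hP₀]
        exact hinv
      | succ r =>
        rw [show ((r + 1 : ℕ) : ℤ) - 1 = (r : ℕ) by push_cast; ring, hZp]
        exact (hP r).2
  have hTQ : ∀ r : ℕ, MatProd 1 N T (Q r) (Z (1 - r)) := by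
    intro r
    induction r with
    | zero =>
      have : Z (1 - (0 : ℕ)) = T := by
        rw [show (1 - (0 : ℕ) : ℤ) = (1 : ℕ) by norm_num, hZp, hP₁]
      rw [this, hQ₀]
      exact hT.symm
    | succ r ih =>
      rw [show 1 - ((r + 1 : ℕ) : ℤ) = -(r : ℕ) by push_cast; ring, hZn]
      refine MatProd.assoc hN hinv ih (hQ r).2 ?_ (hQ r).1
      cases r with
      | zero =>
        rw [show (1 - (0 : ℕ) : ℤ) = (1 : ℕ) by norm_num, hZp, hP₁, hQ₀]
        exact hinv.symm
      | succ r =>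
        rw [show 1 - ((r + 1 : ℕ) : ℤ) = -(r : ℕ) by push_cast; ring, hZn]
        exact (hQ r).2
  have hZT : ∀ r : ℤ, MatProd 1 N T (Z r) (Z (r + 1)) := by
    intro r
    obtain ⟨s, rfl | rfl⟩ := r.eq_nat_or_neg
    · rw [hZp, show (s : ℤ) + 1 = (s + 1 : ℕ) by push_cast; ring, hZp]
      exact (hP s).2
    · rw [hZn, neg_add_eq_sub]
      exact hTQ s
  have hZT' : ∀ r : ℤ, MatProd 1 N T' (Z r) (Z (r - 1)) := by
    intro r
    obtain ⟨s, rfl | rfl⟩ := r.eq_nat_or_neg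
    · rw [hZp]
      exact hT'P s
    · rw [hZn, show -(s : ℤ) - 1 = -(s + 1 : ℕ) by push_cast; ring, hZn]
      exact (hQ s).2
  have hZE : ∀ r : ℤ, MatProd 1 N E (Z r) (Z r) := by
    intro r
    obtain ⟨s, rfl | rfl⟩ := r.eq_nat_or_neg
    · rw [hZp]
      exact (hP s).1
    · rw [hZn]
      exact (hQ s).1
  have hZp' : ∀ (r : ℕ) (s : ℤ), MatProd 1 N (Z s) (P r) (Z (s + r)) := by
    intro r
    induction r with
    | zero =>
      intro s
      rw [hP₀, Nat.cast_zero, add_zero]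
      exact (hZE s).symm
    | succ r ih =>
      intro s
      refine MatProd.assoc hN (hZT s).symm (ih s) (hP r).2 ?_ ?_
      · rw [Nat.cast_add, Nat.cast_one, ← add_assoc]
        exact hZT _
      · rw [Nat.cast_add, Nat.cast_one, show s + (r + 1 : ℤ) = s + 1 + r by ring]
        exact ih _
  have hZn' : ∀ (r : ℕ) (s : ℤ), MatProd 1 N (Z s) (Q r) (Z (s - r)) := by
    intro r
    induction r with
    | zero =>
      intro s
      rw [hQ₀, Nat.cast_zero, sub_zero]
      exact (hZE s).symm
    | succ r ih =>
      intro s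
      refine MatProd.assoc hN (hZT' s).symm (ih s) (hQ r).2 ?_ ?_
      · rw [Nat.cast_add, Nat.cast_one, ← sub_sub]
        exact hZT' _
      · rw [Nat.cast_add, Nat.cast_one, show s - (r + 1 : ℤ) = s - 1 - r by ring]
        exact ih _
  refine ⟨Z, ?_, ?_, ?_, fun r s => ?_⟩
  · rw [← Nat.cast_zero, hZp, hP₀]
  · rw [← Nat.cast_one, hZp, hP₁]
  · rw [← Nat.cast_one, hZn, hQ₁]
  · obtain ⟨t, rfl | rfl⟩ := s.eq_nat_or_neg
    · rw [hZp t]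
      exact hZp' t r
    · rw [hZn t, ← sub_eq_add_neg]
      exact hZn' t r

end
end Steinberg
end

noncomputable section

/-! ### Root vectors from the Chevalley generators of the affine Lie algebra -/

namespace Steinberg
variable {L : Type*} [LieRing L]

/-- The Serre relations between the Chevalley generators `e_0, …, e_{N-1}`, `f_0, …, f_{N-1}` of
the affine Lie algebra of `sl(N)`, `N ≥ 4`. -/
structure ChevalleyAffine (N : ℕ) (e f : ℕ → L) : Prop where
  sl : ChevalleySl N e f
  ef₁ : ∀ i, (1 ≤ i ∧ i < N) → ⁅f i, e 0⁆ = 0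
  ef₂ : ∀ i, (1 ≤ i ∧ i < N) → ⁅e i, f 0⁆ = 0
  ee : ∀ i, (2 ≤ i ∧ i + 1 < N) → ⁅e i, e 0⁆ = 0
  ff : ∀ i, (2 ≤ i ∧ i + 1 < N) → ⁅f i, f 0⁆ = 0
  he₁ : ∀ i, (i = 1 ∨ i + 1 = N) → ⁅⁅e i, f i⁆, e 0⁆ = -e 0
  hf₁ : ∀ i, (i = 1 ∨ i + 1 = N) → ⁅⁅e i, f i⁆, f 0⁆ = f 0
  he₂ : ∀ i, (i = 1 ∨ i + 1 = N) → ⁅⁅e 0, f 0⁆, e i⁆ = -e i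
  hf₂ : ∀ i, (i = 1 ∨ i + 1 = N) → ⁅⁅e 0, f 0⁆, f i⁆ = f i
  eee₁ : ∀ i, (i = 1 ∨ i + 1 = N) → ⁅e i, ⁅e i, e 0⁆⁆ = 0
  fff₁ : ∀ i, (i = 1 ∨ i + 1 = N) → ⁅f i, ⁅f i, f 0⁆⁆ = 0
  eee₂ : ∀ i, (i = 1 ∨ i + 1 = N) → ⁅e 0, ⁅e 0, e i⁆⁆ = 0
  fff₂ : ∀ i, (i = 1 ∨ i + 1 = N) → ⁅f 0, ⁅f 0, f i⁆⁆ = 0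

namespace ChevalleyAffine

variable {N : ℕ} {e f : ℕ → L}

lemma dual (h : ChevalleyAffine N e f) : ChevalleyAffine N (fun i => -f i) fun i => -e i := by
  have hh : ∀ i, ⁅-f i, -e i⁆ = -⁅e i, f i⁆ := fun i => by
    rw [neg_lie, lie_neg, neg_neg, lie_skew]
  exact
  { sl := h.sl.dual
    ef₁ := fun i hi => by rw [neg_lie, lie_neg, neg_neg, h.ef₂ i hi]
    ef₂ := fun i hi => by rw [neg_lie, lie_neg, neg_neg, h.ef₁ i hi]
    ee := fun i hi => by rw [neg_lie, lie_neg, neg_neg, h.ff i hi]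
    ff := fun i hi => by rw [neg_lie, lie_neg, neg_neg, h.ee i hi]
    he₁ := fun i hi => by rw [hh, neg_lie, lie_neg, neg_neg, h.hf₁ i hi, neg_neg]
    hf₁ := fun i hi => by rw [hh, neg_lie, lie_neg, neg_neg, h.he₁ i hi]
    he₂ := fun i hi => by rw [hh, neg_lie, lie_neg, neg_neg, h.hf₂ i hi, neg_neg]
    hf₂ := fun i hi => by rw [hh, neg_lie, lie_neg, neg_neg, h.he₂ i hi]
    eee₁ := fun i hi => by simp only [neg_lie, lie_neg, neg_neg, h.fff₁ i hi, neg_zero]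
    fff₁ := fun i hi => by simp only [neg_lie, lie_neg, neg_neg, h.eee₁ i hi, neg_zero]
    eee₂ := fun i hi => by simp only [neg_lie, lie_neg, neg_neg, h.fff₂ i hi, neg_zero]
    fff₂ := fun i hi => by simp only [neg_lie, lie_neg, neg_neg, h.eee₂ i hi, neg_zero] }

end ChevalleyAffine

variable [LieAlgebra ℂ L]

/-- The family generated by `e_0`, which plays the role of `E_N1 t`. -/
lemma ChevalleyAffine.exists_family {N : ℕ} (hN : 4 ≤ N) {e f : ℕ → L}
    (h : ChevalleyAffine N e f) {E : ℕ → ℕ → L} (hE : MatProd 1 N E E E)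
    (he : ∀ i, 1 ≤ i → i < N → E i (i + 1) = e i)
    (hf : ∀ i, 1 ≤ i → i < N → E (i + 1) i = f i) :
    ∃ T : ℕ → ℕ → L, MatProd 1 N E T T ∧ T N 1 = e 0 ∧ Compat N T T := by
  obtain ⟨p, rfl⟩ : ∃ p, N = p + 1 := ⟨N - 1, by omega⟩
  have he1 : E 1 2 = e 1 := he 1 (by omega) (by omega)
  have hf1 : E 2 1 = f 1 := hf 1 (by omega) (by omega)
  have hep : E p (p + 1) = e p := he p (by omega) (by omega)
  have hfp : E (p + 1) p = f p := hf p (by omega) (by omega)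
  have h₀ : ∀ i, (i = 1 ∨ i = p) → ⁅f i, ⁅e i, e 0⁆⁆ = e 0 := by
    intro i hi
    rw [leibniz_lie, h.ef₁ i (by omega), lie_zero, add_zero, ← lie_skew (f i), neg_lie,
      h.he₁ i (by omega), neg_neg]
  obtain ⟨T, hT, hTv⟩ := Steinberg.exists_family hN hE (v := e 0) (by
      intro k l hk
      rcases Nat.lt_or_gt_of_ne hk.2.2.2.2.1 with hlt | hlt
      · refine lie_eq_zero_of_lt hE (by omega) hlt (by omega) fun i hi hi' => ?_
        rw [he i (by omega) (by omega), h.ee i (by omega)]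
      · refine lie_eq_zero_of_gt hE (by omega) hlt (by omega) fun i hi hi' => ?_
        rw [hf i (by omega) (by omega), h.ef₁ i (by omega)])
    (by rw [Nat.add_sub_cancel, hep, hfp, h₀ p (by omega)])
    (by rw [Nat.add_sub_cancel, hep, h.eee₁ p (by omega)])
    (by rw [he1, hf1, h₀ 1 (by omega)])
    (by rw [he1, h.eee₁ 1 (by omega)])
  refine ⟨T, hT, hTv, compat_of_row hN hT hT ?_⟩
  have h₁ : ∀ l, (1 ≤ l ∧ l ≤ p) → ⁅T (p + 1) 1, T (p + 1) l⁆ = 0 := by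
    have h₂ : ⁅T (p + 1) 1, T (p + 1) 2⁆ = 0 := by
      rw [← hT.symm.mul (i := p + 1) (j := 1) (l := 2), hTv, he1, h.eee₂ 1 (by omega)]
    intro l hl
    by_cases hl1 : l = 1
    · rw [hl1, lie_self]
    by_cases hl2 : l = 2
    · rw [hl2, h₂]
    rw [← hT.symm.mul (i := p + 1) (j := 2) (l := l), leibniz_lie, h₂, hT.symm.zero, zero_lie,
      lie_zero, add_zero]
  have h₂ : ∀ k, (2 ≤ k ∧ k ≤ p) → ⁅T (p + 1) 1, T k 1⁆ = 0 := by
    have h₂ : ⁅T (p + 1) 1, T p 1⁆ = 0 := by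
      rw [← hT.mul (i := p) (j := p + 1) (l := 1), hTv, hep, ← lie_skew (e p), lie_neg,
        h.eee₂ p (by omega), neg_zero]
    intro l hl
    by_cases hl2 : l = p
    · rw [hl2, h₂]
    rw [← hT.mul (i := l) (j := p) (l := 1), leibniz_lie, h₂, hT.symm.zero, zero_lie,
      lie_zero, add_zero]
  intro k l hk
  by_cases hkN : k = p + 1
  · rw [hkN, h₁ l (by omega)]
  by_cases hl1 : l = 1
  · rw [hl1, h₂ k (by omega)]
  have ha : ⁅T (p + 1) 1, T k l⁆ = -⁅T k 1, T (p + 1) l⁆ := by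
    rw [← hT.mul (i := k) (j := p + 1) (l := l), leibniz_lie, h₁ l (by omega), lie_zero, add_zero,
      hT.symm.mul_neg, neg_lie]
  have hb : ⁅T (p + 1) 1, T k l⁆ = ⁅T k 1, T (p + 1) l⁆ := by
    rw [← hT.symm.mul (i := k) (j := 1) (l := l), leibniz_lie, h₂ k (by omega), zero_lie, zero_add,
      hT.symm.mul]
  -- The two expressions by `[T_k1, T_{N,l}]` differ by a sign.
  refine eq_zero_of_add_self (x := ⁅T (p + 1) 1, T k l⁆) ?_
  nth_rewrite 1 [ha]
  rw [hb, neg_add_cancel]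

/-- Chevalley generators of the affine Lie algebra of `sl(N)` generate matrix units with entries
in the Laurent polynomials. -/
theorem ChevalleyAffine.exists_loop {N : ℕ} (hN : 4 ≤ N) {e f : ℕ → L}
    (h : ChevalleyAffine N e f) :
    ∃ Z : ℤ → ℕ → ℕ → L, (∀ r s, MatProd 1 N (Z r) (Z s) (Z (r + s))) ∧
      (∀ i, 1 ≤ i → i < N → Z 0 i (i + 1) = e i) ∧ (∀ i, 1 ≤ i → i < N → Z 0 (i + 1) i = f i) ∧
      Z 1 N 1 = e 0 ∧ Z (-1) 1 N = f 0 := by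
  obtain ⟨E, hE, he, hf⟩ := h.sl.exists_matProd (m := N) (by omega) le_rfl
  obtain ⟨T, hT, hTv, hTT⟩ := h.exists_family hN hE he hf
  obtain ⟨U, hU, hUv, hUU⟩ := h.dual.exists_family hN hE.dual
    (fun i h₁ h₂ => by rw [hf i h₁ h₂]) (fun i h₁ h₂ => by rw [he i h₁ h₂])
  set T' : ℕ → ℕ → L := fun i j => -U j i with hT'_def
  have hT' : MatProd 1 N E T' T' := by simpa using hU.dual
  have hT'v : T' 1 N = f 0 := by rw [hT'_def]; simp only [hUv, neg_neg]
  have hTT' : Compat N T' T' := by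
    intro i j k l hi
    simp only [hT'_def]
    rw [neg_lie, lie_neg, neg_neg, hUU _ _ _ _ (by omega)]
  -- `[e_0, f_0]` acts on the matrix units `E_Nl` and `E_k1` like `E_NN - E_11`.
  have hh₁ : ∀ l, (2 ≤ l ∧ l < N) → ⁅⁅e 0, f 0⁆, E N l⁆ = E N l := by
    intro l hl
    obtain ⟨p, rfl⟩ : ∃ p, N = p + 1 := ⟨N - 1, by omega⟩
    have h₀ : ⁅⁅e 0, f 0⁆, E (p + 1) p⁆ = E (p + 1) p := by
      rw [hf p (by omega) (by omega), h.hf₂ p (by omega)]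
    by_cases hl2 : l = p
    · rw [hl2, h₀]
    have h₁ : ⁅E p l, ⁅e 0, f 0⁆⁆ = 0 := by
      refine lie_eq_zero_of_gt hE (by omega) (by omega) (by omega) fun i hi hi' => ?_
      rw [hf i (by omega) (by omega), leibniz_lie, h.ef₁ i (by omega), h.ff i (by omega), zero_lie,
        lie_zero, add_zero]
    rw [← hE.mul (i := p + 1) (j := p) (l := l), leibniz_lie, h₀, ← lie_skew ⁅e 0, f 0⁆ (E p l),
      h₁, neg_zero, lie_zero, add_zero]
  have hh₂ : ∀ k, (2 ≤ k ∧ k < N) → ⁅E k 1, ⁅e 0, f 0⁆⁆ = -E k 1 := by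
    intro k hk
    have h₀ : ⁅E 2 1, ⁅e 0, f 0⁆⁆ = -E 2 1 := by
      rw [hf 1 (by omega) (by omega), ← lie_skew (f 1), h.hf₂ 1 (by omega)]
    by_cases hk2 : k = 2
    · rw [hk2, h₀]
    have h₁ : ⁅E k 2, ⁅e 0, f 0⁆⁆ = 0 := by
      refine lie_eq_zero_of_gt hE (by omega) (by omega) (by omega) fun i hi hi' => ?_
      rw [hf i (by omega) (by omega), leibniz_lie, h.ef₁ i (by omega), h.ff i (by omega), zero_lie,
        lie_zero, add_zero]
    rw [← hE.mul (i := k) (j := 2) (l := 1), lie_lie, h₀, h₁, lie_zero, sub_zero, lie_neg]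
  have h₁ : ∀ l, (2 ≤ l ∧ l < N) → ⁅T N 1, T' 1 l⁆ = E N l := by
    intro l hl
    rw [← hT'.symm.mul (i := 1) (j := N) (l := l), leibniz_lie, hT.symm.zero (i := N) (j := 1),
      lie_zero, add_zero, hTv, hT'v, hh₁ l hl]
  have h₂ : ∀ k, (2 ≤ k ∧ k < N) → ⁅T N 1, T' k N⁆ = -E k 1 := by
    intro k hk
    rw [← hT'.mul (i := k) (j := 1) (l := N), leibniz_lie, hT.symm.zero (i := N) (j := 1),
      zero_lie, zero_add, hTv, hT'v, hh₂ k hk]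
  have h₃ : ∀ k l, (2 ≤ k ∧ k < N ∧ 2 ≤ l ∧ l < N ∧ k ≠ l) → ⁅T N 1, T' k l⁆ = 0 := by
    intro k l hk
    rw [← hT'.mul (i := k) (j := 1) (l := l), leibniz_lie, hT.symm.zero (i := N) (j := 1),
      zero_lie, zero_add, h₁ l (by omega), hE.zero]
  have h₄ : ∀ k, (2 ≤ k ∧ k < N) → ⁅T N 1, T' k 1⁆ = 0 := by
    intro k hk
    obtain ⟨m, hm⟩ := exists_label hN 1 N k
    rw [← hT'.symm.mul (i := k) (j := m) (l := 1), leibniz_lie, h₃ k m (by omega),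
      hT.symm.zero (i := N) (j := 1), zero_lie, lie_zero, add_zero]
  have hinv : MatProd 1 N T T' E := by
    refine matProd_of_row hN hT hT' hE fun k l hk => ?_
    by_cases hk1 : k = 1
    · subst hk1
      rw [if_pos rfl, if_neg (by omega), sub_zero, h₁ l (by omega)]
    rw [if_neg (by omega)]
    by_cases hlN : l = N
    · subst hlN
      rw [if_pos rfl, zero_sub, h₂ k (by omega)]
    rw [if_neg (by omega), sub_zero]
    by_cases hkN : k = N
    · subst hkN
      obtain ⟨m, hm⟩ := exists_label hN 1 k l
      rw [← hT'.mul (i := k) (j := m) (l := l), leibniz_lie, hT.symm.zero (i := k) (j := 1),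
        zero_lie, zero_add]
      by_cases hl1 : l = 1
      · rw [hl1, h₄ m (by omega), lie_zero]
      · rw [h₃ m l (by omega), lie_zero]
    · by_cases hl1 : l = 1
      · rw [hl1, h₄ k (by omega)]
      · rw [h₃ k l (by omega)]
  obtain ⟨Z, hZ₀, hZ₁, hZ₂, hZ⟩ := Steinberg.exists_loop hN hE hT hTT hT' hTT' hinv
  refine ⟨Z, hZ, ?_, ?_, ?_, ?_⟩
  · rw [hZ₀]
    exact he
  · rw [hZ₀]
    exact hf
  · rw [hZ₁, hTv]
  · rw [hZ₂, hT'v]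

end Steinberg
end

noncomputable section

/-! ### Diagonal elements and the central cocycle -/

namespace Steinberg

section Diagonal

variable {L : Type*} [LieRing L] {N : ℕ} {Z : ℤ → ℕ → ℕ → L}

/-- The difference between `[E_ij t^r, E_ji t^s]` and `[E_ij t^(r+s), E_ji]`, which in the affine
Lie algebra is the central element `r δ_{r+s,0} c`. -/
def centralTerm (Z : ℤ → ℕ → ℕ → L) (i j : ℕ) (r s : ℤ) : L :=
  ⁅Z r i j, Z s j i⁆ - ⁅Z (r + s) i j, Z 0 j i⁆

lemma lie_opposite (hZ : ∀ r s, MatProd 1 N (Z r) (Z s) (Z (r + s))) {i j k : ℕ}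
    (h : 1 ≤ i ∧ i ≤ N ∧ 1 ≤ j ∧ j ≤ N ∧ 1 ≤ k ∧ k ≤ N ∧ i ≠ j ∧ j ≠ k ∧ i ≠ k) (r s u : ℤ) :
    ⁅Z r i j, Z (s + u) j i⁆ = ⁅Z (r + s) i k, Z u k i⁆ - ⁅Z s j k, Z (r + u) k j⁆ := by
  rw [← (hZ s u).mul (i := j) (j := k) (l := i), leibniz_lie, (hZ r s).mul, (hZ r u).mul_neg,
    lie_neg, sub_eq_add_neg]

lemma lie_opposite_zero (hZ : ∀ r s, MatProd 1 N (Z r) (Z s) (Z (r + s))) {i j k : ℕ}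
    (h : 1 ≤ i ∧ i ≤ N ∧ 1 ≤ j ∧ j ≤ N ∧ 1 ≤ k ∧ k ≤ N ∧ i ≠ j ∧ j ≠ k ∧ i ≠ k) (r s : ℤ) :
    ⁅Z r i j, Z s j i⁆ = ⁅Z (r + s) i k, Z 0 k i⁆ + ⁅Z r k j, Z s j k⁆ := by
  have := lie_opposite hZ h r s 0
  rw [add_zero, add_zero, ← lie_skew (Z s j k) (Z r k j), sub_neg_eq_add] at this
  exact this

lemma lie_opposite_additive (hZ : ∀ r s, MatProd 1 N (Z r) (Z s) (Z (r + s))) {i j k : ℕ}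
    (h : 1 ≤ i ∧ i ≤ N ∧ 1 ≤ j ∧ j ≤ N ∧ 1 ≤ k ∧ k ≤ N ∧ i ≠ j ∧ j ≠ k ∧ i ≠ k) (r : ℤ) :
    ⁅Z r i j, Z 0 j i⁆ = ⁅Z r i k, Z 0 k i⁆ + ⁅Z r k j, Z 0 j k⁆ := by
  simpa using lie_opposite_zero hZ h r 0

lemma centralTerm_eq_left (hZ : ∀ r s, MatProd 1 N (Z r) (Z s) (Z (r + s))) {i j k : ℕ}
    (h : 1 ≤ i ∧ i ≤ N ∧ 1 ≤ j ∧ j ≤ N ∧ 1 ≤ k ∧ k ≤ N ∧ i ≠ j ∧ j ≠ k ∧ i ≠ k) (r s : ℤ) :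
    centralTerm Z i j r s = centralTerm Z k j r s := by
  rw [centralTerm, centralTerm, lie_opposite_zero hZ h, lie_opposite_additive hZ h]
  abel

lemma centralTerm_rotate_aux (hZ : ∀ r s, MatProd 1 N (Z r) (Z s) (Z (r + s))) {i j k : ℕ}
    (h : 1 ≤ i ∧ i ≤ N ∧ 1 ≤ j ∧ j ≤ N ∧ 1 ≤ k ∧ k ≤ N ∧ i ≠ j ∧ j ≠ k ∧ i ≠ k) (r s : ℤ) :
    centralTerm Z i j r s - centralTerm Z k i r s =
      (⁅Z (r + s) i k, Z 0 k i⁆ + ⁅Z (r + s) k i, Z 0 i k⁆) -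
        (⁅Z (r + s) j i, Z 0 i j⁆ + ⁅Z (r + s) i j, Z 0 j i⁆) := by
  rw [centralTerm, centralTerm, lie_opposite_zero hZ h, ← lie_skew (Z r k j) (Z s j k),
    lie_opposite_zero hZ (i := j) (j := k) (k := i) (by omega) s r, ← lie_skew (Z r k i) (Z s i k),
    add_comm s r]
  abel

lemma centralTerm_zero (i j : ℕ) (r : ℤ) : centralTerm Z i j r 0 = 0 := by
  rw [centralTerm, add_zero, sub_self]

/-- The right-hand side of `centralTerm_rotate_aux` depends on `r + s` only and vanishes for
`s = 0`. -/
lemma centralTerm_rotate (hZ : ∀ r s, MatProd 1 N (Z r) (Z s) (Z (r + s))) {i j k : ℕ}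
    (h : 1 ≤ i ∧ i ≤ N ∧ 1 ≤ j ∧ j ≤ N ∧ 1 ≤ k ∧ k ≤ N ∧ i ≠ j ∧ j ≠ k ∧ i ≠ k) (r s : ℤ) :
    centralTerm Z i j r s = centralTerm Z k i r s := by
  have h₁ := centralTerm_rotate_aux hZ h (r + s) 0
  rw [centralTerm_zero, centralTerm_zero, sub_zero, add_zero] at h₁
  rw [← sub_eq_zero, centralTerm_rotate_aux hZ h, ← h₁]

lemma lie_opposite_antisymm (hN : 4 ≤ N) (hZ : ∀ r s, MatProd 1 N (Z r) (Z s) (Z (r + s)))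
    {i j : ℕ} (h : 1 ≤ i ∧ i ≤ N ∧ 1 ≤ j ∧ j ≤ N ∧ i ≠ j) (p : ℤ) :
    ⁅Z p i j, Z 0 j i⁆ = -⁅Z p j i, Z 0 i j⁆ := by
  obtain ⟨k, hk⟩ := exists_label hN i j j
  have h₁ := centralTerm_rotate_aux hZ (i := i) (j := j) (k := k) (by omega) p 0
  have h₂ := centralTerm_rotate_aux hZ (i := j) (j := i) (k := k) (by omega) p 0
  have h₃ := lie_opposite_additive hZ (i := i) (j := j) (k := k) (by omega) p
  have h₄ := lie_opposite_additive hZ (i := j) (j := i) (k := k) (by omega) p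
  simp only [centralTerm_zero, add_zero, sub_zero] at h₁ h₂
  have e₁ := sub_eq_zero.1 h₁.symm
  have e₂ := sub_eq_zero.1 h₂.symm
  rw [eq_neg_iff_add_eq_zero]
  generalize ⁅Z p i j, Z 0 j i⁆ = x at *
  generalize ⁅Z p j i, Z 0 i j⁆ = y at *
  generalize ⁅Z p i k, Z 0 k i⁆ = a at *
  generalize ⁅Z p k i, Z 0 i k⁆ = b at *
  generalize ⁅Z p j k, Z 0 k j⁆ = c at *
  generalize ⁅Z p k j, Z 0 j k⁆ = d at *
  -- `x + y = (a + d) + (c + b) = (x + y) + (x + y)`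
  have : x + y = (y + x) + (x + y) := by
    conv_lhs => rw [h₃, h₄]
    rw [← e₁, ← e₂]
    abel
  have h0 : y + x = 0 := by simpa using this
  rw [add_comm, h0]

lemma centralTerm_swap (hN : 4 ≤ N) (hZ : ∀ r s, MatProd 1 N (Z r) (Z s) (Z (r + s)))
    {i j : ℕ} (h : 1 ≤ i ∧ i ≤ N ∧ 1 ≤ j ∧ j ≤ N ∧ i ≠ j) (r s : ℤ) :
    centralTerm Z i j r s = centralTerm Z j i r s := by
  obtain ⟨k, hk⟩ := exists_label hN i j j
  rw [centralTerm_rotate hZ (i := i) (j := j) (k := k) (by omega),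
    centralTerm_eq_left hZ (i := k) (j := i) (k := j) (by omega)]

lemma centralTerm_eq_right (hN : 4 ≤ N) (hZ : ∀ r s, MatProd 1 N (Z r) (Z s) (Z (r + s)))
    {i j k : ℕ}
    (h : 1 ≤ i ∧ i ≤ N ∧ 1 ≤ j ∧ j ≤ N ∧ 1 ≤ k ∧ k ≤ N ∧ i ≠ j ∧ j ≠ k ∧ i ≠ k) (r s : ℤ) :
    centralTerm Z i j r s = centralTerm Z i k r s := by
  rw [centralTerm_rotate hZ h, centralTerm_swap hN hZ (by omega)]

/-- The central term does not depend on the labels. -/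
lemma centralTerm_eq (hN : 4 ≤ N) (hZ : ∀ r s, MatProd 1 N (Z r) (Z s) (Z (r + s)))
    {i j : ℕ} (h : 1 ≤ i ∧ i ≤ N ∧ 1 ≤ j ∧ j ≤ N ∧ i ≠ j) (r s : ℤ) :
    centralTerm Z i j r s = centralTerm Z 1 2 r s := by
  have key : ∀ k, (1 ≤ k ∧ k ≤ N ∧ k ≠ 1) → centralTerm Z 1 k r s = centralTerm Z 1 2 r s := by
    intro k hk
    by_cases hk' : k = 2
    · rw [hk']
    · exact centralTerm_eq_right hN hZ (by omega) r s
  by_cases hi : i = 1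
  · subst hi
    exact key j (by omega)
  by_cases hj : j = 1
  · subst hj
    rw [centralTerm_swap hN hZ (by omega), key i (by omega)]
  · rw [centralTerm_eq_left hZ (k := 1) (by omega), key j (by omega)]

/-- The Jacobi identity for `E_12 t^r`, `E_23 t^s`, `E_31 t^u`. -/
lemma centralTerm_cocycle (hN : 4 ≤ N) (hZ : ∀ r s, MatProd 1 N (Z r) (Z s) (Z (r + s)))
    (r s u : ℤ) : centralTerm Z 1 2 (r + s) u =
      centralTerm Z 1 2 r (s + u) + centralTerm Z 1 2 s (r + u) := by
  rw [← centralTerm_eq hN hZ (i := 1) (j := 3) (by omega) (r + s) u,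
    ← centralTerm_eq hN hZ (i := 2) (j := 3) (by omega) s (r + u), centralTerm, centralTerm,
    centralTerm, lie_opposite hZ (i := 1) (j := 2) (k := 3) (by omega),
    lie_opposite_additive hZ (i := 1) (j := 2) (k := 3) (by omega),
    lie_opposite_antisymm hN hZ (i := 3) (j := 2) (by omega),
    show r + (s + u) = r + s + u by ring, show s + (r + u) = r + s + u by ring]
  abel

/-- The element `(E_ii - E_NN) t^r`. -/
def diag (N : ℕ) (Z : ℤ → ℕ → ℕ → L) (r : ℤ) (i : ℕ) : L :=
  if i = N then 0 else ⁅Z r i N, Z 0 N i⁆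

/-- The root vectors `E_ij t^r` and, for `i = j`, the elements `(E_ii - E_NN) t^r`. -/
def entry (N : ℕ) (Z : ℤ → ℕ → ℕ → L) (r : ℤ) (i j : ℕ) : L :=
  if i = j then diag N Z r i else Z r i j

lemma entry_self (r : ℤ) (i : ℕ) : entry N Z r i i = diag N Z r i := if_pos rfl

lemma entry_of_ne (r : ℤ) {i j : ℕ} (h : i ≠ j) : entry N Z r i j = Z r i j := if_neg h

variable [LieAlgebra ℂ L]

/-- For a fixed value of `r + s`, the central term is additive in `r`; it vanishes for `s = 0`. -/
lemma centralTerm_eq_smul (hN : 4 ≤ N) (hZ : ∀ r s, MatProd 1 N (Z r) (Z s) (Z (r + s)))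
    (r s : ℤ) : centralTerm Z 1 2 r s =
      (if r + s = 0 then (r : ℂ) else 0) • centralTerm Z 1 2 1 (-1) := by
  let g : ℤ →+ L := AddMonoidHom.mk' (fun t => centralTerm Z 1 2 t (r + s - t)) fun a b => by
    rw [centralTerm_cocycle hN hZ a b]
    congr 2 <;> ring
  have hg : ∀ t, g t = (t : ℂ) • g 1 := by
    intro t
    have := map_zsmul g t 1
    rw [smul_eq_mul, mul_one] at this
    rw [this, Int.cast_smul_eq_zsmul]
  have h₁ : centralTerm Z 1 2 r s = g r := by simp [g]
  have h₂ : g (r + s) = 0 := by simp [g, centralTerm_zero]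
  rw [h₁, hg]
  split_ifs with h
  · simp [g, h]
  · rw [hg] at h₂
    have : ((r + s : ℤ) : ℂ) ≠ 0 := by exact_mod_cast h
    rw [(smul_eq_zero_iff_right this).1 h₂, smul_zero, zero_smul]

lemma lie_opposite_eq (hN : 4 ≤ N) (hZ : ∀ r s, MatProd 1 N (Z r) (Z s) (Z (r + s)))
    {i j : ℕ} (h : 1 ≤ i ∧ i ≤ N ∧ 1 ≤ j ∧ j ≤ N ∧ i ≠ j) (r s : ℤ) :
    ⁅Z r i j, Z s j i⁆ = diag N Z (r + s) i - diag N Z (r + s) j +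
      (if r + s = 0 then (r : ℂ) else 0) • centralTerm Z 1 2 1 (-1) := by
  rw [← centralTerm_eq_smul hN hZ, ← centralTerm_eq hN hZ h, centralTerm]
  have : ⁅Z (r + s) i j, Z 0 j i⁆ = diag N Z (r + s) i - diag N Z (r + s) j := by
    by_cases hi : i = N
    · rw [diag, diag, if_pos hi, if_neg (by omega), zero_sub, hi,
        lie_opposite_antisymm hN hZ (by omega)]
    by_cases hj : j = N
    · rw [diag, diag, if_pos hj, if_neg (by omega), sub_zero, hj]
    · rw [diag, diag, if_neg hi, if_neg hj,
        lie_opposite_additive hZ (i := i) (j := j) (k := N) (by omega),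
        lie_opposite_antisymm hN hZ (i := N) (j := j) (by omega)]
      abel
  rw [this]
  abel

lemma lie_lie_opposite (hN : 4 ≤ N) (hZ : ∀ r s, MatProd 1 N (Z r) (Z s) (Z (r + s)))
    {i j k m : ℕ} (h : 1 ≤ i ∧ i ≤ N ∧ 1 ≤ j ∧ j ≤ N ∧ i ≠ j)
    (h' : 1 ≤ k ∧ k ≤ N ∧ 1 ≤ m ∧ m ≤ N ∧ k ≠ m) (r s u : ℤ) :
    ⁅Z r i j, ⁅Z s k m, Z u m k⁆⁆ =
      (((if j = k then 1 else 0) - (if i = k then 1 else 0)) -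
        ((if j = m then 1 else 0) - (if i = m then 1 else 0)) : ℂ) • Z (r + s + u) i j := by
  -- all cases but the two pairs `(k, m)` with the labels `i` and `j`
  have gen : ∀ k m : ℕ, (1 ≤ k ∧ k ≤ N ∧ 1 ≤ m ∧ m ≤ N ∧ k ≠ m ∧ ¬(i = k ∧ j = m) ∧
      ¬(i = m ∧ j = k)) → ∀ s u : ℤ, ⁅Z r i j, ⁅Z s k m, Z u m k⁆⁆ =
      (((if j = k then 1 else 0) - (if i = k then 1 else 0)) -
        ((if j = m then 1 else 0) - (if i = m then 1 else 0)) : ℂ) • Z (r + s + u) i j := by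
    intro k m hkm s u
    rw [leibniz_lie]
    by_cases hjk : j = k
    · subst hjk
      rw [(hZ r s).mul, (hZ (r + s) u).mul, (hZ r u).zero]
      simp [h.2.2.2.2, show i ≠ m by omega, show j ≠ m by omega]
    by_cases him : i = m
    · subst him
      rw [(hZ r s).mul_neg, (hZ r u).zero, neg_lie, (hZ (r + s) u).mul_neg]
      simp [h.2.2.2.2.symm, hjk, show i ≠ k by omega]
    by_cases hik : i = k
    · subst hik
      rw [(hZ r s).zero, (hZ r u).mul_neg, lie_neg, (hZ s (r + u)).mul]
      simp [h.2.2.2.2.symm, show j ≠ m by omega, show i ≠ m by omega,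
        show s + (r + u) = r + s + u by ring]
    by_cases hjm : j = m
    · subst hjm
      rw [(hZ r s).zero, (hZ r u).mul, (hZ s (r + u)).mul_neg]
      simp [hik, him, hjk, show s + (r + u) = r + s + u by ring]
    · rw [(hZ r s).zero, (hZ r u).zero]
      simp [hjk, him, hik, hjm]
  have hij := h.2.2.2.2
  obtain ⟨x, hx⟩ := exists_label hN i j j
  by_cases h₁ : i = k ∧ j = m
  · obtain ⟨rfl, rfl⟩ := h₁
    have := lie_opposite hZ (i := i) (j := j) (k := x) (by omega) s 0 u
    rw [zero_add] at this
    rw [this, lie_sub, gen i x (by omega), gen j x (by omega),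
      show r + (s + 0) + u = r + s + u by ring, show r + 0 + (s + u) = r + s + u by ring,
      ← sub_smul]
    simp [hij, hij.symm, show j ≠ x by omega, show i ≠ x by omega]
  by_cases h₂ : i = m ∧ j = k
  · obtain ⟨rfl, rfl⟩ := h₂
    have := lie_opposite hZ (i := j) (j := i) (k := x) (by omega) s 0 u
    rw [zero_add] at this
    rw [this, lie_sub, gen i x (by omega), gen j x (by omega),
      show r + (s + 0) + u = r + s + u by ring, show r + 0 + (s + u) = r + s + u by ring,
      ← sub_smul]
    simp [hij, hij.symm, show j ≠ x by omega, show i ≠ x by omega]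
  · exact gen k m (by omega) s u

lemma lie_diag (hN : 4 ≤ N) (hZ : ∀ r s, MatProd 1 N (Z r) (Z s) (Z (r + s)))
    {i j k : ℕ} (h : 1 ≤ i ∧ i ≤ N ∧ 1 ≤ j ∧ j ≤ N ∧ i ≠ j) (hk : 1 ≤ k ∧ k ≤ N) (r s : ℤ) :
    ⁅Z r i j, diag N Z s k⁆ =
      (((if j = k then 1 else 0) - (if i = k then 1 else 0)) -
        ((if j = N then 1 else 0) - (if i = N then 1 else 0)) : ℂ) • Z (r + s) i j := by
  by_cases hkN : k = N
  · rw [diag, if_pos hkN, hkN, lie_zero, sub_self, zero_smul]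
  · rw [diag, if_neg hkN, lie_lie_opposite hN hZ h (by omega), add_zero]

/-- The last summand corrects for the diagonal entries being `(E_kk - E_NN) t^s` in place of
`E_kk t^s`; it drops out for traceless matrices. -/
lemma lie_entry (hN : 4 ≤ N) (hZ : ∀ r s, MatProd 1 N (Z r) (Z s) (Z (r + s)))
    {i j k l : ℕ} (h : 1 ≤ i ∧ i ≤ N ∧ 1 ≤ j ∧ j ≤ N ∧ i ≠ j)
    (h' : 1 ≤ k ∧ k ≤ N ∧ 1 ≤ l ∧ l ≤ N) (r s : ℤ) :
    ⁅Z r i j, entry N Z s k l⁆ =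
      (if j = k then entry N Z (r + s) i l else 0) - (if i = l then entry N Z (r + s) k j else 0) +
      (if j = k ∧ i = l then
        (if r + s = 0 then (r : ℂ) else 0) • centralTerm Z 1 2 1 (-1) else 0) -
      (if k = l then ((if j = N then 1 else 0) - (if i = N then 1 else 0) : ℂ) • Z (r + s) i j
        else 0) := by
  have hij := h.2.2.2.2
  by_cases hkl : k = l
  · subst hkl
    rw [entry_self, lie_diag hN hZ (by omega) (by omega), if_pos rfl, sub_smul, sub_left_inj,
      sub_smul, if_neg (show ¬(j = k ∧ i = k) by omega), add_zero]
    by_cases hj : j = k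
    · subst hj
      rw [if_pos rfl, if_pos rfl, if_neg hij, if_neg hij, entry_of_ne _ hij, one_smul, zero_smul]
    · by_cases hi : i = k
      · subst hi
        rw [if_pos rfl, if_neg hij.symm, if_neg hij.symm, if_pos rfl, entry_of_ne _ hij,
          one_smul, zero_smul]
      · simp [hi, hj]
  · rw [entry_of_ne _ hkl, if_neg hkl, sub_zero]
    by_cases hjk : j = k ∧ i = l
    · obtain ⟨rfl, rfl⟩ := hjk
      rw [lie_opposite_eq hN hZ (by omega), entry_self, entry_self]
      simp
    · rw [hZ r s i j k l (by omega), if_neg hjk, add_zero]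
      congr 1
      · split_ifs with h₁
        · rw [entry_of_ne _ (by omega)]
        · rfl
      · split_ifs with h₁
        · rw [entry_of_ne _ (by omega)]
        · rfl

lemma lie_centralTerm (hN : 4 ≤ N) (hZ : ∀ r s, MatProd 1 N (Z r) (Z s) (Z (r + s)))
    {i j : ℕ} (h : 1 ≤ i ∧ i ≤ N ∧ 1 ≤ j ∧ j ≤ N ∧ i ≠ j) (r : ℤ) :
    ⁅Z r i j, centralTerm Z 1 2 1 (-1)⁆ = 0 := by
  rw [centralTerm, lie_sub, lie_lie_opposite hN hZ h (by omega),
    lie_lie_opposite hN hZ h (by omega), show r + (1 + -1) + 0 = r + 1 + -1 by ring, sub_self]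

end Diagonal

end Steinberg

end

noncomputable section

/-! ### Homomorphisms from the affine Lie algebra -/

namespace AffineSl

variable {N : ℕ} [NeZero N]

/-- The label in `1, …, N` of an element of `ℤ/Nℤ`. -/
def label (x : ZMod N) : ℕ := if x = 0 then N else x.val

lemma one_le_label (x : ZMod N) : 1 ≤ label x := by
  rw [label]
  split_ifs with h
  · exact NeZero.one_le
  · exact Nat.one_le_iff_ne_zero.2 fun h' => h ((ZMod.val_eq_zero x).1 h')

lemma label_le (x : ZMod N) : label x ≤ N := by
  rw [label]
  split_ifs
  · exact le_rfl
  · exact (ZMod.val_lt x).le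

lemma cast_label (x : ZMod N) : (label x : ZMod N) = x := by
  rw [label]
  split_ifs with h
  · simp [h]
  · simp

lemma label_cast {i : ℕ} (h : 1 ≤ i) (h' : i ≤ N) : label (i : ZMod N) = i := by
  rw [label]
  obtain rfl | hi := eq_or_lt_of_le h'
  · simp
  · rw [if_neg, ZMod.val_cast_of_lt hi]
    rw [ZMod.natCast_eq_zero_iff]
    exact fun hd => absurd (Nat.le_of_dvd h hd) (by omega)

lemma label_inj {x y : ZMod N} : label x = label y ↔ x = y :=
  ⟨fun h => by rw [← cast_label x, h, cast_label], congrArg _⟩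

lemma loop_add (x y : Base N) (s : ℤ) : loop N (x + y) s = loop N x s + loop N y s := by
  rw [loop, loop, loop, TensorProduct.tmul_add, ← LieAlgebra.of_add, Prod.mk_add_mk, add_zero]

lemma loop_smul (c : ℂ) (x : Base N) (s : ℤ) : loop N (c • x) s = c • loop N x s := by
  rw [loop, loop, TensorProduct.tmul_smul, ← LieAlgebra.of_smul, Prod.smul_mk, smul_zero]

/-- `x ↦ x t^s` as a linear map. -/
def loopLinear (s : ℤ) : Base N →ₗ[ℂ] AffineSl N where
  toFun x := loop N x s
  map_add' x y := loop_add x y s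
  map_smul' c x := loop_smul c x s

lemma mem_of_loop_mem {S : Submodule ℂ (AffineSl N)} (hl : ∀ x s, loop N x s ∈ S)
    (hc : central N ∈ S) (x : AffineSl N) : x ∈ S := by
  obtain ⟨⟨y, c⟩, rfl⟩ := (LieAlgebra.ofProd (cocycle N)).surjective x
  have h : LieAlgebra.ofProd (cocycle N) (y, c) = LieAlgebra.ofProd (cocycle N) (y, 0) +
      (TrivialLieModule.equiv ℂ (LieAlgebra.loopAlgebra ℂ ℤ (Base N)) ℂ c) • central N := by
    rw [central, ← LieAlgebra.of_smul, ← LieAlgebra.of_add, Prod.smul_mk, smul_zero,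
      Prod.mk_add_mk, add_zero, zero_add, ← map_smul, smul_eq_mul, mul_one,
      LinearEquiv.symm_apply_apply]
  rw [h]
  refine add_mem ?_ (S.smul_mem _ hc)
  clear h
  obtain ⟨f, rfl⟩ := (LieAlgebra.LoopAlgebra.toFinsupp ℂ ℤ (Base N)).symm.surjective y
  induction f using Finsupp.induction_linear with
  | zero =>
    rw [map_zero]
    exact S.zero_mem
  | add f g hf hg =>
    have := add_mem hf hg
    rwa [← LieAlgebra.of_add, Prod.mk_add_mk, add_zero, ← map_add] at this
  | single s v =>
    rw [LieAlgebra.LoopAlgebra.toFinsupp_symm_single]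
    exact hl v s

lemma eq_sum_single_of_trace_zero {y : Matrix (ZMod N) (ZMod N) ℂ} (h : ∑ i, y i i = 0) :
    y = ∑ i, ∑ j, y i j •
      (Matrix.single i j 1 - if i = j then Matrix.single (0 : ZMod N) 0 (1 : ℂ) else 0) := by
  simp only [smul_sub, Finset.sum_sub_distrib, smul_ite, smul_zero, Finset.sum_ite_eq,
    Finset.mem_univ, if_true]
  rw [← Finset.sum_smul, h, zero_smul, sub_zero]
  conv_lhs => rw [Matrix.matrix_eq_sum_single y]
  simp

lemma mem_of_single_mem {S : Submodule ℂ (Base N)}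
    (h₁ : ∀ i j (h : i ≠ j), LieAlgebra.SpecialLinear.single i j h 1 ∈ S)
    (h₂ : ∀ i j, LieAlgebra.SpecialLinear.singleSubSingle i j 1 ∈ S) (x : Base N) : x ∈ S := by
  have htr : ∑ i, x.val i i = 0 := x.prop
  have h : x = ∑ i, ∑ j, x.val i j • (if h : i ≠ j then LieAlgebra.SpecialLinear.single i j h 1
      else LieAlgebra.SpecialLinear.singleSubSingle i 0 1 : Base N) := by
    refine Subtype.ext ?_
    have hv : ∀ i j, ((if h : i ≠ j then LieAlgebra.SpecialLinear.single i j h 1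
        else LieAlgebra.SpecialLinear.singleSubSingle i 0 1 : Base N) : Matrix _ _ ℂ) =
        Matrix.single i j 1 - if i = j then Matrix.single 0 0 1 else 0 := by
      intro i j
      by_cases hij : i = j
      · subst hij
        simp
      · simp [hij]
    simp only [AddSubmonoidClass.coe_finsetSum, SetLike.val_smul, hv]
    exact eq_sum_single_of_trace_zero htr
  rw [h]
  refine S.sum_mem fun i _ => S.sum_mem fun j _ => S.smul_mem _ ?_
  split_ifs with hij
  · exact h₁ i j hij
  · exact h₂ i 0

lemma lie_single_single {i j : ZMod N} (h : i ≠ j) :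
    ⁅(LieAlgebra.SpecialLinear.single i j h 1 : Base N),
      (LieAlgebra.SpecialLinear.single j i h.symm 1 : Base N)⁆ =
      LieAlgebra.SpecialLinear.singleSubSingle i j 1 := by
  refine Subtype.ext ?_
  rw [LieAlgebra.SpecialLinear.sl_bracket]
  simp

lemma trace_single_mul_single {i j : ZMod N} (h : i ≠ j) :
    Matrix.trace ((LieAlgebra.SpecialLinear.single i j h 1 : Base N).val *
      (LieAlgebra.SpecialLinear.single j i h.symm 1 : Base N).val) = (1 : ℂ) := by
  simp

lemma E_of_ne {i j : ZMod N} (h : i ≠ j) (s : ℤ) :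
    E N i j s = loop N (LieAlgebra.SpecialLinear.single i j h 1) s := dif_pos h

lemma E_lie_E_opposite {i j : ZMod N} (h : i ≠ j) (r s : ℤ) :
    ⁅E N i j r, E N j i s⁆ = loop N (LieAlgebra.SpecialLinear.singleSubSingle i j 1) (r + s) +
      (if r + s = 0 then (r : ℂ) else 0) • central N := by
  rw [E_of_ne h, E_of_ne h.symm, loop_lie_loop, lie_single_single, trace_single_mul_single h,
    mul_one]

/-- The affine Lie algebra is generated by the root vectors. -/
lemma mem_of_E_mem (hN : 2 ≤ N) {K : LieSubalgebra ℂ (AffineSl N)}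
    (hK : ∀ i j s, i ≠ j → E N i j s ∈ K) (x : AffineSl N) : x ∈ K := by
  have hd : ∀ i j s, i ≠ j →
      loop N (LieAlgebra.SpecialLinear.singleSubSingle i j 1) s ∈ K := by
    intro i j s h
    have := K.lie_mem (hK i j 0 h) (hK j i s h.symm)
    rwa [E_lie_E_opposite h, zero_add, Int.cast_zero, ite_self, zero_smul, add_zero] at this
  have hc : central N ∈ K := by
    have : Fact (1 < N) := ⟨hN⟩
    have h01 : (0 : ZMod N) ≠ 1 := zero_ne_one
    have := sub_mem (K.lie_mem (hK 0 1 1 h01) (hK 1 0 (-1) h01.symm)) (hd 0 1 0 h01)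
    rw [E_lie_E_opposite h01] at this
    simpa using this
  refine mem_of_loop_mem (S := K.toSubmodule) (fun x s => ?_) hc x
  refine mem_of_single_mem (S := K.toSubmodule.comap (loopLinear s)) (fun i j h => ?_)
    (fun i j => ?_) x
  · have := hK i j s h
    rwa [E_of_ne h] at this
  · by_cases h : i = j
    · subst h
      have h₀ : (LieAlgebra.SpecialLinear.singleSubSingle i i 1 : Base N) = 0 :=
        Subtype.ext (by simp)
      rw [h₀]
      exact zero_mem _
    · exact hd i j s h

end AffineSl

namespace Steinberg

open AffineSl

variable {L : Type*} [LieRing L] [LieAlgebra ℂ L] {N : ℕ} [NeZero N]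

/-- The linear extension of `E_ij ↦ W i j` to matrices. -/
def matrixMap (W : ℕ → ℕ → L) : Matrix (ZMod N) (ZMod N) ℂ →ₗ[ℂ] L where
  toFun x := ∑ i, ∑ j, x i j • W (label i) (label j)
  map_add' x y := by simp [add_smul, Finset.sum_add_distrib]
  map_smul' c x := by simp [mul_smul, Finset.smul_sum]

lemma matrixMap_apply (W : ℕ → ℕ → L) (x : Matrix (ZMod N) (ZMod N) ℂ) :
    matrixMap W x = ∑ i, ∑ j, x i j • W (label i) (label j) := rfl

lemma matrixMap_single (W : ℕ → ℕ → L) (a b : ZMod N) :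
    matrixMap W (Matrix.single a b 1) = W (label a) (label b) := by
  rw [matrixMap_apply]
  have h : ∀ i j, (Matrix.single a b (1 : ℂ)) i j • W (label i) (label j) =
      if a = i then (if b = j then W (label i) (label j) else 0) else 0 := by
    intro i j
    rw [Matrix.single_apply]
    split_ifs <;> simp_all
  simp [h]

lemma matrixMap_single_mul (W : ℕ → ℕ → L) (a b : ZMod N) (y : Matrix (ZMod N) (ZMod N) ℂ) :
    matrixMap W (Matrix.single a b 1 * y) = ∑ d, y b d • W (label a) (label d) := by
  rw [matrixMap_apply]
  have h : ∀ i j, (Matrix.single a b (1 : ℂ) * y) i j • W (label i) (label j) =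
      if a = i then y b j • W (label i) (label j) else 0 := by
    intro i j
    split_ifs with h
    · subst h
      simp
    · rw [Matrix.single_mul_apply_of_ne _ _ _ _ _ (Ne.symm h), zero_smul]
  simp only [h]
  rw [Finset.sum_comm]
  simp

lemma matrixMap_mul_single (W : ℕ → ℕ → L) (a b : ZMod N) (y : Matrix (ZMod N) (ZMod N) ℂ) :
    matrixMap W (y * Matrix.single a b 1) = ∑ d, y d a • W (label d) (label b) := by
  rw [matrixMap_apply]
  have h : ∀ i j, (y * Matrix.single a b (1 : ℂ)) i j • W (label i) (label j) =
      if b = j then y i a • W (label i) (label j) else 0 := by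
    intro i j
    split_ifs with h
    · subst h
      simp
    · rw [Matrix.mul_single_apply_of_ne _ _ _ _ _ (Ne.symm h), zero_smul]
  simp [h]

variable {Z : ℤ → ℕ → ℕ → L}

lemma lie_matrixMap (hN : 4 ≤ N) (hZ : ∀ r s, MatProd 1 N (Z r) (Z s) (Z (r + s)))
    {a b : ZMod N} (h : a ≠ b) (r s : ℤ) (y : Base N) :
    ⁅Z r (label a) (label b), matrixMap (entry N Z s) y.val⁆ =
      matrixMap (entry N Z (r + s)) (Matrix.single a b 1 * y.val - y.val * Matrix.single a b 1) +
        (if r + s = 0 then (r : ℂ) * y.val b a else 0) • centralTerm Z 1 2 1 (-1) := by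
  have htr : ∑ i, y.val i i = 0 := y.prop
  have hne : label a ≠ label b := fun h' => h (label_inj.1 h')
  have hb := fun x : ZMod N => And.intro (one_le_label x) (label_le x)
  rw [map_sub, matrixMap_single_mul, matrixMap_mul_single, matrixMap_apply, lie_sum]
  simp only [lie_sum, lie_smul]
  have he : ∀ k l : ZMod N, ⁅Z r (label a) (label b), entry N Z s (label k) (label l)⁆ = _ :=
    fun k l => lie_entry hN hZ (i := label a) (j := label b) (k := label k) (l := label l)
      ⟨(hb _).1, (hb _).2, (hb _).1, (hb _).2, hne⟩ ⟨(hb _).1, (hb _).2, (hb _).1, (hb _).2⟩ r s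
  simp only [he, label_inj, smul_sub, smul_add, Finset.sum_sub_distrib, Finset.sum_add_distrib,
    smul_ite, smul_zero, Finset.sum_ite_eq, Finset.mem_univ, if_true, ite_and]
  have h₀ : ∑ i, y.val i i • ((if label b = N then (1 : ℂ) else 0) -
      (if label a = N then 1 else 0)) • Z (r + s) (label a) (label b) = 0 := by
    rw [← Finset.sum_smul, htr, zero_smul]
  simp only [sub_smul, smul_sub, Finset.sum_sub_distrib] at h₀ ⊢
  rw [h₀, sub_zero]
  congr 1
  · congr 1
    rw [Finset.sum_comm]
    simp
  · simp only [Finset.sum_ite_irrel, Finset.sum_const_zero, Finset.sum_ite_eq, Finset.mem_univ, if_true]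
    split_ifs with h₁
    · rw [smul_smul, mul_comm]
    · simp

/-- The underlying pair of an element of the affine Lie algebra. -/
def toProd (N : ℕ) [NeZero N] : AffineSl N →ₗ[ℂ] LieAlgebra.loopAlgebra ℂ ℤ (Base N) ×
    TrivialLieModule ℂ (LieAlgebra.loopAlgebra ℂ ℤ (Base N)) ℂ where
  toFun x := (LieAlgebra.ofProd (cocycle N)).symm x
  map_add' _ _ := rfl
  map_smul' _ _ := rfl

/-- The inclusion of the traceless matrices. -/
def valLinear (N : ℕ) [NeZero N] : Base N →ₗ[ℂ] Matrix (ZMod N) (ZMod N) ℂ where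
  toFun x := x.val
  map_add' _ _ := rfl
  map_smul' _ _ := rfl

/-- The linear map with `E_ij t^s ↦ Z s i j` on finitely supported functions. -/
def loopMap (N : ℕ) [NeZero N] (Z : ℤ → ℕ → ℕ → L) : (ℤ →₀ Base N) →ₗ[ℂ] L :=
  Finsupp.lsum ℂ fun s => (matrixMap (entry N Z s)).comp (valLinear N)

/-- The linear map with `E_ij t^s ↦ Z s i j`. -/
def affineLinear (N : ℕ) [NeZero N] (Z : ℤ → ℕ → ℕ → L) : AffineSl N →ₗ[ℂ] L :=
  (((loopMap N Z).comp (LieAlgebra.LoopAlgebra.toFinsupp ℂ ℤ (Base N)).toLinearMap).comp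
      (LinearMap.fst ℂ _ _) +
    ((LinearMap.toSpanSingleton ℂ L (centralTerm Z 1 2 1 (-1))).comp
      (TrivialLieModule.equiv ℂ (LieAlgebra.loopAlgebra ℂ ℤ (Base N)) ℂ).toLinearMap).comp
      (LinearMap.snd ℂ _ _)).comp (toProd N)

lemma affineLinear_loop (x : Base N) (s : ℤ) :
    affineLinear N Z (loop N x s) = matrixMap (entry N Z s) x.val := by
  change loopMap N Z (LieAlgebra.LoopAlgebra.toFinsupp ℂ ℤ (Base N)
    (AddMonoidAlgebra.single s 1 ⊗ₜ[ℂ] x)) + (0 : ℂ) • centralTerm Z 1 2 1 (-1) = _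
  rw [LieAlgebra.LoopAlgebra.toFinsupp_single_tmul, zero_smul, add_zero, loopMap,
    Finsupp.lsum_single]
  rfl

lemma affineLinear_central :
    affineLinear N Z (central N) = centralTerm Z 1 2 1 (-1) := by
  change loopMap N Z (LieAlgebra.LoopAlgebra.toFinsupp ℂ ℤ (Base N) 0) +
    (1 : ℂ) • centralTerm Z 1 2 1 (-1) = _
  rw [map_zero, map_zero, zero_add, one_smul]

lemma affineLinear_E {i j : ZMod N} (h : i ≠ j) (s : ℤ) :
    affineLinear N Z (E N i j s) = Z s (label i) (label j) := by
  rw [E_of_ne h, affineLinear_loop, LieAlgebra.SpecialLinear.val_single, matrixMap_single,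
    entry_of_ne _ fun h' => h (label_inj.1 h')]

lemma affineLinear_lie (hN : 4 ≤ N) (hZ : ∀ r s, MatProd 1 N (Z r) (Z s) (Z (r + s)))
    (x y : AffineSl N) :
    affineLinear N Z ⁅x, y⁆ = ⁅affineLinear N Z x, affineLinear N Z y⁆ := by
  let K : LieSubalgebra ℂ (AffineSl N) :=
    { carrier := {x | ∀ y, affineLinear N Z ⁅x, y⁆ = ⁅affineLinear N Z x, affineLinear N Z y⁆}
      add_mem' := fun ha hb y => by rw [add_lie, map_add, map_add, add_lie, ha, hb]
      zero_mem' := fun y => by rw [zero_lie, map_zero, zero_lie]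
      smul_mem' := fun c a ha y => by rw [smul_lie, map_smul, map_smul, smul_lie, ha]
      lie_mem' := fun {a b} ha hb y => by rw [lie_lie, map_sub, ha, hb, ha, hb, ha, lie_lie] }
  refine mem_of_E_mem (K := K) (by omega) (fun i j r hij y => ?_) x y
  let S : Submodule ℂ (AffineSl N) :=
    { carrier := {y | affineLinear N Z ⁅E N i j r, y⁆ =
        ⁅affineLinear N Z (E N i j r), affineLinear N Z y⁆}
      add_mem' := fun {a b} ha hb => by
        simp only [Set.mem_ofPred_eq] at *
        rw [lie_add, map_add, map_add, lie_add, ha, hb]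
      zero_mem' := by
        simp only [Set.mem_ofPred_eq]
        rw [lie_zero, map_zero, lie_zero]
      smul_mem' := fun c a ha => by
        simp only [Set.mem_ofPred_eq] at *
        rw [lie_smul, map_smul, map_smul, lie_smul, ha] }
  refine mem_of_loop_mem (S := S) (fun v s => ?_) ?_ y
  · change affineLinear N Z ⁅E N i j r, loop N v s⁆ =
      ⁅affineLinear N Z (E N i j r), affineLinear N Z (loop N v s)⁆
    rw [affineLinear_E hij, affineLinear_loop, lie_matrixMap hN hZ hij, E_of_ne hij,
      loop_lie_loop, map_add, map_smul, affineLinear_loop, affineLinear_central,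
      LieAlgebra.SpecialLinear.sl_bracket, LieAlgebra.SpecialLinear.val_single]
    congr 4
    rw [Matrix.trace_mul_comm]
    simp [Matrix.trace_mul_single]
  · change affineLinear N Z ⁅E N i j r, central N⁆ =
      ⁅affineLinear N Z (E N i j r), affineLinear N Z (central N)⁆
    have hne : label i ≠ label j := fun h' => hij (label_inj.1 h')
    rw [affineLinear_E hij, affineLinear_central,
      lie_centralTerm hN hZ ⟨one_le_label _, label_le _, one_le_label _, label_le _, hne⟩,
      ← lie_skew, central_lie, neg_zero, map_zero]

/-- A family of root vectors defines a homomorphism from the affine Lie algebra. -/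
def affineHom (hN : 4 ≤ N) (hZ : ∀ r s, MatProd 1 N (Z r) (Z s) (Z (r + s))) :
    AffineSl N →ₗ⁅ℂ⁆ L where
  __ := affineLinear N Z
  map_lie' {x y} := affineLinear_lie hN hZ x y

lemma affineHom_E (hN : 4 ≤ N) (hZ : ∀ r s, MatProd 1 N (Z r) (Z s) (Z (r + s)))
    {i j : ZMod N} (h : i ≠ j) (s : ℤ) :
    affineHom hN hZ (E N i j s) = Z s (label i) (label j) := affineLinear_E h s

end Steinberg

namespace AffineSl

variable {N : ℕ} [NeZero N]

lemma e_lie_f (hN : 2 ≤ N) (i : ZMod N) : ⁅e N i, f N i⁆ = h N i := by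
  have : Fact (1 < N) := ⟨hN⟩
  rw [e, f, E_lie_E_opposite (by simp), h]
  split_ifs with hi hr hr
  · simp
  · exact absurd (add_neg_cancel 1) hr
  · simp
  · simp

end AffineSl

end

noncomputable section

/-! ### The affine Yangian with nodes labelled by natural numbers -/

namespace AffineYangian

/-- Adjacency of the nodes `0, …, n - 1` of the cyclic quiver. -/
abbrev Adjacent (n i j : ℕ) : Prop :=
  i + 1 = j ∨ j + 1 = i ∨ (i = 0 ∧ j + 1 = n) ∨ (j = 0 ∧ i + 1 = n)

/-- The entries of the Cartan matrix, with nodes `0, …, n - 1`. -/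
def cartanNat (n i j : ℕ) : ℂ := if i = j then 2 else if Adjacent n i j then -1 else 0

lemma cartanNat_self (n i : ℕ) : cartanNat n i i = 2 := if_pos rfl

lemma cartanNat_of_adjacent {n i j : ℕ} (h : Adjacent n i j) (h' : i ≠ j) :
    cartanNat n i j = -1 := by
  rw [cartanNat, if_neg h', if_pos h]

lemma cartanNat_of_not_adjacent {n i j : ℕ} (h : ¬Adjacent n i j) (h' : i ≠ j) :
    cartanNat n i j = 0 := by
  rw [cartanNat, if_neg h', if_neg h]

lemma natCast_inj {n i j : ℕ} (hi : i < n) (hj : j < n) : (i : ZMod n) = j ↔ i = j := by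
  rw [ZMod.natCast_eq_natCast_iff', Nat.mod_eq_of_lt hi, Nat.mod_eq_of_lt hj]

lemma natCast_add_one_eq {n i j : ℕ} (hi : i < n) (hj : j < n) :
    (i : ZMod n) + 1 = j ↔ i + 1 = j ∨ (i + 1 = n ∧ j = 0) := by
  rw [← Nat.cast_one, ← Nat.cast_add]
  rcases Nat.lt_or_ge (i + 1) n with h | h
  · rw [natCast_inj h hj]
    omega
  · obtain rfl : n = i + 1 := by omega
    rw [ZMod.natCast_self, ← Nat.cast_zero, natCast_inj (by omega) hj]
    omega

lemma cartan_natCast {n i j : ℕ} (hi : i < n) (hj : j < n) :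
    ((cartan n i j : ℤ) : ℂ) = cartanNat n i j := by
  have h : ((j : ZMod n) = i + 1 ∨ (j : ZMod n) = i - 1) ↔ Adjacent n i j := by
    rw [eq_sub_iff_add_eq, eq_comm, natCast_add_one_eq hi hj, natCast_add_one_eq hj hi, Adjacent]
    omega
  rw [cartan, cartanNat]
  simp only [natCast_inj hi hj, h]
  split_ifs <;> simp

attribute [local instance] LieRing.ofAssociativeRing

variable {R : Type*} [Ring R] [Algebra ℂ R]

/-- The defining relations of the affine Yangian for elements `h i r` and `x σ i r` of an
algebra, with the nodes `i = 0, …, n - 1`; the parameter `κ` is `ε + n ħ / 2`. -/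
structure Relations (n : ℕ) (ħ κ : ℂ) (h : ℕ → Fin 2 → R) (x : ℤˣ → ℕ → Fin 2 → R) : Prop where
  h_h : ∀ i j r s, i < n → j < n → ⁅h i r, h j s⁆ = 0
  x0_x0 : ∀ i j, i < n → j < n → ⁅x 1 i 0, x (-1) j 0⁆ = if i = j then h i 0 else 0
  x1_x0 : ∀ i j, i < n → j < n → ⁅x 1 i 1, x (-1) j 0⁆ = if i = j then h i 1 else 0
  x0_x1 : ∀ i j, i < n → j < n → ⁅x 1 i 0, x (-1) j 1⁆ = if i = j then h i 1 else 0
  h0_x : ∀ σ i j r, i < n → j < n → ⁅h i 0, x σ j r⁆ = (sgn σ * cartanNat n i j) • x σ j r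
  ht_x : ∀ σ i j, i < n → j < n → ¬(i = 0 ∧ j + 1 = n) → ¬(j = 0 ∧ i + 1 = n) →
    ⁅h i 1 - (ħ / 2) • h i 0 ^ 2, x σ j 0⁆ = (sgn σ * cartanNat n i j) • x σ j 1
  ht_x_zero_last : ∀ σ l, l + 1 = n →
    ⁅h 0 1 - (ħ / 2) • h 0 0 ^ 2, x σ l 0⁆ = (-sgn σ) • (x σ l 1 + κ • x σ l 0)
  ht_x_last_zero : ∀ σ l, l + 1 = n →
    ⁅h l 1 - (ħ / 2) • h l 0 ^ 2, x σ 0 0⁆ = (-sgn σ) • (x σ 0 1 - κ • x σ 0 0)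
  x_x : ∀ σ i j, i < n → j < n → ¬(i = 0 ∧ j + 1 = n) → ¬(j = 0 ∧ i + 1 = n) →
    ⁅x σ i 1, x σ j 0⁆ - ⁅x σ i 0, x σ j 1⁆ =
      (sgn σ * cartanNat n i j * (ħ / 2)) • (x σ i 0 * x σ j 0 + x σ j 0 * x σ i 0)
  x_x_zero_last : ∀ σ l, l + 1 = n →
    ⁅x σ 0 1, x σ l 0⁆ - ⁅x σ 0 0, x σ l 1⁆ =
      (-sgn σ * (ħ / 2)) • (x σ 0 0 * x σ l 0 + x σ l 0 * x σ 0 0) + κ • ⁅x σ 0 0, x σ l 0⁆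
  serre_far : ∀ σ i j, i < n → j < n → i ≠ j → ¬Adjacent n i j → ⁅x σ i 0, x σ j 0⁆ = 0
  serre : ∀ σ i j, i < n → j < n → i ≠ j → Adjacent n i j → ⁅x σ i 0, ⁅x σ i 0, x σ j 0⁆⁆ = 0

variable {n : ℕ} {ħ ε : ℂ}

lemma map_lie (ρ : AffineYangian n ħ ε →ₐ[ℂ] R) (a b : AffineYangian n ħ ε) :
    ρ ⁅a, b⁆ = ⁅ρ a, ρ b⁆ := by
  simp [Ring.lie_def]

lemma mk_rel {a b : Free n} (h : Rel n ħ ε a b) : mk n ħ ε a = mk n ħ ε b :=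
  RingQuot.mkAlgHom_rel ℂ h

lemma last_cast {l : ℕ} (h : l + 1 = n) : (l : ZMod n) = -1 := by
  rw [eq_neg_iff_add_eq_zero]
  subst h
  exact_mod_cast ZMod.natCast_self (l + 1)

lemma map_mk_lie (ρ : AffineYangian n ħ ε →ₐ[ℂ] R) (a b : Free n) :
    ρ (mk n ħ ε ⁅a, b⁆) = ⁅ρ (mk n ħ ε a), ρ (mk n ħ ε b)⁆ := by
  simp [Ring.lie_def]

lemma pair_ne_zero_last (hn : 0 < n) {i j : ℕ} (hi : i < n) (hj : j < n)
    (h : ¬(i = 0 ∧ j + 1 = n)) : ((i : ZMod n), (j : ZMod n)) ≠ (0, -1) := by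
  rw [← last_cast (show n - 1 + 1 = n by omega), ← Nat.cast_zero, Ne, Prod.mk.injEq,
    natCast_inj hi hn, natCast_inj hj (by omega)]
  omega

lemma pair_ne_last_zero (hn : 0 < n) {i j : ℕ} (hi : i < n) (hj : j < n)
    (h : ¬(j = 0 ∧ i + 1 = n)) : ((i : ZMod n), (j : ZMod n)) ≠ (-1, 0) := by
  rw [← last_cast (show n - 1 + 1 = n by omega), ← Nat.cast_zero, Ne, Prod.mk.injEq,
    natCast_inj hj hn, natCast_inj hi (by omega)]
  omega

/-- The images of the generators of the affine Yangian satisfy its relations. -/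
lemma relations_map (hn : 3 ≤ n) (ρ : AffineYangian n ħ ε →ₐ[ℂ] R) :
    Relations n ħ (ε + n / 2 * ħ) (fun i r => ρ (H ħ ε (i : ZMod n) r))
      fun σ i r => ρ (X ħ ε σ (i : ZMod n) r) := by
  have key : ∀ {a b}, Rel n ħ ε a b → ρ (mk n ħ ε a) = ρ (mk n ħ ε b) :=
    fun h => congrArg ρ (mk_rel h)
  have h0 : ((0 : ℕ) : ZMod n) = 0 := Nat.cast_zero
  constructor
  · intro i j r s _ _
    have := key (Rel.H_H (i : ZMod n) j r s)
    simp only [map_mk_lie, map_zero] at this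
    exact this
  · intro i j hi hj
    have := key (Rel.X0_X0 (i : ZMod n) j)
    simp only [natCast_inj hi hj, map_mk_lie, apply_ite ρ, apply_ite (mk n ħ ε), map_zero] at this
    exact this
  · intro i j hi hj
    have := key (Rel.X1_X0 (i : ZMod n) j)
    simp only [natCast_inj hi hj, map_mk_lie, apply_ite ρ, apply_ite (mk n ħ ε), map_zero] at this
    exact this
  · intro i j hi hj
    have := key (Rel.X0_X1 (i : ZMod n) j)
    simp only [natCast_inj hi hj, map_mk_lie, apply_ite ρ, apply_ite (mk n ħ ε), map_zero] at this
    exact this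
  · intro σ i j r hi hj
    have := key (Rel.H0_X σ (i : ZMod n) j r)
    rw [cartan_natCast hi hj] at this
    simp only [map_mk_lie, map_smul] at this
    exact this
  · intro σ i j hi hj h₁ h₂
    have := key (Rel.Ht_X σ (i : ZMod n) j (pair_ne_zero_last (by omega) hi hj h₁)
      (pair_ne_last_zero (by omega) hi hj h₂))
    rw [cartan_natCast hi hj] at this
    simp only [map_mk_lie, map_smul, fHt, map_sub, map_pow] at this
    exact this
  · intro σ l hl
    have := key (Rel.Ht_X_zero_last (n := n) σ)
    simp only [map_mk_lie, map_smul, fHt, map_sub, map_add, map_pow, ← last_cast hl] at this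
    rw [← h0] at this
    exact this
  · intro σ l hl
    have := key (Rel.Ht_X_last_zero (n := n) σ)
    simp only [map_mk_lie, map_smul, fHt, map_sub, map_pow, ← last_cast hl] at this
    rw [← h0] at this
    exact this
  · intro σ i j hi hj h₁ h₂
    have := key (Rel.X_X σ (i : ZMod n) j (pair_ne_zero_last (by omega) hi hj h₁)
      (pair_ne_last_zero (by omega) hi hj h₂))
    rw [cartan_natCast hi hj] at this
    simp only [map_mk_lie, map_smul, map_sub, map_add, map_mul] at this
    exact this
  · intro σ l hl
    have := key (Rel.X_X_zero_last (n := n) σ)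
    simp only [map_mk_lie, map_smul, map_sub, map_add, map_mul, ← last_cast hl] at this
    rw [← h0] at this
    exact this
  · intro σ i j hi hj hij ha
    have hc := cartan_natCast hi hj
    rw [cartanNat_of_not_adjacent ha hij] at hc
    have hc' : cartan n i j = 0 := by exact_mod_cast hc
    have := key (Rel.serre σ (i : ZMod n) j (by rwa [Ne, natCast_inj hi hj]))
    rw [hc'] at this
    simp only [Int.natAbs_zero, add_zero,
      Function.iterate_succ, Function.iterate_zero, Function.comp_apply, id_eq,
      map_mk_lie, map_zero] at this
    exact this
  · intro σ i j hi hj hij ha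
    have hc := cartan_natCast hi hj
    rw [cartanNat_of_adjacent ha hij] at hc
    have hc' : cartan n i j = -1 := by exact_mod_cast hc
    have := key (Rel.serre σ (i : ZMod n) j (by rwa [Ne, natCast_inj hi hj]))
    rw [hc'] at this
    simp only [Int.reduceNeg, Int.natAbs_neg, Int.natAbs_one, Nat.reduceAdd,
      Function.iterate_succ, Function.iterate_zero, Function.comp_apply, id_eq,
      map_mk_lie, map_zero] at this
    exact this

/-- The map on generators given by elements with nodes `0, …, n - 1`. -/
def genMap (h : ℕ → Fin 2 → R) (x : ℤˣ → ℕ → Fin 2 → R) : Gen n → R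
  | .H i r => h i.val r
  | .X σ i r => x σ i.val r

lemma genMap_rel [NeZero n] (hn : 3 ≤ n) {h : ℕ → Fin 2 → R} {x : ℤˣ → ℕ → Fin 2 → R}
    (hr : Relations n ħ (ε + n / 2 * ħ) h x) ⦃a b : Free n⦄ (hab : Rel n ħ ε a b) :
    FreeAlgebra.lift ℂ (genMap h x) a = FreeAlgebra.lift ℂ (genMap h x) b := by
  have hH : ∀ i r, FreeAlgebra.lift ℂ (genMap h x) (fH i r) = h (i : ZMod n).val r :=
    fun i r => FreeAlgebra.lift_ι_apply _ _
  have hX : ∀ σ i r, FreeAlgebra.lift ℂ (genMap h x) (fX σ i r) = x σ (i : ZMod n).val r :=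
    fun σ i r => FreeAlgebra.lift_ι_apply _ _
  have hl : ∀ a b : Free n, FreeAlgebra.lift ℂ (genMap h x) ⁅a, b⁆ =
      ⁅FreeAlgebra.lift ℂ (genMap h x) a, FreeAlgebra.lift ℂ (genMap h x) b⁆ := by
    intro a b
    simp only [Ring.lie_def, map_sub, map_mul]
  have hlt : ∀ i : ZMod n, i.val < n := ZMod.val_lt
  have hc : ∀ i j : ZMod n, ((cartan n i j : ℤ) : ℂ) = cartanNat n i.val j.val := by
    intro i j
    rw [← cartan_natCast (hlt i) (hlt j), ZMod.natCast_zmod_val, ZMod.natCast_zmod_val]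
  have hv : ∀ i j : ZMod n, i = j ↔ i.val = j.val := fun i j => (ZMod.val_injective n).eq_iff.symm
  have hlast : (-1 : ZMod n).val + 1 = n := by
    have h₁ : ((n - 1 : ℕ) : ZMod n) = -1 := last_cast (by omega)
    rw [← h₁, ZMod.val_cast_of_lt (by omega)]
    omega
  have h0 : (0 : ZMod n).val = 0 := ZMod.val_zero
  have hp₁ : ∀ i j : ZMod n, (i, j) ≠ (0, -1) → ¬(i.val = 0 ∧ j.val + 1 = n) := by
    intro i j hij hi
    refine hij (Prod.ext ((hv _ _).2 ?_) ((hv _ _).2 ?_)) <;> simp only [] <;> omega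
  have hp₂ : ∀ i j : ZMod n, (i, j) ≠ (-1, 0) → ¬(j.val = 0 ∧ i.val + 1 = n) := by
    intro i j hij hi
    refine hij (Prod.ext ((hv _ _).2 ?_) ((hv _ _).2 ?_)) <;> simp only [] <;> omega
  cases hab with
  | H_H i j r s => simp only [hl, hH, map_zero, hr.h_h _ _ _ _ (hlt i) (hlt j)]
  | X0_X0 i j =>
    simp only [hl, hX, hr.x0_x0 _ _ (hlt i) (hlt j), hv]
    split_ifs <;> simp [hH]
  | X1_X0 i j =>
    simp only [hl, hX, hr.x1_x0 _ _ (hlt i) (hlt j), hv]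
    split_ifs <;> simp [hH]
  | X0_X1 i j =>
    simp only [hl, hX, hr.x0_x1 _ _ (hlt i) (hlt j), hv]
    split_ifs <;> simp [hH]
  | H0_X σ i j r => simp only [hl, hX, hH, hr.h0_x _ _ _ _ (hlt i) (hlt j), map_smul, hc]
  | Ht_X σ i j h₁ h₂ =>
    simp only [hl, hX, fHt, hH, map_sub, map_smul, map_pow, hc,
      hr.ht_x _ _ _ (hlt i) (hlt j) (hp₁ i j h₁) (hp₂ i j h₂)]
  | Ht_X_zero_last σ =>
    simp only [hl, hX, fHt, hH, map_sub, map_add, map_smul, map_pow, h0,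
      hr.ht_x_zero_last _ _ hlast]
  | Ht_X_last_zero σ =>
    simp only [hl, hX, fHt, hH, map_sub, map_smul, map_pow, h0,
      hr.ht_x_last_zero _ _ hlast]
  | X_X σ i j h₁ h₂ =>
    simp only [hl, hX, map_sub, map_add, map_mul, map_smul, hc,
      hr.x_x _ _ _ (hlt i) (hlt j) (hp₁ i j h₁) (hp₂ i j h₂)]
  | X_X_zero_last σ =>
    simp only [hl, hX, map_sub, map_add, map_mul, map_smul, h0, hr.x_x_zero_last _ _ hlast]
  | serre σ i j hij =>
    have hij' : i.val ≠ j.val := fun h' => hij ((hv _ _).2 h')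
    have hc' := hc i j
    by_cases ha : Adjacent n i.val j.val
    · rw [cartanNat_of_adjacent ha hij'] at hc'
      have hc'' : cartan n i j = -1 := by exact_mod_cast hc'
      rw [hc'']
      simp [hl, hX, hr.serre σ _ _ (hlt i) (hlt j) hij' ha]
    · rw [cartanNat_of_not_adjacent ha hij'] at hc'
      have hc'' : cartan n i j = 0 := by exact_mod_cast hc'
      rw [hc'']
      simp [hl, hX, hr.serre_far σ _ _ (hlt i) (hlt j) hij' ha]

/-- Elements that satisfy the relations define a homomorphism from the affine Yangian. -/
lemma exists_lift (hn : 3 ≤ n) {h : ℕ → Fin 2 → R} {x : ℤˣ → ℕ → Fin 2 → R}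
    (hr : Relations n ħ (ε + n / 2 * ħ) h x) : ∃ Ψ : AffineYangian n ħ ε →ₐ[ℂ] R,
      (∀ i r, i < n → Ψ (H ħ ε (i : ZMod n) r) = h i r) ∧
      ∀ σ i r, i < n → Ψ (X ħ ε σ (i : ZMod n) r) = x σ i r := by
  have : NeZero n := ⟨by omega⟩
  let Ψ : AffineYangian n ħ ε →ₐ[ℂ] R :=
    RingQuot.liftAlgHom ℂ ⟨FreeAlgebra.lift ℂ (genMap h x), genMap_rel hn hr⟩
  have hΨ : ∀ g, Ψ (gen n ħ ε g) = genMap h x g := by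
    intro g
    change RingQuot.liftAlgHom ℂ _ (RingQuot.mkAlgHom ℂ _ _) = _
    rw [RingQuot.liftAlgHom_mkAlgHom_apply, FreeAlgebra.lift_ι_apply]
  refine ⟨Ψ, fun i r hi => ?_, fun σ i r hi => ?_⟩
  · rw [H, hΨ, genMap, ZMod.val_cast_of_lt hi]
  · rw [X, hΨ, genMap, ZMod.val_cast_of_lt hi]

open Steinberg in
/-- The degree zero generators satisfy the relations of the affine Lie algebra. -/
lemma Relations.chevalleyAffine {κ : ℂ} (hn : 4 ≤ n) {h : ℕ → Fin 2 → R}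
    {x : ℤˣ → ℕ → Fin 2 → R} (hr : Relations n ħ κ h x) :
    ChevalleyAffine n (fun i => x 1 i 0) fun i => x (-1) i 0 := by
  have hef : ∀ i j, (i < n ∧ j < n ∧ i ≠ j) → ⁅x 1 i 0, x (-1) j 0⁆ = 0 := fun i j h => by
    rw [hr.x0_x0 i j (by omega) (by omega), if_neg h.2.2]
  have hh : ∀ i, i < n → ⁅x 1 i 0, x (-1) i 0⁆ = h i 0 := fun i h => by
    rw [hr.x0_x0 i i h h, if_pos rfl]
  have hhe : ∀ i j, (i < n ∧ j < n ∧ i ≠ j ∧ Adjacent n i j) →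
      ⁅⁅x 1 i 0, x (-1) i 0⁆, x 1 j 0⁆ = -x 1 j 0 := fun i j h => by
    rw [hh i (by omega), hr.h0_x 1 i j 0 (by omega) (by omega),
      cartanNat_of_adjacent (by omega) (by omega)]
    simp [sgn]
  have hhf : ∀ i j, (i < n ∧ j < n ∧ i ≠ j ∧ Adjacent n i j) →
      ⁅⁅x 1 i 0, x (-1) i 0⁆, x (-1) j 0⁆ = x (-1) j 0 := fun i j h => by
    rw [hh i (by omega), hr.h0_x (-1) i j 0 (by omega) (by omega),
      cartanNat_of_adjacent (by omega) (by omega)]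
    simp [sgn]
  have hfar : ∀ σ i j, (i < n ∧ j < n ∧ i ≠ j ∧ ¬Adjacent n i j) → ⁅x σ i 0, x σ j 0⁆ = 0 :=
    fun σ i j h => hr.serre_far σ i j h.1 h.2.1 h.2.2.1 h.2.2.2
  have hser : ∀ σ i j, (i < n ∧ j < n ∧ i ≠ j ∧ Adjacent n i j) →
      ⁅x σ i 0, ⁅x σ i 0, x σ j 0⁆⁆ = 0 :=
    fun σ i j h => hr.serre σ i j h.1 h.2.1 h.2.2.1 h.2.2.2
  refine ⟨⟨?_, ?_, ?_, ?_, ?_, ?_, ?_⟩, ?_, ?_, ?_, ?_, ?_, ?_, ?_, ?_, ?_, ?_, ?_, ?_⟩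
  · exact fun i j h => hef i j (by omega)
  · exact fun i j h => hhe i j (by omega)
  · exact fun i j h => hhf i j (by omega)
  · exact fun i j h => hfar 1 i j (by omega)
  · exact fun i j h => hfar (-1) i j (by omega)
  · exact fun i j h => hser 1 i j (by omega)
  · exact fun i j h => hser (-1) i j (by omega)
  · exact fun i h => by rw [← lie_skew, hef 0 i (by omega), neg_zero]
  · exact fun i h => hef i 0 (by omega)
  · exact fun i h => hfar 1 i 0 (by omega)
  · exact fun i h => hfar (-1) i 0 (by omega)
  · exact fun i h => hhe i 0 (by omega)
  · exact fun i h => hhf i 0 (by omega)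
  · exact fun i h => hhe 0 i (by omega)
  · exact fun i h => hhf 0 i (by omega)
  · exact fun i h => hser 1 i 0 (by omega)
  · exact fun i h => hser (-1) i 0 (by omega)
  · exact fun i h => hser 1 0 i (by omega)
  · exact fun i h => hser (-1) 0 i (by omega)

open AffineSl Steinberg in
/-- The natural homomorphism exists. -/
lemma exists_isNatural {N : ℕ} [NeZero N] (hN : 4 ≤ N) (ħ ε : ℂ) :
    ∃ φ : Env N →ₐ[ℂ] AffineYangian N ħ ε, IsNatural φ := by
  have hr := relations_map (by omega : 3 ≤ N) (AlgHom.id ℂ (AffineYangian N ħ ε))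
  obtain ⟨Z, hZ, he, hf, he0, hf0⟩ := (hr.chevalleyAffine hN).exists_loop hN
  let φ := UniversalEnvelopingAlgebra.lift ℂ (affineHom hN hZ)
  have hφ : ∀ x, φ (UniversalEnvelopingAlgebra.ι ℂ x) = affineHom hN hZ x :=
    fun x => UniversalEnvelopingAlgebra.lift_ι_apply ℂ _ x
  have : Fact (1 < N) := ⟨by omega⟩
  have hne : ∀ i : ZMod N, i ≠ i + 1 := fun i => by simp
  have h1 : label (1 : ZMod N) = 1 := by
    simpa using label_cast (N := N) (i := 1) le_rfl (by omega)
  have hl : ∀ i : ZMod N, i ≠ 0 → label i < N ∧ label (i + 1) = label i + 1 := by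
    intro i hi
    have h₁ : label i < N := by
      rw [label, if_neg hi]
      exact ZMod.val_lt i
    refine ⟨h₁, ?_⟩
    conv_lhs => rw [← cast_label i, ← Nat.cast_one, ← Nat.cast_add]
    exact label_cast (by omega) (by omega)
  have hφe : ∀ i, φ (UniversalEnvelopingAlgebra.ι ℂ (e N i)) = X ħ ε 1 i 0 := by
    intro i
    rw [hφ, e, affineHom_E hN hZ (hne i)]
    split_ifs with hi
    · subst hi
      rw [zero_add, h1, label, if_pos rfl, he0]
      simp
    · rw [(hl i hi).2, he _ (one_le_label i) (hl i hi).1]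
      simp [cast_label]
  have hφf : ∀ i, φ (UniversalEnvelopingAlgebra.ι ℂ (f N i)) = X ħ ε (-1) i 0 := by
    intro i
    rw [hφ, f, affineHom_E hN hZ (hne i).symm]
    split_ifs with hi
    · subst hi
      rw [zero_add, h1, label, if_pos rfl, hf0]
      simp
    · rw [(hl i hi).2, hf _ (one_le_label i) (hl i hi).1]
      simp [cast_label]
  refine ⟨φ, fun i => ⟨hφe i, hφf i, ?_⟩⟩
  have h₂ := hr.x0_x0 i.val i.val (ZMod.val_lt i) (ZMod.val_lt i)
  rw [if_pos rfl] at h₂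
  simp only [ZMod.natCast_zmod_val, AlgHom.id_apply] at h₂
  rw [← e_lie_f (by omega), hφ, LieHom.map_lie, ← hφ, ← hφ, hφe, hφf, h₂]

end AffineYangian

end

noncomputable section

/-! ### Root vectors in the image of the Yangian -/

namespace AffineYangian

attribute [local instance] LieRing.ofAssociativeRing

open Steinberg MulOpposite

variable {R : Type*} [Ring R]

lemma lie_mul_eq (a b c : R) : ⁅a, b * c⁆ = ⁅a, b⁆ * c + b * ⁅a, c⁆ := by
  simp only [Ring.lie_def, mul_sub, sub_mul, mul_assoc]
  abel

lemma mul_lie_eq (a b c : R) : ⁅a * b, c⁆ = a * ⁅b, c⁆ + ⁅a, c⁆ * b := by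
  simp only [Ring.lie_def, mul_sub, sub_mul, mul_assoc]
  abel

lemma op_lie_op (a b : R) : ⁅op a, op b⁆ = op ⁅b, a⁆ := by
  simp only [Ring.lie_def, op_sub, op_mul]

lemma sgn_one : sgn 1 = 1 := by simp [sgn]

lemma sgn_neg (σ : ℤˣ) : sgn (-σ) = -sgn σ := by simp [sgn]

variable [Algebra ℂ R]

/-- Interchanging the generators `X^+` and `X^-` is an anti-automorphism of the presentation. -/
lemma Relations.op {n : ℕ} {ħ κ : ℂ} {h : ℕ → Fin 2 → R} {x : ℤˣ → ℕ → Fin 2 → R}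
    (hr : Relations n ħ κ h x) :
    Relations n ħ κ (fun i r => op (h i r)) fun σ i r => op (x (-σ) i r) where
  h_h i j r s hi hj := by rw [op_lie_op, hr.h_h j i s r hj hi, op_zero]
  x0_x0 i j hi hj := by
    rw [op_lie_op, neg_neg, hr.x0_x0 j i hj hi]
    by_cases hij : i = j
    · subst hij
      simp
    · rw [if_neg hij, if_neg (Ne.symm hij), op_zero]
  x1_x0 i j hi hj := by
    rw [op_lie_op, neg_neg, hr.x0_x1 j i hj hi]
    by_cases hij : i = j
    · subst hij
      simp
    · rw [if_neg hij, if_neg (Ne.symm hij), op_zero]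
  x0_x1 i j hi hj := by
    rw [op_lie_op, neg_neg, hr.x1_x0 j i hj hi]
    by_cases hij : i = j
    · subst hij
      simp
    · rw [if_neg hij, if_neg (Ne.symm hij), op_zero]
  h0_x σ i j r hi hj := by
    rw [op_lie_op, ← lie_skew, hr.h0_x _ i j r hi hj, sgn_neg, ← op_smul, op_neg, neg_mul, neg_smul,
      op_neg, neg_neg]
  ht_x σ i j hi hj h₁ h₂ := by
    rw [← op_pow, ← op_smul, ← op_sub, op_lie_op, ← lie_skew, hr.ht_x _ i j hi hj h₁ h₂, sgn_neg,
      ← op_smul, op_neg, neg_mul, neg_smul, op_neg, neg_neg]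
  ht_x_zero_last σ l hl := by
    rw [← op_pow, ← op_smul, ← op_sub, op_lie_op, ← lie_skew, hr.ht_x_zero_last _ l hl, sgn_neg,
      ← op_smul, ← op_add, ← op_smul, op_neg, neg_smul, op_neg, neg_neg]
  ht_x_last_zero σ l hl := by
    rw [← op_pow, ← op_smul, ← op_sub, op_lie_op, ← lie_skew, hr.ht_x_last_zero _ l hl, sgn_neg,
      ← op_smul, ← op_sub, ← op_smul, op_neg, neg_smul, op_neg, neg_neg]
  x_x σ i j hi hj h₁ h₂ := by
    have := hr.x_x (-σ) i j hi hj h₁ h₂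
    rw [op_lie_op, op_lie_op, ← op_mul, ← op_mul, ← op_add, ← op_smul, ← op_sub,
      ← lie_skew (x (-σ) j 0), ← lie_skew (x (-σ) j 1)]
    congr 1
    rw [← neg_sub', this, sgn_neg, neg_mul, neg_mul, neg_smul, neg_neg,
      add_comm (x (-σ) j 0 * _)]
  x_x_zero_last σ l hl := by
    have := hr.x_x_zero_last (-σ) l hl
    rw [op_lie_op, op_lie_op, op_lie_op, ← op_mul, ← op_mul, ← op_add, ← op_smul, ← op_sub,
      ← op_smul, ← op_add, ← lie_skew (x (-σ) l 0), ← lie_skew (x (-σ) l 1),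
      ← lie_skew (x (-σ) l 0) (x (-σ) 0 0)]
    congr 1
    rw [← neg_sub', this, sgn_neg, neg_neg, neg_mul, neg_smul, smul_neg, neg_add,
      add_comm (x (-σ) l 0 * _)]
  serre_far σ i j hi hj hij ha := by
    rw [op_lie_op, ← lie_skew, hr.serre_far _ i j hi hj hij ha, neg_zero, op_zero]
  serre σ i j hi hj hij ha := by
    rw [op_lie_op, op_lie_op, ← lie_skew, ← lie_skew (x (-σ) j 0), lie_neg,
      hr.serre _ i j hi hj hij ha, neg_zero, neg_zero, op_zero]

lemma Relations.x1_x0_far {n : ℕ} {ħ κ : ℂ} {h : ℕ → Fin 2 → R} {x : ℤˣ → ℕ → Fin 2 → R}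
    (hr : Relations n ħ κ h x) (hn : 3 ≤ n) (σ : ℤˣ) {i j : ℕ} (hi : i < n) (hj : j < n)
    (hij : i ≠ j) (ha : ¬Adjacent n i j) : ⁅x σ i 1, x σ j 0⁆ = 0 := by
  have h₁ := congrArg (fun z => ⁅h i 1 - (ħ / 2) • h i 0 ^ 2, z⁆) (hr.serre_far σ i j hi hj hij ha)
  simp only [leibniz_lie (h i 1 - _)] at h₁
  rw [hr.ht_x σ i i hi hi (by omega) (by omega), hr.ht_x σ i j hi hj (by omega) (by omega),
    cartanNat_self, cartanNat_of_not_adjacent ha hij, mul_zero, zero_smul, lie_zero, lie_zero,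
    add_zero, smul_lie] at h₁
  refine (smul_eq_zero.1 h₁).resolve_left ?_
  rcases Int.units_eq_one_or σ with rfl | rfl <;> simp [sgn]

/-- The image of the Yangian of `sl(n + 1)^` in an algebra: elements that satisfy the relations,
together with compatible root vectors `E r i j`, the images of `E_ij t^r`. -/
structure LoopRep (n : ℕ) (ħ κ : ℂ) (h : ℕ → Fin 2 → R) (x : ℤˣ → ℕ → Fin 2 → R)
    (E : ℤ → ℕ → ℕ → R) : Prop where
  rel : Relations (n + 1) ħ (κ + ħ / 2) h x
  prod : ∀ r s, MatProd 1 (n + 1) (E r) (E s) (E (r + s))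
  e : ∀ i, 1 ≤ i → i ≤ n → x 1 i 0 = E 0 i (i + 1)
  f : ∀ i, 1 ≤ i → i ≤ n → x (-1) i 0 = E 0 (i + 1) i
  e₀ : x 1 0 0 = E 1 (n + 1) 1
  f₀ : x (-1) 0 0 = E (-1) 1 (n + 1)

/-- The opposite algebra, with the root vectors `E_ij t^r` replaced by `E_ji t^(-r)`. -/
lemma LoopRep.op {n : ℕ} {ħ κ : ℂ} {h : ℕ → Fin 2 → R} {x : ℤˣ → ℕ → Fin 2 → R}
    {E : ℤ → ℕ → ℕ → R} (hr : LoopRep n ħ κ h x E) :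
    LoopRep n ħ κ (fun i r => op (h i r)) (fun σ i r => op (x (-σ) i r))
      fun r i j => op (E (-r) j i) where
  rel := hr.rel.op
  prod r s i j k l hi := by
    rw [op_lie_op, hr.prod _ _ l k j i (by omega), op_sub, show -s + -r = -(r + s) by ring,
      apply_ite MulOpposite.op, apply_ite MulOpposite.op, op_zero]
    exact congrArg₂ _ (if_congr eq_comm rfl rfl) (if_congr eq_comm rfl rfl)
  e i hi hi' := by rw [hr.f i hi hi', neg_zero]
  f i hi hi' := by rw [neg_neg, hr.e i hi hi', neg_zero]
  e₀ := by rw [hr.f₀]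
  f₀ := by rw [neg_neg, hr.e₀, neg_neg]

end AffineYangian

end

noncomputable section

/-! ### The action of diagonal elements on root vectors -/

namespace AffineYangian

attribute [local instance] LieRing.ofAssociativeRing

open Steinberg MulOpposite

variable {R : Type*} [Ring R] [Algebra ℂ R]

/-- `K` acts on the generators `X^±_{j,0}` like the combination of the `H̃_{i,1}` with diagonal
matrix `w`: `[K, X^±_{j,0}] = ± (w_j - w_{j+1}) X^±_{j,1}`. The positions `0` and `n + 1` both
stand for the last row, whose entry is zero: then `H̃_{0,1}` and `H̃_{n,1}` do not occur. -/
structure IsDiagonal (n : ℕ) (x : ℤˣ → ℕ → Fin 2 → R) (w : ℕ → ℂ) (K : R) : Prop where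
  zero : w 0 = 0
  last : w (n + 1) = 0
  sum : ∑ k ∈ Finset.Ico 1 (n + 1), w k = 0
  lie : ∀ σ j, j ≤ n → ⁅K, x σ j 0⁆ = (sgn σ * (w j - w (j + 1))) • x σ j 1

namespace IsDiagonal

variable {n : ℕ} {x : ℤˣ → ℕ → Fin 2 → R} {w w' : ℕ → ℂ} {K K' : R}

lemma sub_smul (hK : IsDiagonal n x w K) (hK' : IsDiagonal n x w' K') (a b : ℂ) :
    IsDiagonal n x (fun k => a * w k - b * w' k) (a • K - b • K') where
  zero := by simp [hK.zero, hK'.zero]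
  last := by simp [hK.last, hK'.last]
  sum := by rw [Finset.sum_sub_distrib, ← Finset.mul_sum, ← Finset.mul_sum, hK.sum, hK'.sum]; simp
  lie σ j hj := by
    rw [sub_lie, smul_lie, smul_lie, hK.lie σ j hj, hK'.lie σ j hj, smul_smul, smul_smul,
      ← _root_.sub_smul]
    congr 1
    ring

lemma op (hK : IsDiagonal n x w K) :
    IsDiagonal n (fun σ i r => op (x (-σ) i r)) w (op K) where
  zero := hK.zero
  last := hK.last
  sum := hK.sum
  lie σ j hj := by
    rw [op_lie_op, ← lie_skew, hK.lie _ j hj, sgn_neg, neg_mul, neg_smul, neg_neg, ← op_smul]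

end IsDiagonal

namespace LoopRep

variable {n : ℕ} {ħ κ : ℂ} {h : ℕ → Fin 2 → R} {x : ℤˣ → ℕ → Fin 2 → R} {E : ℤ → ℕ → ℕ → R}

/-- The root vectors that are iterated commutators of `X^+_{a,0}, …, X^+_{b-1,0}`. -/
def chain (n : ℕ) (E : ℤ → ℕ → ℕ → R) (a b : ℕ) : R := if a = 0 then E 1 (n + 1) b else E 0 a b

lemma chain_zero (b : ℕ) : chain n E 0 b = E 1 (n + 1) b := if_pos rfl

lemma chain_of_pos {a : ℕ} (ha : 1 ≤ a) (b : ℕ) : chain n E a b = E 0 a b := if_neg (by omega)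

/-- The iterated commutator of `X^+_{a,1}, X^+_{a+1,0}, …, X^+_{b-1,0}`. -/
def chainOne (n : ℕ) (x : ℤˣ → ℕ → Fin 2 → R) (E : ℤ → ℕ → ℕ → R) (a b : ℕ) : R :=
  if b = a + 1 then x 1 a 1 else ⁅x 1 a 1, chain n E (a + 1) b⁆

lemma e_eq_chain (hr : LoopRep n ħ κ h x E) {a : ℕ} (ha : a ≤ n) :
    x 1 a 0 = chain n E a (a + 1) := by
  rcases Nat.eq_zero_or_pos a with rfl | h0
  · rw [chain_zero, hr.e₀]
  · rw [chain_of_pos h0, hr.e a h0 ha]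

lemma e_lie_chain (hr : LoopRep n ħ κ h x E) {a b : ℕ} (hb : a + 1 < b ∧ b ≤ n + 1)
    (h0 : a = 0 → b ≤ n) : ⁅x 1 a 0, chain n E (a + 1) b⁆ = chain n E a b := by
  rw [hr.e_eq_chain (by omega), chain_of_pos (a := a + 1) (by omega)]
  rcases Nat.eq_zero_or_pos a with rfl | ha
  · rw [chain_zero, chain_zero, (hr.prod 1 0).mul, add_zero]
  · rw [chain_of_pos ha, chain_of_pos ha, (hr.prod 0 0).mul, add_zero]

lemma e_lie_chain_far (hr : LoopRep n ħ κ h x E) {a b c : ℕ} (hc : a + 2 ≤ c ∧ c < b ∧ b ≤ n + 1)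
    (h0 : a = 0 → b ≤ n) : ⁅x 1 a 0, chain n E c b⁆ = 0 := by
  rw [hr.e_eq_chain (by omega), chain_of_pos (a := c) (by omega)]
  rcases Nat.eq_zero_or_pos a with rfl | ha
  · rw [chain_zero, (hr.prod 1 0).zero]
  · rw [chain_of_pos ha, (hr.prod 0 0).zero]

lemma x1_lie_chain_far (hn : 3 ≤ n) (hr : LoopRep n ħ κ h x E) {a c b : ℕ}
    (hc : a + 2 ≤ c ∧ c < b ∧ b ≤ n + 1) (h0 : a = 0 → b ≤ n) :
    ⁅x 1 a 1, chain n E c b⁆ = 0 := by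
  obtain ⟨d, rfl⟩ := Nat.exists_eq_add_of_lt hc.2.1
  induction d with
  | zero =>
    rw [add_zero, ← hr.e_eq_chain (by omega),
      hr.rel.x1_x0_far (by omega) 1 (by omega) (by omega) (by omega) (by omega)]
  | succ d ih =>
    have h₁ : chain n E c (c + (d + 1) + 1) = ⁅chain n E c (c + d + 1), x 1 (c + d + 1) 0⁆ := by
      rw [chain_of_pos (by omega), chain_of_pos (by omega), hr.e _ (by omega) (by omega),
        (hr.prod 0 0).mul, add_zero]
      rfl
    rw [h₁, leibniz_lie, ih (by omega) (by omega), zero_lie,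
      hr.rel.x1_x0_far (by omega) 1 (by omega) (by omega) (by omega) (by omega), lie_zero,
      add_zero]

lemma e_lie_chainOne (hn : 3 ≤ n) (hr : LoopRep n ħ κ h x E) {a b : ℕ}
    (hb : a + 1 < b ∧ b ≤ n + 1) (h0 : a = 0 → b ≤ n) :
    ⁅x 1 a 0, chainOne n x E (a + 1) b⁆ = chainOne n x E a b +
      (ħ / 2) • (chain n E a (a + 1) * chain n E (a + 1) b +
        chain n E (a + 1) b * chain n E a (a + 1)) := by
  have hxx := hr.rel.x_x 1 a (a + 1) (by omega) (by omega) (by omega) (by omega)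
  rw [cartanNat_of_adjacent (by omega) (by omega), sgn_one, one_mul, neg_one_mul, neg_smul,
    sub_eq_iff_eq_add, neg_add_eq_sub, eq_sub_iff_add_eq] at hxx
  rw [chainOne, chainOne, if_neg (show b ≠ a + 1 by omega)]
  split_ifs with hb'
  · subst hb'
    rw [← hxx, hr.e_eq_chain (a := a) (by omega), ← hr.e_eq_chain (a := a + 1) (by omega)]
  · rw [leibniz_lie, hr.e_lie_chain_far (by omega) h0, lie_zero, add_zero, ← hxx, add_lie,
      lie_lie, hr.x1_lie_chain_far hn (by omega) h0, lie_zero, sub_zero,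
      hr.e_lie_chain (by omega) (by omega), smul_lie, add_lie, mul_lie_eq, mul_lie_eq,
      hr.e_lie_chain_far (by omega) h0, hr.e_lie_chain (by omega) (by omega), zero_mul, mul_zero,
      add_zero, zero_add, hr.e_eq_chain (by omega)]

/-- The action of `K` on the commutators of the `X^+_{j,0}`. -/
lemma lie_chain (hn : 3 ≤ n) (hr : LoopRep n ħ κ h x E) {w : ℕ → ℂ} {K : R}
    (hK : IsDiagonal n x w K) (b d : ℕ) : ∀ a, a + d + 1 = b → b ≤ n + 1 → (a = 0 → b ≤ n) →
    ⁅K, chain n E a b⁆ = (w a - w b) • chainOne n x E a b +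
      (ħ / 2) • ∑ k ∈ Finset.Ico (a + 1) b,
        (w k - w b) • (chain n E a k * chain n E k b + chain n E k b * chain n E a k) := by
  induction d with
  | zero =>
    intro a ha hb h0
    obtain rfl : b = a + 1 := ha.symm
    rw [← hr.e_eq_chain (by omega), hK.lie 1 a (by omega), chainOne, if_pos rfl, sgn_one, one_mul,
      Finset.Ico_self, Finset.sum_empty, smul_zero, add_zero]
  | succ d ih =>
    intro a ha hb h0
    have hfar : ∀ k ∈ Finset.Ico (a + 1 + 1) b, ⁅x 1 a 0, chain n E (a + 1) k * chain n E k b +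
        chain n E k b * chain n E (a + 1) k⁆ =
        chain n E a k * chain n E k b + chain n E k b * chain n E a k := by
      intro k hk
      rw [Finset.mem_Ico] at hk
      rw [lie_add, lie_mul_eq, lie_mul_eq, hr.e_lie_chain_far (by omega) h0,
        hr.e_lie_chain (by omega) (by omega), mul_zero, zero_mul, add_zero, zero_add]
    rw [← hr.e_lie_chain (by omega) h0, leibniz_lie, hK.lie 1 a (by omega), sgn_one, one_mul,
      ih (a + 1) (by omega) hb (by omega), lie_add, lie_smul, hr.e_lie_chainOne hn (by omega) h0,
      lie_smul, lie_sum, Finset.sum_eq_sum_Ico_succ_bot (a := a + 1) (by omega)]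
    simp only [lie_smul]
    rw [Finset.sum_congr rfl fun k hk => by rw [hfar k hk], smul_lie,
      show ⁅x 1 a 1, chain n E (a + 1) b⁆ = chainOne n x E a b by
        rw [chainOne, if_neg (by omega)]]
    module

end LoopRep

end AffineYangian

end

noncomputable section

/-! ### Commutativity of the partial sums -/

namespace AffineYangian

attribute [local instance] LieRing.ofAssociativeRing

open Steinberg MulOpposite Finset

variable {R : Type*} [Ring R] [Algebra ℂ R]

namespace LoopRep

variable {n : ℕ} {ħ κ : ℂ} {h : ℕ → Fin 2 → R} {x : ℤˣ → ℕ → Fin 2 → R} {E : ℤ → ℕ → ℕ → R}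

/-- The sum of the `E_kl t^(m-s) E_{n+1,k} t^(s+1)` over `0 ≤ s < m`. -/
def rowSum (n : ℕ) (E : ℤ → ℕ → ℕ → R) (k l m : ℕ) : R :=
  ∑ s ∈ range m, E ((m : ℤ) - s) k l * E ((s : ℤ) + 1) (n + 1) k

lemma shift_row (hn : 3 ≤ n) (hr : LoopRep n ħ κ h x E) {l : ℕ} (hl : 1 ≤ l ∧ l ≤ n) (s : ℤ) :
    ⁅E 1 (n + 1) l, ⁅E 0 l (n + 1), E s (n + 1) l⁆⁆ = (2 : ℂ) • E (s + 1) (n + 1) l := by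
  rw [lie_lie_opposite (by omega) hr.prod (by omega) (by omega), if_pos rfl, if_neg (by omega),
    if_neg (by omega), if_pos rfl, show 1 + 0 + s = s + 1 by ring]
  norm_num

lemma shift_mul (hr : LoopRep n ħ κ h x E) {k l : ℕ} (hl : 1 ≤ l ∧ l ≤ n ∧ 1 ≤ k ∧ k ≤ n ∧ k ≠ l)
    (p s : ℤ) :
    ⁅E 1 (n + 1) l, ⁅E 0 l (n + 1), E p k l * E s (n + 1) k⁆⁆ =
      E (p + 1) k l * E s (n + 1) k + E p k l * E (s + 1) (n + 1) k := by
  rw [lie_mul_eq, (hr.prod 0 p).mul_neg, (hr.prod 0 s).mul, lie_add, lie_mul_eq, lie_mul_eq,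
    lie_neg, (hr.prod 1 (0 + p)).mul_neg, (hr.prod 1 s).zero, (hr.prod 1 p).zero,
    (hr.prod 1 (0 + s)).mul, neg_neg, mul_zero, add_zero, zero_mul, zero_add, zero_add, zero_add,
    add_comm 1 p, add_comm 1 s]

lemma shift_rowSum (hr : LoopRep n ħ κ h x E) {k l : ℕ}
    (hl : 1 ≤ l ∧ l ≤ n ∧ 1 ≤ k ∧ k ≤ n ∧ k ≠ l) (m : ℕ) :
    ⁅E 1 (n + 1) l, ⁅E 0 l (n + 1), rowSum n E k l m⁆⁆ + E 1 k l * E ((m : ℤ) + 1) (n + 1) k +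
      E ((m : ℤ) + 1) k l * E 1 (n + 1) k = (2 : ℂ) • rowSum n E k l (m + 1) := by
  rw [rowSum, lie_sum, lie_sum]
  simp only [hr.shift_mul hl]
  rw [sum_add_distrib, two_smul]
  have h₁ : rowSum n E k l (m + 1) = ∑ s ∈ range m,
      E ((m : ℤ) - s + 1) k l * E ((s : ℤ) + 1) (n + 1) k +
        E 1 k l * E ((m : ℤ) + 1) (n + 1) k := by
    rw [rowSum, sum_range_succ]
    congr 1
    · refine sum_congr rfl fun s _ => ?_
      push_cast
      rw [show (m : ℤ) + 1 - s = m - s + 1 by ring]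
    · push_cast
      rw [add_sub_cancel_left]
  have h₂ : rowSum n E k l (m + 1) = ∑ s ∈ range m,
      E ((m : ℤ) - s) k l * E ((s : ℤ) + 1 + 1) (n + 1) k +
        E ((m : ℤ) + 1) k l * E 1 (n + 1) k := by
    rw [rowSum, sum_range_succ']
    congr 1
    · refine sum_congr rfl fun s _ => ?_
      push_cast
      rw [show (m : ℤ) + 1 - (s + 1) = m - s by ring]
  conv_rhs => lhs; rw [h₁]
  conv_rhs => rhs; rw [h₂]
  abel

/-- The image of a row vector `E_{n+1,l} t^(m+1)` under `ad K`, when `w_l = 0`. The map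
`y ↦ [E_{n+1,l} t, [E_{l,n+1}, y]]` multiplies the row vector by `2 t`, which yields an induction
on `m`. -/
lemma lie_row (hn : 3 ≤ n) (hr : LoopRep n ħ κ h x E) {w : ℕ → ℂ} {K : R}
    (hK : IsDiagonal n x w K) {l : ℕ} (hl : 1 ≤ l ∧ l ≤ n) (hw : w l = 0) (m : ℕ) :
    ⁅K, E ((m : ℤ) + 1) (n + 1) l⁆ =
      ħ • ∑ k ∈ Ico 1 l, w k • (rowSum n E k l m + E 0 k l * E ((m : ℤ) + 1) (n + 1) k) +
      ħ • ∑ k ∈ Ico (l + 1) (n + 1), w k • rowSum n E k l m +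
      (ħ / 2 * ∑ k ∈ Ico 1 l, w k) • E ((m : ℤ) + 1) (n + 1) l := by
  have hw' : ∑ k ∈ Ico (l + 1) (n + 1), w k = -∑ k ∈ Ico 1 l, w k := by
    have h₁ := hK.sum
    rw [← sum_Ico_consecutive w hl.1 (show l ≤ n + 1 by omega),
      sum_eq_sum_Ico_succ_bot (a := l) (by omega), hw, zero_add] at h₁
    rw [eq_neg_iff_add_eq_zero, add_comm, h₁]
  have hh : ∀ y : R, ħ • y = (ħ / 2) • (2 : ℂ) • y := fun y => by module
  have hb : ⁅K, E 1 (n + 1) l⁆ = ħ • ∑ k ∈ Ico 1 l, w k • (E 0 k l * E 1 (n + 1) k) +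
      (ħ / 2 * ∑ k ∈ Ico 1 l, w k) • E 1 (n + 1) l := by
    have h₁ := hr.lie_chain hn hK l (l - 1) 0 (by omega) (by omega) (by omega)
    rw [chain_zero, hK.zero, hw, sub_zero, zero_smul, zero_add] at h₁
    rw [h₁, hh, mul_smul, Finset.sum_smul, ← smul_add, smul_sum (r := (2 : ℂ)),
      ← sum_add_distrib]
    congr 1
    refine sum_congr rfl fun k hk => ?_
    rw [mem_Ico] at hk
    have h₂ := (hr.prod 1 0).mul (i := n + 1) (j := k) (l := l)
    rw [Ring.lie_def, sub_eq_iff_eq_add, add_zero] at h₂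
    rw [sub_zero, chain_zero, chain_of_pos (by omega), h₂]
    module
  have hg : ⁅K, E 0 l (n + 1)⁆ = (ħ / 2) • ∑ k ∈ Ico (l + 1) (n + 1),
      w k • (E 0 l k * E 0 k (n + 1) + E 0 k (n + 1) * E 0 l k) := by
    have h₁ := hr.lie_chain hn hK (n + 1) (n - l) l (by omega) le_rfl (by omega)
    rw [chain_of_pos hl.1, hK.last, hw, sub_zero, zero_smul, zero_add] at h₁
    rw [h₁]
    congr 1
    refine sum_congr rfl fun k hk => ?_
    rw [mem_Ico] at hk
    rw [sub_zero, chain_of_pos hl.1, chain_of_pos (by omega)]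
  induction m with
  | zero =>
    simp only [Nat.cast_zero, zero_add, rowSum, range_zero, sum_empty, smul_zero, sum_const_zero,
      add_zero]
    exact hb
  | succ m ih =>
    set T : R → R := fun y => ⁅E 1 (n + 1) l, ⁅E 0 l (n + 1), y⁆⁆ with hT
    have hcast : ((m + 1 : ℕ) : ℤ) + 1 = (m : ℤ) + 1 + 1 := by push_cast; ring
    rw [hcast]
    have h₁ : ⁅⁅K, E 1 (n + 1) l⁆, ⁅E 0 l (n + 1), E ((m : ℤ) + 1) (n + 1) l⁆⁆ =
        ħ • ∑ k ∈ Ico 1 l, w k • (E ((m : ℤ) + 1) k l * E 1 (n + 1) k +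
          E 0 k l * E ((m : ℤ) + 1 + 1) (n + 1) k) +
        (2 * (ħ / 2 * ∑ k ∈ Ico 1 l, w k)) • E ((m : ℤ) + 1 + 1) (n + 1) l := by
      rw [hb, add_lie, smul_lie, smul_lie, hr.shift_row hn hl, smul_smul, sum_lie]
      congr 1
      · congr 1
        refine sum_congr rfl fun k hk => ?_
        rw [mem_Ico] at hk
        rw [smul_lie, mul_lie_eq, lie_lie_opposite (by omega) hr.prod (by omega) (by omega),
          lie_lie_opposite (by omega) hr.prod (by omega) (by omega), if_neg (show k ≠ l by omega),
          if_neg (show l ≠ n + 1 by omega), if_neg (show k ≠ n + 1 by omega), if_pos rfl,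
          if_neg (show n + 1 ≠ l by omega), if_pos rfl, zero_add, zero_add, add_zero,
          add_comm 1 ((m : ℤ) + 1), add_comm (E 0 k l * _)]
        simp
      · rw [mul_comm]
    have h₂ : ⁅E 1 (n + 1) l, ⁅⁅K, E 0 l (n + 1)⁆, E ((m : ℤ) + 1) (n + 1) l⁆⁆ =
        ħ • ∑ k ∈ Ico (l + 1) (n + 1), w k • (E 1 k l * E ((m : ℤ) + 1) (n + 1) k +
          E ((m : ℤ) + 1) k l * E 1 (n + 1) k) +
        (ħ * ∑ k ∈ Ico (l + 1) (n + 1), w k) • E ((m : ℤ) + 1 + 1) (n + 1) l := by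
      rw [hg, smul_lie, sum_lie, lie_smul, lie_sum, mul_smul, Finset.sum_smul,
        ← smul_add, ← sum_add_distrib, hh, smul_sum (r := (2 : ℂ))]
      congr 1
      refine sum_congr rfl fun k hk => ?_
      rw [mem_Ico] at hk
      have e₁ := (hr.prod ((m : ℤ) + 1) 1).mul (i := n + 1) (j := k) (l := l)
      have e₂ := (hr.prod 1 ((m : ℤ) + 1)).mul (i := n + 1) (j := k) (l := l)
      rw [Ring.lie_def, sub_eq_iff_eq_add] at e₁ e₂
      rw [add_comm 1 ((m : ℤ) + 1)] at e₂
      rw [smul_lie, lie_smul, add_lie, mul_lie_eq, mul_lie_eq, (hr.prod 0 ((m : ℤ) + 1)).mul,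
        (hr.prod 0 ((m : ℤ) + 1)).mul_neg, lie_add, lie_add, lie_add, lie_mul_eq, lie_mul_eq,
        lie_mul_eq, lie_mul_eq, lie_neg, (hr.prod 1 0).mul, (hr.prod 1 (0 + ((m : ℤ) + 1))).zero,
        (hr.prod 1 0).mul_neg, (hr.prod 1 (0 + ((m : ℤ) + 1))).zero, zero_add, add_zero]
      simp only [mul_zero, zero_mul, neg_zero, add_zero, zero_add, mul_neg, neg_mul, neg_neg]
      rw [e₁, e₂]
      module
    have h₃ : T ⁅K, E ((m : ℤ) + 1) (n + 1) l⁆ =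
        ħ • ∑ k ∈ Ico 1 l, w k • (T (rowSum n E k l m) + (E 1 k l * E ((m : ℤ) + 1) (n + 1) k +
          E 0 k l * E ((m : ℤ) + 1 + 1) (n + 1) k)) +
        ħ • ∑ k ∈ Ico (l + 1) (n + 1), w k • T (rowSum n E k l m) +
        (2 * (ħ / 2 * ∑ k ∈ Ico 1 l, w k)) • E ((m : ℤ) + 1 + 1) (n + 1) l := by
      rw [ih]
      simp only [hT, lie_add, lie_smul, lie_sum]
      rw [hr.shift_row hn hl, smul_smul, mul_comm 2]
      congr 3
      refine sum_congr rfl fun k hk => ?_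
      rw [mem_Ico] at hk
      rw [hr.shift_mul (by omega), zero_add]
    have h₄ : (2 : ℂ) • ⁅K, E ((m : ℤ) + 1 + 1) (n + 1) l⁆ = (2 : ℂ) •
        (ħ • ∑ k ∈ Ico 1 l, w k •
          (rowSum n E k l (m + 1) + E 0 k l * E ((m : ℤ) + 1 + 1) (n + 1) k) +
        ħ • ∑ k ∈ Ico (l + 1) (n + 1), w k • rowSum n E k l (m + 1) +
        (ħ / 2 * ∑ k ∈ Ico 1 l, w k) • E ((m : ℤ) + 1 + 1) (n + 1) l) := by
      rw [← lie_smul, ← hr.shift_row hn hl, leibniz_lie, leibniz_lie K, lie_add, h₁, h₂]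
      change _ + (_ + T ⁅K, E ((m : ℤ) + 1) (n + 1) l⁆) = _
      rw [h₃, hw', smul_add, smul_add, smul_comm (2 : ℂ) ħ, smul_comm (2 : ℂ) ħ]
      have s₁ : (2 : ℂ) • ∑ k ∈ Ico 1 l, w k •
          (rowSum n E k l (m + 1) + E 0 k l * E ((m : ℤ) + 1 + 1) (n + 1) k) =
          ∑ k ∈ Ico 1 l, w k • (E ((m : ℤ) + 1) k l * E 1 (n + 1) k +
            E 0 k l * E ((m : ℤ) + 1 + 1) (n + 1) k) +
          ∑ k ∈ Ico 1 l, w k • (T (rowSum n E k l m) + (E 1 k l * E ((m : ℤ) + 1) (n + 1) k +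
          E 0 k l * E ((m : ℤ) + 1 + 1) (n + 1) k)) := by
        rw [smul_sum, ← sum_add_distrib]
        refine sum_congr rfl fun k hk => ?_
        rw [mem_Ico] at hk
        rw [smul_comm, smul_add, ← hr.shift_rowSum (by omega)]
        module
      have s₂ : (2 : ℂ) • ∑ k ∈ Ico (l + 1) (n + 1), w k • rowSum n E k l (m + 1) =
          ∑ k ∈ Ico (l + 1) (n + 1), w k • (E 1 k l * E ((m : ℤ) + 1) (n + 1) k +
            E ((m : ℤ) + 1) k l * E 1 (n + 1) k) +
          ∑ k ∈ Ico (l + 1) (n + 1), w k • T (rowSum n E k l m) := by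
        rw [smul_sum, ← sum_add_distrib]
        refine sum_congr rfl fun k hk => ?_
        rw [mem_Ico] at hk
        rw [smul_comm, ← hr.shift_rowSum (by omega)]
        module
      rw [s₁, s₂]
      module
    exact smul_right_injective R (two_ne_zero (α := ℂ)) h₄

/-- The sum of the `w_k E_{k,n+1} t^(-s-1) E_{n+1,k} t^(s+1)` over the pairs `(s, k)` that precede
`(m, l)` in the lexicographic order. -/
def partialSum (n : ℕ) (E : ℤ → ℕ → ℕ → R) (w : ℕ → ℂ) (m l : ℕ) : R :=
  ∑ s ∈ range m, ∑ k ∈ Ico 1 (n + 1),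
    w k • (E (-(s : ℤ) - 1) k (n + 1) * E ((s : ℤ) + 1) (n + 1) k) +
  ∑ k ∈ Ico 1 l, w k • (E (-(m : ℤ) - 1) k (n + 1) * E ((m : ℤ) + 1) (n + 1) k)

lemma partialSum_lie_row (hr : LoopRep n ħ κ h x E) {w : ℕ → ℂ} {l : ℕ} (hl : 1 ≤ l ∧ l ≤ n)
    (hw : w l = 0) (m : ℕ) : ⁅partialSum n E w m l, E ((m : ℤ) + 1) (n + 1) l⁆ =
      ∑ k ∈ Ico 1 l, w k • (rowSum n E k l m + E 0 k l * E ((m : ℤ) + 1) (n + 1) k) +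
      ∑ k ∈ Ico (l + 1) (n + 1), w k • rowSum n E k l m := by
  have key : ∀ k, (1 ≤ k ∧ k ≤ n ∧ k ≠ l) → ∀ s : ℤ,
      ⁅E (-s - 1) k (n + 1) * E (s + 1) (n + 1) k, E ((m : ℤ) + 1) (n + 1) l⁆ =
        E ((m : ℤ) - s) k l * E (s + 1) (n + 1) k := by
    intro k hk s
    rw [mul_lie_eq, (hr.prod (s + 1) ((m : ℤ) + 1)).zero, (hr.prod (-s - 1) ((m : ℤ) + 1)).mul,
      mul_zero, zero_add, show -s - 1 + ((m : ℤ) + 1) = m - s by ring]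
  rw [partialSum, sum_comm, ← sum_Ico_consecutive _ hl.1 (show l ≤ n + 1 by omega),
    sum_eq_sum_Ico_succ_bot (a := l) (b := n + 1) (by omega)]
  simp only [hw, zero_smul, sum_const_zero, zero_add, add_lie, sum_lie, smul_lie]
  rw [add_right_comm, ← sum_add_distrib]
  congr 1
  · refine sum_congr rfl fun k hk => ?_
    rw [mem_Ico] at hk
    rw [sum_congr rfl fun s _ => by rw [key k (by omega)], key k (by omega), ← smul_sum, sub_self,
      ← smul_add]
    rfl
  · refine sum_congr rfl fun k hk => ?_
    rw [mem_Ico] at hk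
    rw [sum_congr rfl fun s _ => by rw [key k (by omega)], ← smul_sum]
    rfl

/-- The terms of `lie_row` quadratic in the root vectors are those of the partial sum. -/
lemma lie_row_eq_smul (hn : 3 ≤ n) (hr : LoopRep n ħ κ h x E) {w : ℕ → ℂ} {K : R}
    (hK : IsDiagonal n x w K) {l : ℕ} (hl : 1 ≤ l ∧ l ≤ n) (hw : w l = 0) (m : ℕ) :
    ⁅K - ħ • partialSum n E w m l, E ((m : ℤ) + 1) (n + 1) l⁆ =
      (ħ / 2 * ∑ k ∈ Ico 1 l, w k) • E ((m : ℤ) + 1) (n + 1) l := by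
  rw [sub_lie, hr.lie_row hn hK hl hw, smul_lie, hr.partialSum_lie_row hl hw, smul_add]
  abel

lemma op_partialSum (w : ℕ → ℂ) (m l : ℕ) :
    MulOpposite.op (partialSum n E w m l) =
      partialSum n (fun r i j => MulOpposite.op (E (-r) j i)) w m l := by
  have h₁ : ∀ s : ℤ, -(-s - 1) = s + 1 := fun s => by ring
  have h₂ : ∀ s : ℤ, -(s + 1) = -s - 1 := fun s => by ring
  simp only [partialSum, op_add, op_sum, op_smul, op_mul, h₁, h₂]

lemma lie_column_eq_smul (hn : 3 ≤ n) (hr : LoopRep n ħ κ h x E) {w : ℕ → ℂ} {K : R}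
    (hK : IsDiagonal n x w K) {l : ℕ} (hl : 1 ≤ l ∧ l ≤ n) (hw : w l = 0) (m : ℕ) :
    ⁅K - ħ • partialSum n E w m l, E (-(m : ℤ) - 1) l (n + 1)⁆ =
      -((ħ / 2 * ∑ k ∈ Ico 1 l, w k) • E (-(m : ℤ) - 1) l (n + 1)) := by
  have h₁ := hr.op.lie_row_eq_smul hn hK.op hl hw m
  rw [← op_partialSum, ← op_smul, ← op_sub, op_lie_op, ← op_smul] at h₁
  have h₂ := op_injective h₁
  rw [← lie_skew, show -(m : ℤ) - 1 = -((m : ℤ) + 1) by ring, h₂]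

/-- Commuting diagonal elements still commute after the partial sums of the series have been
subtracted. The terms are added one at a time. -/
lemma lie_partialSum (hn : 3 ≤ n) (hr : LoopRep n ħ κ h x E) {w w' : ℕ → ℂ} {K K' : R}
    (hK : IsDiagonal n x w K) (hK' : IsDiagonal n x w' K') (hKK : ⁅K, K'⁆ = 0) (m : ℕ) :
    ⁅K - ħ • partialSum n E w m 1, K' - ħ • partialSum n E w' m 1⁆ = 0 := by
  have step : ∀ m l, ⁅K - ħ • partialSum n E w m 1, K' - ħ • partialSum n E w' m 1⁆ = 0 →
      l ≤ n → ⁅K - ħ • partialSum n E w m (l + 1), K' - ħ • partialSum n E w' m (l + 1)⁆ = 0 := by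
    intro m l h₀
    induction l with
    | zero => exact fun _ => h₀
    | succ l ih =>
      intro hl
      have ih := ih (by omega)
      set u := E (-(m : ℤ) - 1) (l + 1) (n + 1) with hu
      set v := E ((m : ℤ) + 1) (n + 1) (l + 1) with hv
      have hs : ∀ w : ℕ → ℂ, partialSum n E w m (l + 1 + 1) =
          partialSum n E w m (l + 1) + w (l + 1) • (u * v) := by
        intro w
        rw [partialSum, partialSum, sum_Ico_succ_top (by omega), add_assoc]
      -- The combination of `K` and `K'` without a term in `u * v` acts on `u` and `v` by opposite
      -- scalars, so it commutes with `u * v`.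
      have hc := hK.sub_smul hK' (w' (l + 1)) (w (l + 1))
      have hcw : w' (l + 1) * w (l + 1) - w (l + 1) * w' (l + 1) = 0 := by ring
      have h₁ := hr.lie_row_eq_smul hn hc (l := l + 1) (by omega) hcw m
      have h₂ := hr.lie_column_eq_smul hn hc (l := l + 1) (by omega) hcw m
      have hps : w' (l + 1) • K - w (l + 1) • K' -
          ħ • partialSum n E (fun k => w' (l + 1) * w k - w (l + 1) * w' k) m (l + 1) =
          w' (l + 1) • (K - ħ • partialSum n E w m (l + 1)) -
            w (l + 1) • (K' - ħ • partialSum n E w' m (l + 1)) := by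
        have : partialSum n E (fun k => w' (l + 1) * w k - w (l + 1) * w' k) m (l + 1) =
            w' (l + 1) • partialSum n E w m (l + 1) - w (l + 1) • partialSum n E w' m (l + 1) := by
          simp only [partialSum, smul_add, smul_sum, smul_smul, _root_.sub_smul, sum_sub_distrib]
          abel
        rw [this]
        module
      rw [hps, ← hv] at h₁
      rw [hps, ← hu] at h₂
      have h₃ : ⁅w' (l + 1) • (K - ħ • partialSum n E w m (l + 1)) -
          w (l + 1) • (K' - ħ • partialSum n E w' m (l + 1)), u * v⁆ = 0 := by
        rw [lie_mul_eq, h₁, h₂, neg_mul, smul_mul_assoc, mul_smul_comm, neg_add_cancel]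
      rw [hs, hs, smul_add, smul_add, ← sub_sub, ← sub_sub]
      generalize K - ħ • partialSum n E w m (l + 1) = A at *
      generalize K' - ħ • partialSum n E w' m (l + 1) = A' at *
      rw [sub_lie, smul_lie, smul_lie] at h₃
      simp only [sub_lie, lie_sub, smul_lie, lie_smul, lie_self, smul_zero, sub_zero, ih]
      rw [← lie_skew (u * v) A', sub_eq_zero.1 h₃]
      module
  induction m with
  | zero => simpa [partialSum] using hKK
  | succ m ih =>
    have h₁ : ∀ w : ℕ → ℂ, partialSum n E w (m + 1) 1 = partialSum n E w m (n + 1) := by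
      intro w
      rw [partialSum, partialSum, sum_range_succ, Ico_self, sum_empty, add_zero]
    rw [h₁, h₁]
    exact step m n ih le_rfl

end LoopRep

end AffineYangian

end

noncomputable section

/-! ### Brackets with the series `P_ij` -/

namespace AffineYangian

attribute [local instance] LieRing.ofAssociativeRing

open Steinberg MulOpposite

variable {R : Type*} [Ring R] [Algebra ℂ R] [TopologicalSpace R] [IsTopologicalRing R]

lemma hasSum_lie {ι : Type*} {f : ι → R} {a : R} (hf : HasSum f a) (y : R) :
    HasSum (fun s => ⁅f s, y⁆) ⁅a, y⁆ := by
  simp only [Ring.lie_def]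
  exact (hf.mul_right y).sub (hf.mul_left y)

lemma continuous_algebra_smul (c : ℂ) : Continuous fun y : R => c • y := by
  simp only [Algebra.smul_def]
  exact continuous_const_mul _

/-- A `LoopRep` in a topological algebra in which the series `P i j`, the sums of
`E_{i,n+1} t^(-s-1) E_{n+1,j} t^(s+1)`, converge. -/
structure SumRep (n : ℕ) (ħ κ : ℂ) (h : ℕ → Fin 2 → R) (x : ℤˣ → ℕ → Fin 2 → R)
    (E : ℤ → ℕ → ℕ → R) (P : ℕ → ℕ → R) : Prop extends LoopRep n ħ κ h x E where
  hasSum : ∀ i j, (1 ≤ i ∧ i ≤ n ∧ 1 ≤ j ∧ j ≤ n) → HasSum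
    (fun s : ℕ => E (-(s : ℤ) - 1) i (n + 1) * E ((s : ℤ) + 1) (n + 1) j) (P i j)

namespace SumRep

variable {n : ℕ} {ħ κ : ℂ} {h : ℕ → Fin 2 → R} {x : ℤˣ → ℕ → Fin 2 → R} {E : ℤ → ℕ → ℕ → R}
  {P : ℕ → ℕ → R}

lemma op (hr : SumRep n ħ κ h x E P) :
    SumRep n ħ κ (fun i r => op (h i r)) (fun σ i r => op (x (-σ) i r))
      (fun r i j => op (E (-r) j i)) fun i j => op (P j i) where
  toLoopRep := hr.toLoopRep.op
  hasSum i j hi := by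
    have h₁ := (hr.hasSum j i (by omega)).op
    have h₂ : ∀ s : ℤ, -(-s - 1) = s + 1 := fun s => by ring
    have h₃ : ∀ s : ℤ, -(s + 1) = -s - 1 := fun s => by ring
    simp only [h₂, h₃, ← op_mul]
    exact h₁

lemma term_lie (hr : SumRep n ħ κ h x E P) {i j k l : ℕ}
    (hi : 1 ≤ i ∧ i ≤ n ∧ 1 ≤ j ∧ j ≤ n ∧ 1 ≤ k ∧ k ≤ n ∧ 1 ≤ l ∧ l ≤ n ∧ k ≠ l) (s r : ℤ) :
    ⁅E (-s - 1) i (n + 1) * E (s + 1) (n + 1) j, E r k l⁆ =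
      (if j = k then E (-s - 1) i (n + 1) * E (s + 1 + r) (n + 1) l else 0) -
        (if i = l then E (-s - 1 + r) k (n + 1) * E (s + 1) (n + 1) j else 0) := by
  rw [mul_lie_eq, hr.prod (s + 1) r (n + 1) j k l (by omega),
    hr.prod (-s - 1) r i (n + 1) k l (by omega), if_neg (show n + 1 ≠ l by omega),
    if_neg (show n + 1 ≠ k by omega)]
  split_ifs <;> simp [sub_eq_add_neg]

variable [T2Space R]

lemma P_lie (hr : SumRep n ħ κ h x E P) {i j k l : ℕ}
    (hi : 1 ≤ i ∧ i ≤ n ∧ 1 ≤ j ∧ j ≤ n ∧ 1 ≤ k ∧ k ≤ n ∧ 1 ≤ l ∧ l ≤ n ∧ k ≠ l) :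
    ⁅P i j, E 0 k l⁆ = (if j = k then P i l else 0) - (if i = l then P k j else 0) := by
  have h₁ := hasSum_lie (hr.hasSum i j (by omega)) (E 0 k l)
  simp only [hr.term_lie hi, add_zero] at h₁
  refine h₁.unique (HasSum.sub ?_ ?_)
  · split_ifs
    · exact hr.hasSum i l (by omega)
    · exact hasSum_zero
  · split_ifs
    · exact hr.hasSum k j (by omega)
    · exact hasSum_zero

lemma P_lie_eq_zero (hr : SumRep n ħ κ h x E P) {i j k l : ℕ}
    (hi : 1 ≤ i ∧ i ≤ n ∧ 1 ≤ j ∧ j ≤ n ∧ 1 ≤ k ∧ k ≤ n ∧ 1 ≤ l ∧ l ≤ n ∧ k ≠ l ∧ j ≠ k ∧ i ≠ l)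
    (r : ℤ) : ⁅P i j, E r k l⁆ = 0 := by
  have h₁ := hasSum_lie (hr.hasSum i j (by omega)) (E r k l)
  simp only [hr.term_lie (i := i) (j := j) (k := k) (l := l) (by omega),
    if_neg (show j ≠ k by omega), if_neg (show i ≠ l by omega), sub_zero] at h₁
  exact h₁.unique hasSum_zero

/-- With `g s = E_{n,n+1} t^(-s) E_{n+1,1} t^(s+1)`, the terms of the two brackets are `-g s` and
`g (s + 1)`, so that their sum telescopes to `-g 0`. -/
lemma P_one_add_P_last_lie (hn : 3 ≤ n) (hr : SumRep n ħ κ h x E P) :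
    ⁅P 1 1 + P n n, E 1 n 1⁆ = -(E 0 n (n + 1) * E 1 (n + 1) 1) := by
  have h₁ := hasSum_lie (hr.hasSum 1 1 (by omega)) (E 1 n 1)
  have h₂ := hasSum_lie (hr.hasSum n n (by omega)) (E 1 n 1)
  simp only [hr.term_lie (i := 1) (j := 1) (k := n) (l := 1) (by omega),
    if_neg (show 1 ≠ n by omega), if_true, zero_sub] at h₁
  simp only [hr.term_lie (i := n) (j := n) (k := n) (l := 1) (by omega),
    if_neg (show n ≠ 1 by omega), if_true, sub_zero] at h₂
  let g : ℕ → R := fun s => E (-(s : ℤ)) n (n + 1) * E ((s : ℤ) + 1) (n + 1) 1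
  have hg : ∀ s : ℕ, E (-(s : ℤ) - 1) n (n + 1) * E ((s : ℤ) + 1 + 1) (n + 1) 1 = g (s + 1) := by
    intro s
    simp only [g]
    push_cast
    rw [show -((s : ℤ) + 1) = -s - 1 by ring]
  have h₃ := h₁.add h₂
  rw [← add_lie] at h₃
  have ht : Filter.Tendsto (fun s => g (s + 1)) Filter.atTop (𝓝 0) := by
    simpa only [hg] using h₂.summable.tendsto_atTop_zero
  have ht' : Filter.Tendsto g Filter.atTop (𝓝 0) := (Filter.tendsto_add_atTop_iff_nat 1).1 ht
  have h₄ : ∀ m, ∑ s ∈ Finset.range m,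
      (-(E (-(s : ℤ) - 1 + 1) n (n + 1) * E ((s : ℤ) + 1) (n + 1) 1) +
        E (-(s : ℤ) - 1) n (n + 1) * E ((s : ℤ) + 1 + 1) (n + 1) 1) = g m - g 0 := by
    intro m
    rw [← Finset.sum_range_sub]
    refine Finset.sum_congr rfl fun s _ => ?_
    rw [hg, sub_add_cancel, neg_add_eq_sub]
  have h₅ := h₃.tendsto_sum_nat
  simp only [h₄] at h₅
  rw [tendsto_nhds_unique h₅ (ht'.sub_const (g 0)), zero_sub]
  simp [g]

lemma P_one_lie_lie (hn : 3 ≤ n) (hr : SumRep n ħ κ h x E P) :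
    ⁅⁅P 1 1, E 1 n 1⁆, E 1 n 1⁆ = 0 := by
  have h₁ := hasSum_lie (hasSum_lie (hr.hasSum 1 1 (by omega)) (E 1 n 1)) (E 1 n 1)
  refine h₁.unique ?_
  convert hasSum_zero with s
  rw [hr.term_lie (i := 1) (j := 1) (k := n) (l := 1) (by omega), if_neg (by omega), if_pos rfl,
    zero_sub, neg_lie, mul_lie_eq, (hr.prod _ _).zero, (hr.prod _ _).zero]
  simp

/-- The weight of the root vector `E_kl` with respect to `E_aa - E_bb`. -/
def weight (a b k l : ℕ) : ℂ :=
  ((if k = a then 1 else 0) - (if l = a then 1 else 0)) -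
    ((if k = b then 1 else 0) - (if l = b then 1 else 0))

lemma lie_E (hn : 3 ≤ n) (hr : SumRep n ħ κ h x E P) {a b k l : ℕ}
    (ha : 1 ≤ a ∧ a ≤ n ∧ 1 ≤ b ∧ b ≤ n ∧ a ≠ b)
    (hk : 1 ≤ k ∧ k ≤ n + 1 ∧ 1 ≤ l ∧ l ≤ n + 1 ∧ k ≠ l) (r s : ℤ) :
    ⁅⁅E r a b, E (-r) b a⁆, E s k l⁆ = weight a b k l • E s k l := by
  rw [← lie_skew, lie_lie_opposite (by omega) hr.prod (by omega) (by omega), ← neg_smul,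
    show s + r + -r = s by ring, weight]
  congr 1
  ring

lemma lie_P (hn : 3 ≤ n) (hr : SumRep n ħ κ h x E P) {a b k l : ℕ}
    (ha : 1 ≤ a ∧ a ≤ n ∧ 1 ≤ b ∧ b ≤ n ∧ a ≠ b)
    (hk : 1 ≤ k ∧ k ≤ n ∧ 1 ≤ l ∧ l ≤ n) (r : ℤ) :
    ⁅⁅E r a b, E (-r) b a⁆, P k l⁆ = weight a b k l • P k l := by
  have h₁ := hasSum_lie (hr.hasSum k l hk) ⁅E r a b, E (-r) b a⁆
  have h₂ : ∀ s : ℕ, ⁅E (-(s : ℤ) - 1) k (n + 1) * E ((s : ℤ) + 1) (n + 1) l,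
      ⁅E r a b, E (-r) b a⁆⁆ =
      algebraMap ℂ R (-weight a b k l) *
        (E (-(s : ℤ) - 1) k (n + 1) * E ((s : ℤ) + 1) (n + 1) l) := by
    intro s
    rw [← lie_skew, lie_mul_eq, hr.lie_E hn (by omega) (by omega), hr.lie_E hn (by omega) (by omega),
      ← Algebra.smul_def, smul_mul_assoc, mul_smul_comm, ← add_smul, ← neg_smul]
    congr 2
    simp only [weight, if_neg (show n + 1 ≠ a by omega), if_neg (show n + 1 ≠ b by omega)]
    ring
  simp only [h₂] at h₁
  rw [← lie_skew, h₁.unique ((hr.hasSum k l hk).mul_left _), ← Algebra.smul_def, neg_smul, neg_neg]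

end SumRep

end AffineYangian

end

noncomputable section

/-! ### Reduction to one half of the relations -/

namespace AffineYangian

attribute [local instance] LieRing.ofAssociativeRing

open Steinberg MulOpposite

variable {R : Type*} [Ring R] [Algebra ℂ R]

/-- The relations of the affine Yangian without those for the generators `X^-` alone. -/
structure HalfRelations (n : ℕ) (ħ κ : ℂ) (h₀ h₁ e₀ e₁ f₀ f₁ : ℕ → R) : Prop where
  h0_h0 : ∀ i j, i < n → j < n → ⁅h₀ i, h₀ j⁆ = 0
  h0_h1 : ∀ i j, i < n → j < n → ⁅h₀ i, h₁ j⁆ = 0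
  h1_h1 : ∀ i j, i < n → j < n → ⁅h₁ i, h₁ j⁆ = 0
  e0_f0 : ∀ i j, i < n → j < n → ⁅e₀ i, f₀ j⁆ = if i = j then h₀ i else 0
  e1_f0 : ∀ i j, i < n → j < n → ⁅e₁ i, f₀ j⁆ = if i = j then h₁ i else 0
  e0_f1 : ∀ i j, i < n → j < n → ⁅e₀ i, f₁ j⁆ = if i = j then h₁ i else 0
  h0_e0 : ∀ i j, i < n → j < n → ⁅h₀ i, e₀ j⁆ = cartanNat n i j • e₀ j
  h0_e1 : ∀ i j, i < n → j < n → ⁅h₀ i, e₁ j⁆ = cartanNat n i j • e₁ j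
  ht_e0 : ∀ i j, i < n → j < n → ¬(i = 0 ∧ j + 1 = n) → ¬(j = 0 ∧ i + 1 = n) →
    ⁅h₁ i - (ħ / 2) • h₀ i ^ 2, e₀ j⁆ = cartanNat n i j • e₁ j
  ht_e0_zero_last : ∀ l, l + 1 = n →
    ⁅h₁ 0 - (ħ / 2) • h₀ 0 ^ 2, e₀ l⁆ = -(e₁ l + κ • e₀ l)
  ht_e0_last_zero : ∀ l, l + 1 = n →
    ⁅h₁ l - (ħ / 2) • h₀ l ^ 2, e₀ 0⁆ = -(e₁ 0 - κ • e₀ 0)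
  e_e : ∀ i j, i < n → j < n → ¬(i = 0 ∧ j + 1 = n) → ¬(j = 0 ∧ i + 1 = n) →
    ⁅e₁ i, e₀ j⁆ - ⁅e₀ i, e₁ j⁆ =
      (cartanNat n i j * (ħ / 2)) • (e₀ i * e₀ j + e₀ j * e₀ i)
  e_e_zero_last : ∀ l, l + 1 = n →
    ⁅e₁ 0, e₀ l⁆ - ⁅e₀ 0, e₁ l⁆ =
      -((ħ / 2) • (e₀ 0 * e₀ l + e₀ l * e₀ 0)) + κ • ⁅e₀ 0, e₀ l⁆
  serre_far : ∀ i j, i < n → j < n → i ≠ j → ¬Adjacent n i j → ⁅e₀ i, e₀ j⁆ = 0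
  serre : ∀ i j, i < n → j < n → i ≠ j → Adjacent n i j → ⁅e₀ i, ⁅e₀ i, e₀ j⁆⁆ = 0

/-- The relations of the generators `X^-` are those of the generators `X^+` in the opposite
algebra. -/
lemma HalfRelations.relations {n : ℕ} {ħ κ : ℂ} {h₀ h₁ e₀ e₁ f₀ f₁ : ℕ → R}
    (hr : HalfRelations n ħ κ h₀ h₁ e₀ e₁ f₀ f₁)
    (hr' : HalfRelations n ħ κ (fun i => op (h₀ i)) (fun i => op (h₁ i)) (fun i => op (f₀ i))
      (fun i => op (f₁ i)) (fun i => op (e₀ i)) fun i => op (e₁ i)) :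
    Relations n ħ κ (fun i => ![h₀ i, h₁ i])
      fun σ i => if σ = 1 then ![e₀ i, e₁ i] else ![f₀ i, f₁ i] := by
  have hs : ∀ σ : ℤˣ, σ = 1 ∨ σ = -1 := Int.units_eq_one_or
  have hne : ¬((-1 : ℤˣ) = 1) := by decide
  have hm : sgn (-1) = -1 := by rw [sgn_neg, sgn_one]
  constructor
  · intro i j r s hi hj
    fin_cases r <;> fin_cases s
    · exact hr.h0_h0 i j hi hj
    · exact hr.h0_h1 i j hi hj
    · change ⁅h₁ i, h₀ j⁆ = 0
      rw [← lie_skew, hr.h0_h1 j i hj hi, neg_zero]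
    · exact hr.h1_h1 i j hi hj
  · intro i j hi hj
    simpa [hne] using hr.e0_f0 i j hi hj
  · intro i j hi hj
    simpa [hne] using hr.e1_f0 i j hi hj
  · intro i j hi hj
    simpa [hne] using hr.e0_f1 i j hi hj
  · intro σ i j r hi hj
    rcases hs σ with rfl | rfl
    · fin_cases r
      · simpa [sgn_one] using hr.h0_e0 i j hi hj
      · simpa [sgn_one] using hr.h0_e1 i j hi hj
    · have k₀ := hr'.h0_e0 i j hi hj
      have k₁ := hr'.h0_e1 i j hi hj
      rw [op_lie_op, ← op_smul, op_inj, ← lie_skew, neg_eq_iff_eq_neg, ← neg_smul] at k₀ k₁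
      fin_cases r
      · simpa [hne, hm] using k₀
      · simpa [hne, hm] using k₁
  · intro σ i j hi hj h₁ h₂
    rcases hs σ with rfl | rfl
    · simpa [sgn_one] using hr.ht_e0 i j hi hj h₁ h₂
    · have k := hr'.ht_e0 i j hi hj h₁ h₂
      rw [← op_pow, ← op_smul, ← op_sub, op_lie_op, ← op_smul, op_inj, ← lie_skew,
        neg_eq_iff_eq_neg, ← neg_smul] at k
      simpa [hne, hm] using k
  · intro σ l hl
    rcases hs σ with rfl | rfl
    · simp only [if_true, sgn_one]
      rw [neg_smul, one_smul]
      exact hr.ht_e0_zero_last l hl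
    · have k := hr'.ht_e0_zero_last l hl
      rw [← op_pow, ← op_smul, ← op_sub, op_lie_op, ← op_smul, ← op_add, ← op_neg, op_inj,
        ← lie_skew, neg_inj] at k
      simpa [hne, hm] using k
  · intro σ l hl
    rcases hs σ with rfl | rfl
    · simpa [sgn_one] using hr.ht_e0_last_zero l hl
    · have k := hr'.ht_e0_last_zero l hl
      rw [← op_pow, ← op_smul, ← op_sub, op_lie_op, ← op_smul, ← op_sub, ← op_neg, op_inj,
        ← lie_skew, neg_inj] at k
      simpa [hne, hm] using k
  · intro σ i j hi hj h₁ h₂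
    rcases hs σ with rfl | rfl
    · simpa [sgn_one] using hr.e_e i j hi hj h₁ h₂
    · have k := hr'.e_e i j hi hj h₁ h₂
      rw [op_lie_op, op_lie_op, ← op_mul, ← op_mul, ← op_add, ← op_smul, ← op_sub, op_inj,
        ← lie_skew, ← lie_skew (f₁ j), ← neg_sub', neg_eq_iff_eq_neg, ← neg_smul,
        add_comm (f₀ j * _)] at k
      simp only [hne, hm, if_false]
      rw [neg_one_mul, neg_mul]
      exact k
  · intro σ l hl
    rcases hs σ with rfl | rfl
    · have k := hr.e_e_zero_last l hl
      simp only [if_true, sgn_one]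
      rw [neg_one_mul, neg_smul]
      exact k
    · have k := hr'.e_e_zero_last l hl
      rw [op_lie_op, op_lie_op, op_lie_op, ← op_mul, ← op_mul, ← op_add, ← op_smul, ← op_sub,
        ← op_smul, ← op_neg, ← op_add, op_inj, ← lie_skew (f₀ l) (f₁ 0),
        ← lie_skew (f₁ l) (f₀ 0), ← lie_skew (f₀ l) (f₀ 0), ← neg_sub', neg_eq_iff_eq_neg, neg_add, neg_neg, smul_neg,
        neg_neg, add_comm (f₀ l * _)] at k
      simp only [hne, hm, if_false, neg_neg, one_mul]
      exact k
  · intro σ i j hi hj hij ha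
    rcases hs σ with rfl | rfl
    · simpa using hr.serre_far i j hi hj hij ha
    · have k := hr'.serre_far i j hi hj hij ha
      rw [op_lie_op, ← op_zero, op_inj, ← lie_skew, neg_eq_zero] at k
      simpa [hne] using k
  · intro σ i j hi hj hij ha
    rcases hs σ with rfl | rfl
    · simpa using hr.serre i j hi hj hij ha
    · have k := hr'.serre i j hi hj hij ha
      rw [op_lie_op, op_lie_op, ← op_zero, op_inj, ← lie_skew ⁅f₀ j, f₀ i⁆ (f₀ i),
        ← lie_skew (f₀ j) (f₀ i), lie_neg, neg_neg] at k
      simpa [hne] using k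

end AffineYangian

end

noncomputable section

/-! ### The images of the generators -/

namespace AffineYangian

attribute [local instance] LieRing.ofAssociativeRing

open Steinberg MulOpposite

section Nodes

/-- The node `i` of the smaller diagram corresponds to the root vector with labels
`src n i`, `i + 1`. -/
def src (n i : ℕ) : ℕ := if i = 0 then n else i

/-- The power of `t` in the root vector of the node `i`. -/
def wind (i : ℕ) : ℤ := if i = 0 then 1 else 0

lemma src_bounds {n i : ℕ} (hi : i < n) (hn : 3 ≤ n) :
    1 ≤ src n i ∧ src n i ≤ n ∧ 1 ≤ i + 1 ∧ i + 1 ≤ n ∧ src n i ≠ i + 1 := by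
  rw [src]
  split_ifs <;> omega

lemma weight_self {a b k : ℕ} : SumRep.weight a b k k = 0 := by simp [SumRep.weight]

lemma weight_src {n i j : ℕ} (hn : 3 ≤ n) (hi : i < n) (hj : j < n) :
    SumRep.weight (src n i) (i + 1) (src n j) (j + 1) = cartanNat n i j := by
  simp only [SumRep.weight, src, cartanNat, Adjacent]
  split_ifs <;> first | omega | norm_num

lemma cartanNat_succ {n i j : ℕ} (hi : 1 ≤ i ∧ i < n) (hj : 1 ≤ j ∧ j < n) :
    cartanNat (n + 1) i j = cartanNat n i j := by
  simp only [cartanNat, Adjacent]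
  split_ifs <;> first | omega | rfl

lemma cartanNat_zero_add_last {n j : ℕ} (hn : 3 ≤ n) (hj : 1 ≤ j ∧ j < n) :
    cartanNat (n + 1) 0 j + cartanNat (n + 1) n j = cartanNat n 0 j := by
  simp only [cartanNat, Adjacent]
  split_ifs <;> try simp only [false_or, true_and, and_true] at *
  all_goals first | omega | norm_num

lemma cartanNat_comm (n i j : ℕ) : cartanNat n i j = cartanNat n j i := by
  simp only [cartanNat, Adjacent]
  split_ifs <;> first | omega | rfl

/-- The diagonal matrix `E_ii - E_{i+1,i+1}`. -/
def diagWeight (i k : ℕ) : ℂ := if k = i then 1 else if k = i + 1 then -1 else 0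

lemma diagWeight_sub {n i j : ℕ} (hi : 1 ≤ i ∧ i < n) :
    diagWeight i j - diagWeight i (j + 1) = cartanNat (n + 1) i j := by
  simp only [diagWeight, cartanNat, Adjacent]
  split_ifs <;> first | omega | norm_num

lemma sum_diagWeight {n i : ℕ} (hi : 1 ≤ i ∧ i < n) {V : Type*} [AddCommGroup V] [Module ℂ V]
    (g : ℕ → V) : ∑ k ∈ Finset.Ico 1 (n + 1), diagWeight i k • g k = g i - g (i + 1) := by
  rw [← Finset.sum_Ico_consecutive _ hi.1 (show i ≤ n + 1 by omega),
    Finset.sum_eq_sum_Ico_succ_bot (a := i) (by omega),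
    Finset.sum_eq_sum_Ico_succ_bot (a := i + 1) (by omega), Finset.sum_eq_zero,
    Finset.sum_eq_zero]
  · simp [diagWeight, sub_eq_add_neg]
  · intro k hk
    rw [Finset.mem_Ico] at hk
    rw [diagWeight, if_neg (by omega), if_neg (by omega), zero_smul]
  · intro k hk
    rw [Finset.mem_Ico] at hk
    rw [diagWeight, if_neg (by omega), if_neg (by omega), zero_smul]

end Nodes

variable {R : Type*} [Ring R] [Algebra ℂ R]

section Images

variable (n : ℕ) (ħ : ℂ) (h : ℕ → Fin 2 → R) (x : ℤˣ → ℕ → Fin 2 → R) (E : ℤ → ℕ → ℕ → R)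
  (P : ℕ → ℕ → R)

/-- The image of `X^+_{i,0}`. -/
def rootE (i : ℕ) : R := E (wind i) (src n i) (i + 1)

/-- The image of `X^-_{i,0}`. -/
def rootF (i : ℕ) : R := E (-wind i) (i + 1) (src n i)

/-- The image of `H_{i,0}`. -/
def imH₀ (i : ℕ) : R := if i = 0 then h 0 0 + h n 0 else h i 0

/-- The image of `H̃_{i,1}` for `i ≠ 0`. -/
def imHt (i : ℕ) : R := h i 1 - ħ • P i i + ħ • P (i + 1) (i + 1) - (ħ / 2) • h i 0 ^ 2

/-- The image of `X^+_{i,1}`; for `i = 0` it is forced by the action of `H̃_{1,1}`. -/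
def imE₁ (i : ℕ) : R :=
  if i = 0 then -⁅imHt ħ h P 1, rootE n E 0⁆ else x 1 i 1 - ħ • P i (i + 1)

/-- The image of `X^-_{i,1}`; for `i = 0` it is forced by the action of `H̃_{1,1}`. -/
def imF₁ (i : ℕ) : R :=
  if i = 0 then ⁅imHt ħ h P 1, rootF n E 0⁆ else x (-1) i 1 - ħ • P (i + 1) i

/-- The image of `H_{i,1}`; for `i = 0` it is forced by the other images. -/
def imH₁ (i : ℕ) : R :=
  if i = 0 then ⁅imE₁ n ħ h x E P 0, rootF n E 0⁆ else
    h i 1 - ħ • P i i + ħ • P (i + 1) (i + 1)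

variable {n ħ h x E P}

lemma rootE_zero : rootE n E 0 = E 1 n 1 := rfl

lemma rootE_of_pos {i : ℕ} (hi : 1 ≤ i) : rootE n E i = E 0 i (i + 1) := by
  rw [rootE, wind, src, if_neg (by omega), if_neg (by omega)]

lemma rootF_zero : rootF n E 0 = E (-1) 1 n := rfl

lemma rootF_of_pos {i : ℕ} (hi : 1 ≤ i) : rootF n E i = E 0 (i + 1) i := by
  rw [rootF, wind, src, if_neg (by omega), if_neg (by omega), neg_zero]

lemma imH₀_zero : imH₀ n h 0 = h 0 0 + h n 0 := rfl

lemma imH₀_of_pos {i : ℕ} (hi : 1 ≤ i) : imH₀ n h i = h i 0 := if_neg (by omega)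

lemma imHt_eq (i : ℕ) : imHt ħ h P i =
    (h i 1 - (ħ / 2) • h i 0 ^ 2) - ħ • (P i i - P (i + 1) (i + 1)) := by
  rw [imHt, smul_sub]
  abel

lemma imE₁_zero : imE₁ n ħ h x E P 0 = -⁅imHt ħ h P 1, rootE n E 0⁆ := if_pos rfl

lemma imE₁_of_pos {i : ℕ} (hi : 1 ≤ i) :
    imE₁ n ħ h x E P i = x 1 i 1 - ħ • P i (i + 1) := if_neg (by omega)

lemma imF₁_zero : imF₁ n ħ h x E P 0 = ⁅imHt ħ h P 1, rootF n E 0⁆ := if_pos rfl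

lemma imF₁_of_pos {i : ℕ} (hi : 1 ≤ i) :
    imF₁ n ħ h x E P i = x (-1) i 1 - ħ • P (i + 1) i := if_neg (by omega)

lemma imH₁_zero : imH₁ n ħ h x E P 0 = ⁅imE₁ n ħ h x E P 0, rootF n E 0⁆ := if_pos rfl

lemma imH₁_of_pos {i : ℕ} (hi : 1 ≤ i) :
    imH₁ n ħ h x E P i = h i 1 - ħ • P i i + ħ • P (i + 1) (i + 1) := if_neg (by omega)

lemma imHt_eq_imH₁ {i : ℕ} (hi : 1 ≤ i) :
    imH₁ n ħ h x E P i - (ħ / 2) • imH₀ n h i ^ 2 = imHt ħ h P i := by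
  rw [imH₁_of_pos hi, imH₀_of_pos hi, imHt]

lemma op_rootF (i : ℕ) : rootE n (fun r i j => op (E (-r) j i)) i = op (rootF n E i) := rfl

lemma op_rootE (i : ℕ) : rootF n (fun r i j => op (E (-r) j i)) i = op (rootE n E i) := by
  rw [rootF, rootE, neg_neg]

lemma op_imH₀ (i : ℕ) : imH₀ n (fun i r => op (h i r)) i = op (imH₀ n h i) := by
  rw [imH₀, imH₀]
  split_ifs <;> simp

lemma op_imHt (i : ℕ) : imHt ħ (fun i r => op (h i r)) (fun i j => op (P j i)) i =
    op (imHt ħ h P i) := by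
  simp [imHt]

lemma op_imF₁ (i : ℕ) : imE₁ n ħ (fun i r => op (h i r)) (fun σ i r => op (x (-σ) i r))
    (fun r i j => op (E (-r) j i)) (fun i j => op (P j i)) i = op (imF₁ n ħ h x E P i) := by
  rw [imE₁, imF₁, op_imHt, op_rootF, op_lie_op, ← lie_skew, op_neg, neg_neg]
  split_ifs <;> simp

lemma op_imE₁ (i : ℕ) : imF₁ n ħ (fun i r => op (h i r)) (fun σ i r => op (x (-σ) i r))
    (fun r i j => op (E (-r) j i)) (fun i j => op (P j i)) i = op (imE₁ n ħ h x E P i) := by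
  rw [imE₁, imF₁, op_imHt, op_rootE, op_lie_op, ← lie_skew]
  split_ifs <;> simp

end Images

lemma lie_ht_eq_zero {ħ : ℂ} {a b c : R} (hb : ⁅a, b⁆ = 0) (hc : ⁅a, c⁆ = 0) :
    ⁅a, b - (ħ / 2) • c ^ 2⁆ = 0 := by
  rw [lie_sub, hb, lie_smul, pow_two, lie_mul_eq, hc, mul_zero, zero_mul, add_zero, smul_zero,
    sub_zero]

namespace SumRep

variable {n : ℕ} {ħ κ : ℂ} {h : ℕ → Fin 2 → R} {x : ℤˣ → ℕ → Fin 2 → R} {E : ℤ → ℕ → ℕ → R}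
  {P : ℕ → ℕ → R} [TopologicalSpace R] [IsTopologicalRing R] [T2Space R]

lemma rootE_lie_rootF_self (hn : 3 ≤ n) (hr : SumRep n ħ κ h x E P) {i : ℕ} (hi : i < n) :
    ⁅rootE n E i, rootF n E i⁆ = imH₀ n h i := by
  rcases Nat.eq_zero_or_pos i with rfl | h0
  · have h₁ := hr.rel.x0_x0 0 0 (by omega) (by omega)
    have h₂ := hr.rel.x0_x0 n n (by omega) (by omega)
    rw [if_pos rfl, hr.e₀, hr.f₀] at h₁
    rw [if_pos rfl, hr.e n (by omega) le_rfl, hr.f n (by omega) le_rfl] at h₂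
    rw [rootE_zero, rootF_zero, imH₀_zero, ← h₁, ← h₂, lie_opposite_eq (by omega) hr.prod (by omega),
      lie_opposite_eq (by omega) hr.prod (by omega), lie_opposite_eq (by omega) hr.prod (by omega),
      add_neg_cancel, add_zero, if_pos rfl, if_pos rfl, Int.cast_zero, zero_smul, add_zero]
    abel
  · have h₁ := hr.rel.x0_x0 i i (by omega) (by omega)
    rw [if_pos rfl, hr.e i h0 hi.le, hr.f i h0 hi.le] at h₁
    rw [rootE_of_pos h0, rootF_of_pos h0, imH₀_of_pos h0, h₁]

lemma imH₀_lie_rootE (hn : 3 ≤ n) (hr : SumRep n ħ κ h x E P) {i j : ℕ} (hi : i < n)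
    (hj : j < n) : ⁅imH₀ n h i, rootE n E j⁆ = cartanNat n i j • rootE n E j := by
  have hb := src_bounds hi hn
  have hb' := src_bounds hj hn
  rw [← hr.rootE_lie_rootF_self hn hi, rootE, rootF, rootE, hr.lie_E hn hb (by omega),
    weight_src hn hi hj]

lemma imH₀_lie_P (hn : 3 ≤ n) (hr : SumRep n ħ κ h x E P) {i k l : ℕ} (hi : i < n)
    (hk : 1 ≤ k ∧ k ≤ n ∧ 1 ≤ l ∧ l ≤ n) :
    ⁅imH₀ n h i, P k l⁆ = weight (src n i) (i + 1) k l • P k l := by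
  rw [← hr.rootE_lie_rootF_self hn hi, rootE, rootF, hr.lie_P hn (src_bounds hi hn) hk]

lemma imH₀_lie_h (hr : SumRep n ħ κ h x E P) {i j : ℕ} (hi : i < n)
    (hj : j ≤ n) (r : Fin 2) : ⁅imH₀ n h i, h j r⁆ = 0 := by
  rw [imH₀]
  split_ifs with h0
  · rw [add_lie, hr.rel.h_h _ _ _ _ (by omega) (by omega), hr.rel.h_h _ _ _ _ (by omega) (by omega),
      add_zero]
  · rw [hr.rel.h_h _ _ _ _ (by omega) (by omega)]

lemma imH₀_lie_imH₀ (hr : SumRep n ħ κ h x E P) {i j : ℕ} (hi : i < n) (hj : j < n) :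
    ⁅imH₀ n h i, imH₀ n h j⁆ = 0 := by
  rcases Nat.eq_zero_or_pos j with rfl | h0
  · rw [imH₀_zero, lie_add, hr.imH₀_lie_h hi (by omega), hr.imH₀_lie_h hi (by omega), add_zero]
  · rw [imH₀_of_pos h0, hr.imH₀_lie_h hi hj.le]

lemma imH₀_lie_imH₁_of_pos (hn : 3 ≤ n) (hr : SumRep n ħ κ h x E P) {i j : ℕ} (hi : i < n)
    (hj : 1 ≤ j ∧ j < n) : ⁅imH₀ n h i, imH₁ n ħ h x E P j⁆ = 0 := by
  rw [imH₁_of_pos hj.1, lie_add, lie_sub, lie_smul, lie_smul, hr.imH₀_lie_h hi (by omega),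
    hr.imH₀_lie_P hn hi (by omega), hr.imH₀_lie_P hn hi (by omega), weight_self, weight_self]
  simp

lemma imH₀_lie_imHt (hn : 3 ≤ n) (hr : SumRep n ħ κ h x E P) {i j : ℕ} (hi : i < n)
    (hj : 1 ≤ j ∧ j < n) : ⁅imH₀ n h i, imHt ħ h P j⁆ = 0 := by
  rw [← imHt_eq_imH₁ (n := n) (x := x) (E := E) hj.1]
  exact lie_ht_eq_zero (hr.imH₀_lie_imH₁_of_pos hn hi hj) (hr.imH₀_lie_imH₀ hi hj.2)

lemma imH₀_lie_imE₁ (hn : 3 ≤ n) (hr : SumRep n ħ κ h x E P) {i j : ℕ} (hi : i < n)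
    (hj : j < n) : ⁅imH₀ n h i, imE₁ n ħ h x E P j⁆ = cartanNat n i j • imE₁ n ħ h x E P j := by
  rcases Nat.eq_zero_or_pos j with rfl | h0
  · rw [imE₁_zero, lie_neg, leibniz_lie, hr.imH₀_lie_imHt hn hi (by omega), zero_lie, zero_add,
      hr.imH₀_lie_rootE hn hi hj, lie_smul, smul_neg]
  · have h₁ : ⁅imH₀ n h i, x 1 j 1⁆ = cartanNat n i j • x 1 j 1 := by
      rcases Nat.eq_zero_or_pos i with rfl | hi0
      · rw [imH₀_zero, add_lie, hr.rel.h0_x _ _ _ _ (by omega) (by omega),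
          hr.rel.h0_x _ _ _ _ (by omega) (by omega), sgn_one, one_mul, one_mul, ← add_smul,
          cartanNat_zero_add_last hn (by omega)]
      · rw [imH₀_of_pos hi0, hr.rel.h0_x _ _ _ _ (by omega) (by omega), sgn_one, one_mul,
          cartanNat_succ (by omega) (by omega)]
    have h₂ := weight_src hn hi hj
    rw [show src n j = j from if_neg (by omega)] at h₂
    rw [imE₁_of_pos h0, lie_sub, lie_smul, h₁, hr.imH₀_lie_P hn hi (by omega), h₂, smul_sub,
      smul_comm ħ]

lemma imHt_lie_rootE (hr : SumRep n ħ κ h x E P) {i j : ℕ} (hi : 1 ≤ i ∧ i < n)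
    (hj : 1 ≤ j ∧ j < n) :
    ⁅imHt ħ h P i, rootE n E j⁆ = cartanNat n i j • imE₁ n ħ h x E P j := by
  have h₁ : ⁅P i i - P (i + 1) (i + 1), E 0 j (j + 1)⁆ = cartanNat n i j • P j (j + 1) := by
    rw [sub_lie, hr.P_lie (by omega), hr.P_lie (by omega)]
    by_cases hij : i = j
    · subst hij
      simp [cartanNat_self, two_smul]
    by_cases hij' : i = j + 1
    · subst hij'
      rw [cartanNat_of_adjacent (by omega) (by omega)]
      simp [show j + 1 + 1 ≠ j by omega]
    by_cases hij'' : j = i + 1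
    · subst hij''
      rw [cartanNat_of_adjacent (by omega) (by omega)]
      simp [show i ≠ i + 1 + 1 by omega]
    · rw [cartanNat, if_neg hij, if_neg (by omega), if_neg (by omega), if_neg (by omega),
        if_neg (by omega), if_neg (by omega)]
      simp
  have h₂ := hr.rel.ht_x 1 i j (by omega) (by omega) (by omega) (by omega)
  rw [sgn_one, one_mul, hr.e j hj.1 hj.2.le, cartanNat_succ hi hj] at h₂
  rw [rootE_of_pos hj.1, imHt_eq, sub_lie, h₂, smul_lie, h₁, imE₁_of_pos hj.1, smul_sub,
    smul_comm ħ]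

lemma imHt_lie_rootF (hr : SumRep n ħ κ h x E P) {i j : ℕ} (hi : 1 ≤ i ∧ i < n)
    (hj : 1 ≤ j ∧ j < n) :
    ⁅imHt ħ h P i, rootF n E j⁆ = -(cartanNat n i j • imF₁ n ħ h x E P j) := by
  have h₁ := hr.op.imHt_lie_rootE hi hj
  rw [op_imHt, op_rootF, op_imF₁, op_lie_op, ← op_smul, op_inj, ← lie_skew,
    neg_eq_iff_eq_neg] at h₁
  exact h₁

lemma rootE_lie_rootF (hn : 3 ≤ n) (hr : SumRep n ħ κ h x E P) {i j : ℕ} (hi : i < n)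
    (hj : j < n) : ⁅rootE n E i, rootF n E j⁆ = if i = j then imH₀ n h i else 0 := by
  split_ifs with hij
  · subst hij
    exact hr.rootE_lie_rootF_self hn hi
  · have hb := src_bounds hi hn
    have hb' := src_bounds hj hn
    have : src n i ≠ src n j := by
      simp only [src]
      split_ifs <;> omega
    rw [rootE, rootF, (hr.prod _ _).zero (i := src n i) (j := i + 1) (k := j + 1) (l := src n j)
      (by omega)]

lemma imE₁_lie_rootF_of_pos (hr : SumRep n ħ κ h x E P) {i j : ℕ} (hi : 1 ≤ i ∧ i < n)
    (hj : 1 ≤ j ∧ j < n) :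
    ⁅imE₁ n ħ h x E P i, rootF n E j⁆ = if i = j then imH₁ n ħ h x E P i else 0 := by
  have h₁ := hr.rel.x1_x0 i j (by omega) (by omega)
  rw [hr.f j hj.1 hj.2.le] at h₁
  rw [imE₁_of_pos hi.1, rootF_of_pos hj.1, sub_lie, smul_lie, hr.P_lie (by omega), h₁]
  by_cases hij : i = j
  · subst hij
    rw [if_pos rfl, if_pos rfl, if_pos rfl, if_pos rfl, imH₁_of_pos hi.1, smul_sub]
    abel
  · rw [if_neg hij, if_neg (by omega), if_neg hij, if_neg hij]
    simp

lemma imE₁_lie_rootF_zero (hn : 3 ≤ n) (hr : SumRep n ħ κ h x E P) {i : ℕ}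
    (hi : 1 ≤ i ∧ i < n) : ⁅imE₁ n ħ h x E P i, rootF n E 0⁆ = 0 := by
  have h₁ : E (-1) 1 n = ⁅x (-1) 0 0, x (-1) n 0⁆ := by
    rw [hr.f₀, hr.f n (by omega) le_rfl, (hr.prod (-1) 0).mul, add_zero]
  have h₂ : ⁅x 1 i 1, E (-1) 1 n⁆ = 0 := by
    rw [h₁, leibniz_lie, hr.rel.x1_x0 i 0 (by omega) (by omega), if_neg (by omega),
      hr.rel.x1_x0 i n (by omega) (by omega), if_neg (by omega), zero_lie, lie_zero, add_zero]
  rw [imE₁_of_pos hi.1, rootF_zero, sub_lie, h₂, smul_lie, hr.P_lie_eq_zero (by omega), smul_zero,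
    sub_zero]

lemma rootE_zero_lie_imF₁ (hn : 3 ≤ n) (hr : SumRep n ħ κ h x E P) {i : ℕ}
    (hi : 1 ≤ i ∧ i < n) : ⁅rootE n E 0, imF₁ n ħ h x E P i⁆ = 0 := by
  have h₁ := hr.op.imE₁_lie_rootF_zero hn hi
  rwa [op_imF₁, op_rootE, op_lie_op, ← op_zero, op_inj] at h₁

lemma imE₁_zero_lie_rootF (hn : 3 ≤ n) (hr : SumRep n ħ κ h x E P) {j : ℕ}
    (hj : 1 ≤ j ∧ j < n) : ⁅imE₁ n ħ h x E P 0, rootF n E j⁆ = 0 := by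
  rw [imE₁_zero, neg_lie, lie_lie, hr.rootE_lie_rootF hn (by omega) hj.2, if_neg (by omega),
    lie_zero, hr.imHt_lie_rootF (by omega) hj, lie_neg, lie_smul,
    hr.rootE_zero_lie_imF₁ hn hj]
  simp

lemma rootE_zero_lie_imF₁_zero (hn : 3 ≤ n) (hr : SumRep n ħ κ h x E P) :
    ⁅rootE n E 0, imF₁ n ħ h x E P 0⁆ = imH₁ n ħ h x E P 0 := by
  have h₁ := hr.imH₀_lie_imHt hn (i := 0) (j := 1) (by omega) (by omega)
  rw [← hr.rootE_lie_rootF_self hn (by omega), ← lie_skew, leibniz_lie, ← imF₁_zero (x := x),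
    neg_eq_zero, add_eq_zero_iff_neg_eq] at h₁
  rw [← h₁, imH₁_zero, imE₁_zero, neg_lie]

lemma op_imH₁ (hn : 3 ≤ n) (hr : SumRep n ħ κ h x E P) (i : ℕ) :
    imH₁ n ħ (fun i r => MulOpposite.op (h i r)) (fun σ i r => MulOpposite.op (x (-σ) i r))
      (fun r i j => MulOpposite.op (E (-r) j i)) (fun i j => MulOpposite.op (P j i)) i =
      MulOpposite.op (imH₁ n ħ h x E P i) := by
  rcases Nat.eq_zero_or_pos i with rfl | h0
  · rw [imH₁_zero, op_imF₁, op_rootE, op_lie_op, hr.rootE_zero_lie_imF₁_zero hn]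
  · rw [imH₁_of_pos h0, imH₁_of_pos h0]
    simp

lemma imE₁_lie_rootF (hn : 3 ≤ n) (hr : SumRep n ħ κ h x E P) {i j : ℕ} (hi : i < n)
    (hj : j < n) :
    ⁅imE₁ n ħ h x E P i, rootF n E j⁆ = if i = j then imH₁ n ħ h x E P i else 0 := by
  rcases Nat.eq_zero_or_pos i with rfl | hi0 <;> rcases Nat.eq_zero_or_pos j with rfl | hj0
  · rw [if_pos rfl, imH₁_zero]
  · rw [if_neg (by omega), hr.imE₁_zero_lie_rootF hn ⟨hj0, hj⟩]
  · rw [if_neg (by omega), hr.imE₁_lie_rootF_zero hn ⟨hi0, hi⟩]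
  · exact hr.imE₁_lie_rootF_of_pos ⟨hi0, hi⟩ ⟨hj0, hj⟩

lemma rootE_lie_imF₁ (hn : 3 ≤ n) (hr : SumRep n ħ κ h x E P) {i j : ℕ} (hi : i < n)
    (hj : j < n) :
    ⁅rootE n E i, imF₁ n ħ h x E P j⁆ = if i = j then imH₁ n ħ h x E P i else 0 := by
  have h₁ := hr.op.imE₁_lie_rootF hn hj hi
  rw [op_imF₁, op_rootE, op_lie_op, hr.op_imH₁ hn] at h₁
  split_ifs at h₁ ⊢ with h₂ h₃ h₃
  · subst h₂
    exact op_injective h₁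
  · omega
  · omega
  · exact op_injective h₁

lemma imH₀_lie_imH₁ (hn : 3 ≤ n) (hr : SumRep n ħ κ h x E P) {i j : ℕ} (hi : i < n)
    (hj : j < n) : ⁅imH₀ n h i, imH₁ n ħ h x E P j⁆ = 0 := by
  rcases Nat.eq_zero_or_pos j with rfl | h0
  · have h₁ := hr.op.imH₀_lie_rootE hn hi hj
    rw [op_imH₀, op_rootF, op_lie_op, ← op_smul, op_inj, ← lie_skew, neg_eq_iff_eq_neg] at h₁
    rw [imH₁_zero, leibniz_lie, hr.imH₀_lie_imE₁ hn hi hj, h₁, smul_lie, lie_neg, lie_smul,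
      add_neg_cancel]
  · exact hr.imH₀_lie_imH₁_of_pos hn hi ⟨h0, hj⟩

open Filter in
lemma imHt_lie_imHt (hn : 3 ≤ n) (hr : SumRep n ħ κ h x E P) {i j : ℕ} (hi : 1 ≤ i ∧ i < n)
    (hj : 1 ≤ j ∧ j < n) : ⁅imHt ħ h P i, imHt ħ h P j⁆ = 0 := by
  have hd : ∀ i, 1 ≤ i ∧ i < n →
      IsDiagonal n x (diagWeight i) (h i 1 - (ħ / 2) • h i 0 ^ 2) := fun i hi =>
    { zero := by rw [diagWeight, if_neg (by omega), if_neg (by omega)]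
      last := by rw [diagWeight, if_neg (by omega), if_neg (by omega)]
      sum := by simpa using sum_diagWeight hi (fun _ => (1 : ℂ))
      lie := fun σ j hj => by
        rw [hr.rel.ht_x σ i j (by omega) (by omega) (by omega) (by omega),
          diagWeight_sub hi] }
  have ht : ∀ i, 1 ≤ i ∧ i < n → Tendsto (fun m => (h i 1 - (ħ / 2) • h i 0 ^ 2) -
      ħ • LoopRep.partialSum n E (diagWeight i) m 1) atTop (𝓝 (imHt ħ h P i)) := by
    intro i hi
    have h₁ := ((hr.hasSum i i (by omega)).sub
      (hr.hasSum (i + 1) (i + 1) (by omega))).tendsto_sum_nat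
    rw [imHt_eq]
    refine tendsto_const_nhds.sub (((continuous_algebra_smul ħ).tendsto _).comp ?_)
    convert h₁ using 2 with m
    rw [LoopRep.partialSum, Finset.Ico_self, Finset.sum_empty, add_zero]
    exact Finset.sum_congr rfl fun s _ => sum_diagWeight hi fun k =>
      E (-(s : ℤ) - 1) k (n + 1) * E ((s : ℤ) + 1) (n + 1) k
  have hc : ⁅h i 1 - (ħ / 2) • h i 0 ^ 2, h j 1 - (ħ / 2) • h j 0 ^ 2⁆ = 0 := by
    have key : ∀ r, ⁅h j r, h i 1 - (ħ / 2) • h i 0 ^ 2⁆ = 0 := fun r =>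
      lie_ht_eq_zero (hr.rel.h_h _ _ _ _ (by omega) (by omega))
        (hr.rel.h_h _ _ _ _ (by omega) (by omega))
    refine lie_ht_eq_zero ?_ ?_ <;> rw [← lie_skew, key, neg_zero]
  have h₂ := fun m => hr.lie_partialSum hn (hd i hi) (hd j hj) hc m
  have h₃ := ((ht i hi).mul (ht j hj)).sub ((ht j hj).mul (ht i hi))
  simp only [Ring.lie_def] at h₂ ⊢
  simp only [h₂] at h₃
  exact (tendsto_nhds_unique tendsto_const_nhds h₃).symm

end SumRep

end AffineYangian

end

noncomputable section

/-! ### Relations between the images of `X^+_{i,1}` and `X^+_{j,0}` -/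

namespace AffineYangian

attribute [local instance] LieRing.ofAssociativeRing

open Steinberg MulOpposite

variable {R : Type*} [Ring R] [Algebra ℂ R]

/-- The action of `H̃_0 = [X^+_{0,1}, X^-_{0,0}] - c H_0²` on a root vector that commutes with
`X^-_{0,0}` follows from the relation between `X^+_{0,1}` and this root vector. -/
lemma lie_ht_of_lie {c d a : ℂ} {e₀ e₁ f₀ h y y₁ : R} (hy : ⁅f₀, y⁆ = 0) (hy₁ : ⁅f₀, y₁⁆ = 0)
    (h₀ : ⁅e₀, f₀⁆ = h) (ha : ⁅h, y⁆ = a • y) (ha₁ : ⁅h, y₁⁆ = a • y₁)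
    (he : ⁅e₁, y⁆ - ⁅e₀, y₁⁆ = (a * c) • (e₀ * y + y * e₀) + d • ⁅e₀, y⁆) :
    ⁅⁅e₁, f₀⁆ - c • h ^ 2, y⁆ = a • y₁ + (d * a) • y := by
  have h₁ : ⁅f₀, e₀⁆ = -h := by rw [← lie_skew, h₀]
  have h₂ : ⁅⁅e₁, f₀⁆, y⁆ = -⁅f₀, ⁅e₁, y⁆⁆ := by rw [lie_lie, hy, lie_zero, zero_sub]
  rw [sub_lie, smul_lie, pow_two, mul_lie_eq, ha, h₂, sub_eq_iff_eq_add.1 he, lie_add, lie_add,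
    lie_smul, lie_smul, lie_add, lie_mul_eq, lie_mul_eq, leibniz_lie f₀ e₀ y₁,
    leibniz_lie f₀ e₀ y, hy, hy₁, h₁, neg_lie, neg_lie, ha, ha₁, mul_smul_comm, smul_mul_assoc]
  simp only [lie_zero, mul_zero, zero_mul, add_zero, zero_add, neg_mul, mul_neg]
  module

lemma lie_ht_self {c : ℂ} {e₀ e₁ f₀ h : R} (h₀ : ⁅e₀, f₀⁆ = h) (he₀ : ⁅h, e₀⁆ = (2 : ℂ) • e₀)
    (he₁ : ⁅h, e₁⁆ = (2 : ℂ) • e₁) (he : ⁅e₁, e₀⁆ = (2 * c) • (e₀ * e₀)) :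
    ⁅⁅e₁, f₀⁆ - c • h ^ 2, e₀⁆ = (2 : ℂ) • e₁ := by
  have h₁ : ⁅f₀, e₀⁆ = -h := by rw [← lie_skew, h₀]
  rw [sub_lie, smul_lie, pow_two, mul_lie_eq, he₀, lie_lie, he, lie_smul, lie_mul_eq, h₁, lie_neg,
    ← lie_skew e₁ h, he₁, mul_smul_comm, smul_mul_assoc]
  simp only [neg_mul, mul_neg]
  module

namespace SumRep

variable {n : ℕ} {ħ κ : ℂ} {h : ℕ → Fin 2 → R} {x : ℤˣ → ℕ → Fin 2 → R} {E : ℤ → ℕ → ℕ → R}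
  {P : ℕ → ℕ → R} [TopologicalSpace R] [IsTopologicalRing R] [T2Space R]

lemma rootE_zero_eq (hn : 3 ≤ n) (hr : SumRep n ħ κ h x E P) :
    rootE n E 0 = ⁅x 1 n 0, x 1 0 0⁆ := by
  rw [rootE_zero, hr.e n (by omega) le_rfl, hr.e₀, (hr.prod 0 1).mul, zero_add]

/-- The image of `X^+_{0,1}` through `[X^+_{n,0}, X^+_{0,1}]`, the form suited to the node `1`. -/
lemma imE₁_zero_eq (hn : 3 ≤ n) (hr : SumRep n ħ κ h x E P) :
    imE₁ n ħ h x E P 0 = ⁅x 1 n 0, x 1 0 1⁆ + ħ • ⁅P 1 1, rootE n E 0⁆ := by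
  have h₁ := hr.rel.ht_x 1 1 0 (by omega) (by omega) (by omega) (by omega)
  have h₂ := hr.rel.ht_x 1 1 n (by omega) (by omega) (by omega) (by omega)
  rw [cartanNat_of_adjacent (by omega) (by omega), sgn_one] at h₁
  rw [cartanNat_of_not_adjacent (by omega) (by omega), mul_zero, zero_smul] at h₂
  have h₃ : ⁅P 2 2, rootE n E 0⁆ = 0 := by rw [rootE_zero, hr.P_lie_eq_zero (by omega)]
  rw [imE₁_zero, imHt_eq, sub_lie (h 1 1 - _), smul_lie, sub_lie (P 1 1), h₃, sub_zero]
  nth_rewrite 1 [hr.rootE_zero_eq hn]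
  rw [leibniz_lie, h₁, h₂, zero_lie, zero_add, lie_smul]
  module

/-- The image of `X^+_{0,1}` through `[X^+_{n,1}, X^+_{0,0}]`, the form suited to the node
`n - 1`. -/
lemma imE₁_zero_eq' (hn : 3 ≤ n) (hr : SumRep n ħ κ h x E P) :
    imE₁ n ħ h x E P 0 =
      κ • rootE n E 0 + ⁅x 1 n 1, x 1 0 0⁆ - ħ • ⁅P n n, rootE n E 0⁆ := by
  have h₁ := hr.rel.x_x_zero_last 1 n rfl
  have h₂ := hr.P_one_add_P_last_lie hn
  rw [← rootE_zero (E := E), ← hr.e₀, ← hr.e n (by omega) le_rfl, add_lie, ← eq_sub_iff_add_eq] at h₂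
  have h₃ : x 1 n 0 * x 1 0 0 = x 1 0 0 * x 1 n 0 + rootE n E 0 := by
    rw [hr.rootE_zero_eq hn, Ring.lie_def]
    abel
  rw [← lie_skew (x 1 0 1), ← lie_skew (x 1 0 0) (x 1 n 1), ← lie_skew (x 1 0 0) (x 1 n 0),
    ← hr.rootE_zero_eq hn, h₃, sgn_one, sub_neg_eq_add, neg_add_eq_iff_eq_add] at h₁
  rw [hr.imE₁_zero_eq hn, h₂, h₁, h₃]
  module

lemma imHt_lie_rootE_zero (hn : 3 ≤ n) (hr : SumRep n ħ κ h x E P) {i : ℕ}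
    (hi : 2 ≤ i ∧ i + 1 < n) : ⁅imHt ħ h P i, rootE n E 0⁆ = 0 := by
  have h₁ := hr.rel.ht_x 1 i 0 (by omega) (by omega) (by omega) (by omega)
  have h₂ := hr.rel.ht_x 1 i n (by omega) (by omega) (by omega) (by omega)
  rw [cartanNat_of_not_adjacent (by omega) (by omega), mul_zero, zero_smul] at h₁ h₂
  have h₃ : ⁅P i i - P (i + 1) (i + 1), rootE n E 0⁆ = 0 := by
    rw [rootE_zero, sub_lie, hr.P_lie_eq_zero (by omega), hr.P_lie_eq_zero (by omega), sub_zero]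
  rw [imHt_eq, sub_lie, smul_lie, h₃, hr.rootE_zero_eq hn, leibniz_lie, h₁, h₂, zero_lie, lie_zero,
    smul_zero, sub_zero, add_zero]

lemma imHt_last_lie_rootE_zero (hn : 3 ≤ n) (hr : SumRep n ħ κ h x E P) {i : ℕ}
    (hi : i + 1 = n) :
    ⁅imHt ħ h P i, rootE n E 0⁆ = -(imE₁ n ħ h x E P 0 - κ • rootE n E 0) := by
  have h₁ := hr.rel.ht_x 1 i 0 (by omega) (by omega) (by omega) (by omega)
  have h₂ := hr.rel.ht_x 1 i n (by omega) (by omega) (by omega) (by omega)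
  rw [cartanNat_of_not_adjacent (by omega) (by omega), mul_zero, zero_smul] at h₁
  rw [cartanNat_of_adjacent (by omega) (by omega), sgn_one] at h₂
  have h₃ : ⁅P i i, rootE n E 0⁆ = 0 := by rw [rootE_zero, hr.P_lie_eq_zero (by omega)]
  rw [hr.imE₁_zero_eq' hn, imHt_eq, hi, sub_lie (h i 1 - _), smul_lie,
    sub_lie (P i i), h₃]
  nth_rewrite 1 [hr.rootE_zero_eq hn]
  rw [leibniz_lie, h₁, h₂, lie_zero, add_zero, smul_lie]
  module

lemma imE₁_lie_rootE_of_pos (hr : SumRep n ħ κ h x E P) {i j : ℕ} (hi : 1 ≤ i ∧ i < n)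
    (hj : 1 ≤ j ∧ j < n) :
    ⁅imE₁ n ħ h x E P i, rootE n E j⁆ - ⁅rootE n E i, imE₁ n ħ h x E P j⁆ =
      (cartanNat n i j * (ħ / 2)) • (rootE n E i * rootE n E j + rootE n E j * rootE n E i) := by
  have h₁ := hr.rel.x_x 1 i j (by omega) (by omega) (by omega) (by omega)
  rw [sgn_one, one_mul, hr.e i hi.1 hi.2.le, hr.e j hj.1 hj.2.le, cartanNat_succ hi hj] at h₁
  have h₂ : ⁅P i (i + 1), E 0 j (j + 1)⁆ + ⁅P j (j + 1), E 0 i (i + 1)⁆ = 0 := by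
    rw [hr.P_lie (by omega), hr.P_lie (by omega)]
    simp only [eq_comm (a := j) (b := i + 1), eq_comm (a := j + 1) (b := i)]
    abel
  rw [rootE_of_pos hi.1, rootE_of_pos hj.1, ← h₁, imE₁_of_pos hi.1, imE₁_of_pos hj.1, sub_lie,
    lie_sub, smul_lie, lie_smul, ← lie_skew (E 0 i (i + 1)) (P j (j + 1)),
    eq_neg_of_add_eq_zero_left h₂]
  module

lemma imE₁_zero_lie_rootE_zero (hn : 3 ≤ n) (hr : SumRep n ħ κ h x E P) :
    ⁅imE₁ n ħ h x E P 0, rootE n E 0⁆ = ħ • (rootE n E 0 * rootE n E 0) := by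
  have h₁ := hr.rel.ht_x 1 1 0 (by omega) (by omega) (by omega) (by omega)
  have h₂ := hr.rel.ht_x 1 1 n (by omega) (by omega) (by omega) (by omega)
  have h₃ := hr.rel.serre 1 n 0 (by omega) (by omega) (by omega) (by omega)
  have h₄ := hr.rel.x_x 1 0 0 (by omega) (by omega) (by omega) (by omega)
  have h₅ := hr.P_one_lie_lie hn
  rw [cartanNat_of_adjacent (by omega) (by omega), sgn_one, one_mul, neg_smul, one_smul] at h₁
  rw [cartanNat_of_not_adjacent (by omega) (by omega), mul_zero, zero_smul] at h₂
  rw [cartanNat_self, sgn_one, ← lie_skew (x 1 0 0) (x 1 0 1), sub_neg_eq_add] at h₄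
  rw [← rootE_zero (E := E)] at h₅
  have h₆ : ⁅x 1 n 0, ⁅x 1 n 0, x 1 0 1⁆⁆ = 0 := by
    have := congrArg (fun z => ⁅h 1 1 - (ħ / 2) • h 1 0 ^ 2, z⁆) h₃
    rw [← lie_skew (x 1 n 0) (x 1 0 1), lie_neg, neg_eq_zero]
    simpa [leibniz_lie (h 1 1 - (ħ / 2) • h 1 0 ^ 2), h₁, h₂] using this
  have h₇ : ⁅x 1 0 1, x 1 0 0⁆ = ħ • (x 1 0 0 * x 1 0 0) := by
    have : (2 : ℂ) • ⁅x 1 0 1, x 1 0 0⁆ = (2 : ℂ) • (ħ • (x 1 0 0 * x 1 0 0)) := by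
      rw [two_smul, h₄]
      module
    exact smul_right_injective R (two_ne_zero' ℂ) this
  -- Apply `ad X^+_{n,0}` twice to the relation for `X^+_{0,1}` and `X^+_{0,0}`.
  have h₈ := congrArg (fun z => ⁅x 1 n 0, ⁅x 1 n 0, z⁆⁆) h₇
  rw [← hr.rootE_zero_eq hn] at h₃
  simp only [leibniz_lie (x 1 n 0) (x 1 0 1), leibniz_lie (x 1 n 0) ⁅x 1 n 0, x 1 0 1⁆,
    lie_smul, lie_mul_eq, lie_add, h₃, h₆, ← hr.rootE_zero_eq hn, lie_zero, zero_lie, zero_mul,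
    mul_zero, add_zero, zero_add] at h₈
  rw [hr.imE₁_zero_eq hn, add_lie, smul_lie, h₅, smul_zero, add_zero]
  refine smul_right_injective R (two_ne_zero' ℂ) ?_
  simp only
  rw [two_smul, h₈]
  module

lemma imE₁_zero_lie_rootE_one (hn : 3 ≤ n) (hr : SumRep n ħ κ h x E P) :
    ⁅imE₁ n ħ h x E P 0, rootE n E 1⁆ - ⁅rootE n E 0, imE₁ n ħ h x E P 1⁆ =
      -((ħ / 2) • (rootE n E 0 * rootE n E 1 + rootE n E 1 * rootE n E 0)) := by
  have h₁ := hr.rel.x_x 1 0 1 (by omega) (by omega) (by omega) (by omega)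
  have h₂ := hr.rel.serre_far 1 n 1 (by omega) (by omega) (by omega) (by omega)
  have h₃ := hr.rel.x1_x0_far (by omega) 1 (i := 1) (j := n) (by omega) (by omega) (by omega)
    (by omega)
  rw [← lie_skew, neg_eq_zero] at h₃
  rw [cartanNat_of_adjacent (by omega) (by omega), sgn_one] at h₁
  have h₄ : x 1 1 0 = rootE n E 1 := by rw [hr.e 1 le_rfl (by omega), rootE_of_pos le_rfl]
  have h₅ : ⁅⁅P 1 1, rootE n E 0⁆, rootE n E 1⁆ = -⁅rootE n E 0, P 1 2⁆ := by
    rw [lie_lie, rootE_zero, rootE_of_pos le_rfl, (hr.prod 1 0).mul, hr.P_lie_eq_zero (by omega),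
      hr.P_lie (by omega), if_pos rfl, if_neg (by omega), sub_zero, zero_sub]
  have h₆ : ⁅⁅x 1 n 0, x 1 0 1⁆, x 1 1 0⁆ = ⁅x 1 n 0, ⁅x 1 0 1, x 1 1 0⁆⁆ := by
    rw [lie_lie, h₂, lie_zero, sub_zero]
  have h₇ : ⁅rootE n E 0, x 1 1 1⁆ = ⁅x 1 n 0, ⁅x 1 0 0, x 1 1 1⁆⁆ := by
    rw [hr.rootE_zero_eq hn, lie_lie, h₃, lie_zero, sub_zero]
  rw [hr.imE₁_zero_eq hn, imE₁_of_pos le_rfl, add_lie, smul_lie, lie_sub, lie_smul, h₅, h₇, ← h₄,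
    h₆, sub_eq_iff_eq_add.1 h₁, lie_add, lie_smul, lie_add, lie_mul_eq, lie_mul_eq, h₂,
    ← hr.rootE_zero_eq hn]
  simp only [mul_zero, zero_mul, add_zero, zero_add]
  module

lemma rootE_zero_lie_imE₁ (hn : 3 ≤ n) (hr : SumRep n ħ κ h x E P) {j : ℕ}
    (hj : 2 ≤ j ∧ j + 1 < n) : ⁅rootE n E 0, imE₁ n ħ h x E P j⁆ = 0 := by
  have h₁ := hr.rel.x1_x0_far (by omega) 1 (i := j) (j := n) (by omega) (by omega) (by omega)
    (by omega)
  have h₂ := hr.rel.x1_x0_far (by omega) 1 (i := j) (j := 0) (by omega) (by omega) (by omega)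
    (by omega)
  have h₃ : ⁅P j (j + 1), rootE n E 0⁆ = 0 := by rw [rootE_zero, hr.P_lie_eq_zero (by omega)]
  rw [← lie_skew, imE₁_of_pos (by omega), sub_lie, smul_lie, h₃, hr.rootE_zero_eq hn, leibniz_lie,
    h₁, h₂]
  simp

lemma imE₁_zero_lie_rootE (hn : 3 ≤ n) (hr : SumRep n ħ κ h x E P) {j : ℕ}
    (hj : 2 ≤ j ∧ j + 1 < n) : ⁅imE₁ n ħ h x E P 0, rootE n E j⁆ = 0 := by
  have h₁ : ⁅rootE n E 0, rootE n E j⁆ = 0 := by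
    rw [rootE_zero, rootE_of_pos (by omega), (hr.prod 1 0).zero]
  rw [imE₁_zero, neg_lie, lie_lie, h₁, hr.imHt_lie_rootE (by omega) (by omega), lie_smul,
    hr.rootE_zero_lie_imE₁ hn hj]
  simp

lemma imE₁_zero_lie_rootE_last (hn : 3 ≤ n) (hr : SumRep n ħ κ h x E P) {l : ℕ}
    (hl : l + 1 = n) :
    ⁅imE₁ n ħ h x E P 0, rootE n E l⁆ - ⁅rootE n E 0, imE₁ n ħ h x E P l⁆ =
      -((ħ / 2) • (rootE n E 0 * rootE n E l + rootE n E l * rootE n E 0)) +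
        κ • ⁅rootE n E 0, rootE n E l⁆ := by
  have h₁ := hr.rel.x_x 1 n l (by omega) (by omega) (by omega) (by omega)
  have h₂ := hr.rel.serre_far 1 0 l (by omega) (by omega) (by omega) (by omega)
  have h₃ := hr.rel.x1_x0_far (by omega) 1 (i := l) (j := 0) (by omega) (by omega) (by omega)
    (by omega)
  have h₂' : ⁅x 1 l 0, x 1 0 0⁆ = 0 := by rw [← lie_skew, h₂, neg_zero]
  have h₃' : ⁅x 1 0 0, x 1 l 1⁆ = 0 := by rw [← lie_skew, h₃, neg_zero]
  rw [cartanNat_of_adjacent (by omega) (by omega), sgn_one] at h₁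
  have h₄ : x 1 l 0 = rootE n E l := by rw [hr.e l (by omega) (by omega), rootE_of_pos (by omega)]
  have h₅ : ⁅⁅P n n, rootE n E 0⁆, rootE n E l⁆ = ⁅rootE n E 0, P l n⁆ := by
    rw [lie_lie, rootE_zero, rootE_of_pos (by omega), hl,
      (hr.prod 1 0).mul_neg (i := n) (j := 1) (k := l), lie_neg,
      hr.P_lie_eq_zero (by omega), hr.P_lie (by omega), if_neg (by omega), if_pos rfl, zero_sub,
      lie_neg, neg_zero, zero_sub, neg_neg]
  have h₆ : ⁅⁅x 1 n 1, x 1 0 0⁆, x 1 l 0⁆ = ⁅⁅x 1 n 1, x 1 l 0⁆, x 1 0 0⁆ := by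
    rw [lie_lie, h₂, lie_zero, zero_sub, ← lie_skew, neg_neg]
  have h₇ : ⁅rootE n E 0, x 1 l 1⁆ = ⁅⁅x 1 n 0, x 1 l 1⁆, x 1 0 0⁆ := by
    rw [hr.rootE_zero_eq hn, lie_lie, h₃', lie_zero, zero_sub, ← lie_skew, neg_neg]
  rw [hr.imE₁_zero_eq' hn, imE₁_of_pos (by omega), sub_lie, add_lie, smul_lie, smul_lie, lie_sub,
    lie_smul, h₅, h₇, ← h₄, h₆, sub_eq_iff_eq_add.1 h₁, add_lie, smul_lie, add_lie, mul_lie_eq,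
    mul_lie_eq, h₂', ← hr.rootE_zero_eq hn, hl]
  simp only [mul_zero, zero_mul, add_zero, zero_add]
  module

lemma imE₁_zero_lie (hn : 3 ≤ n) (hr : SumRep n ħ κ h x E P) {j : ℕ} (hj : j + 1 < n) :
    ⁅imE₁ n ħ h x E P 0, rootE n E j⁆ - ⁅rootE n E 0, imE₁ n ħ h x E P j⁆ =
      (cartanNat n 0 j * (ħ / 2)) • (rootE n E 0 * rootE n E j + rootE n E j * rootE n E 0) := by
  by_cases h0 : j = 0
  · subst h0
    rw [← lie_skew (rootE n E 0), hr.imE₁_zero_lie_rootE_zero hn, cartanNat_self]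
    module
  by_cases h1 : j = 1
  · subst h1
    rw [hr.imE₁_zero_lie_rootE_one hn, cartanNat_of_adjacent (by omega) (by omega)]
    module
  · rw [hr.imE₁_zero_lie_rootE hn (by omega), hr.rootE_zero_lie_imE₁ hn (by omega),
      cartanNat_of_not_adjacent (by omega) (by omega)]
    simp

lemma imE₁_lie_rootE (hn : 3 ≤ n) (hr : SumRep n ħ κ h x E P) {i j : ℕ} (hi : i < n)
    (hj : j < n) (hij : ¬(i = 0 ∧ j + 1 = n)) (hij' : ¬(j = 0 ∧ i + 1 = n)) :
    ⁅imE₁ n ħ h x E P i, rootE n E j⁆ - ⁅rootE n E i, imE₁ n ħ h x E P j⁆ =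
      (cartanNat n i j * (ħ / 2)) • (rootE n E i * rootE n E j + rootE n E j * rootE n E i) := by
  rcases Nat.eq_zero_or_pos i with rfl | hi0
  · exact hr.imE₁_zero_lie hn (by omega)
  rcases Nat.eq_zero_or_pos j with rfl | hj0
  · rw [← lie_skew, ← lie_skew (rootE n E i), cartanNat_comm, add_comm (rootE n E i * _),
      ← hr.imE₁_zero_lie hn (j := i) (by omega)]
    abel
  · exact hr.imE₁_lie_rootE_of_pos ⟨hi0, hi⟩ ⟨hj0, hj⟩

end SumRep

end AffineYangian

end

noncomputable section

/-! ### Commutativity of the images of `H_{i,1}`, and the remaining relations -/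

namespace AffineYangian

attribute [local instance] LieRing.ofAssociativeRing

open Steinberg MulOpposite

variable {R : Type*} [Ring R] [Algebra ℂ R]

namespace LoopRep

variable {n : ℕ} {ħ κ : ℂ} {h : ℕ → Fin 2 → R} {x : ℤˣ → ℕ → Fin 2 → R} {E : ℤ → ℕ → ℕ → R}

lemma rootE_lie_rootE_of_not_adjacent (hn : 3 ≤ n) (hr : LoopRep n ħ κ h x E) {i j : ℕ}
    (hi : i < n) (hj : j < n) (hij : i ≠ j) (ha : ¬Adjacent n i j) :
    ⁅rootE n E i, rootE n E j⁆ = 0 := by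
  have h₁ : src n i ≠ j + 1 ∧ i + 1 ≠ src n j := by
    simp only [src]
    split_ifs <;> omega
  have hb := src_bounds hi hn
  have hb' := src_bounds hj hn
  rw [rootE, rootE, (hr.prod _ _).zero (i := src n i) (j := i + 1) (k := src n j) (l := j + 1)
    (by omega)]

lemma rootE_lie_rootE_lie_rootE (hn : 3 ≤ n) (hr : LoopRep n ħ κ h x E) {i j : ℕ}
    (hi : i < n) (hj : j < n) (ha : Adjacent n i j) :
    ⁅rootE n E i, ⁅rootE n E i, rootE n E j⁆⁆ = 0 := by
  have hb := src_bounds hi hn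
  have hb' := src_bounds hj hn
  have h₁ : src n i ≠ src n j := by
    simp only [src]
    split_ifs <;> omega
  have h₂ : (src n i ≠ j + 1 ∧ i + 1 = src n j) ∨ (src n i = j + 1 ∧ i + 1 ≠ src n j) := by
    simp only [src]
    split_ifs <;> omega
  rw [rootE, rootE]
  rcases h₂ with ⟨h₂, h₃⟩ | ⟨h₂, h₃⟩
  · rw [← h₃, (hr.prod _ _).mul (i := src n i) (j := i + 1) (l := j + 1) (by omega),
      (hr.prod _ _).zero (i := src n i) (j := i + 1) (k := src n i) (l := j + 1) (by omega)]
  · rw [← h₂, (hr.prod _ _).mul_neg (i := src n i) (j := i + 1) (k := src n j) (by omega), lie_neg,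
      (hr.prod _ _).zero (i := src n i) (j := i + 1) (k := src n j) (l := i + 1) (by omega),
      neg_zero]

end LoopRep

namespace SumRep

variable {n : ℕ} {ħ κ : ℂ} {h : ℕ → Fin 2 → R} {x : ℤˣ → ℕ → Fin 2 → R} {E : ℤ → ℕ → ℕ → R}
  {P : ℕ → ℕ → R} [TopologicalSpace R] [IsTopologicalRing R] [T2Space R]

lemma rootF_lie_rootE (hn : 3 ≤ n) (hr : SumRep n ħ κ h x E P) {j : ℕ} (hj : 1 ≤ j ∧ j < n) :
    ⁅rootF n E 0, rootE n E j⁆ = 0 := by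
  rw [← lie_skew, hr.rootE_lie_rootF hn hj.2 (by omega), if_neg (by omega), neg_zero]

lemma rootF_lie_imE₁ (hn : 3 ≤ n) (hr : SumRep n ħ κ h x E P) {j : ℕ} (hj : 1 ≤ j ∧ j < n) :
    ⁅rootF n E 0, imE₁ n ħ h x E P j⁆ = 0 := by
  rw [← lie_skew, hr.imE₁_lie_rootF hn hj.2 (by omega), if_neg (by omega), neg_zero]

lemma imHt_zero_lie_rootE (hn : 3 ≤ n) (hr : SumRep n ħ κ h x E P) {j : ℕ} (hj : j + 1 < n) :
    ⁅imH₁ n ħ h x E P 0 - (ħ / 2) • imH₀ n h 0 ^ 2, rootE n E j⁆ =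
      cartanNat n 0 j • imE₁ n ħ h x E P j := by
  have h₀ := hr.rootE_lie_rootF_self hn (i := 0) (by omega)
  have ha := hr.imH₀_lie_rootE hn (i := 0) (j := j) (by omega) (by omega)
  have ha₁ := hr.imH₀_lie_imE₁ hn (i := 0) (j := j) (by omega) (by omega)
  rcases Nat.eq_zero_or_pos j with rfl | hj0
  · rw [cartanNat_self] at ha ha₁ ⊢
    refine lie_ht_self h₀ ha ha₁ ?_
    rw [hr.imE₁_zero_lie_rootE_zero hn, mul_div_cancel₀ _ (two_ne_zero' ℂ)]
  · rw [imH₁_zero, lie_ht_of_lie (d := 0) (hr.rootF_lie_rootE hn (by omega))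
      (hr.rootF_lie_imE₁ hn (by omega)) h₀ ha ha₁
      (by rw [hr.imE₁_zero_lie hn hj, zero_smul, add_zero]), zero_mul, zero_smul, add_zero]

lemma imHt_zero_lie_rootE_last (hn : 3 ≤ n) (hr : SumRep n ħ κ h x E P) {l : ℕ}
    (hl : l + 1 = n) :
    ⁅imH₁ n ħ h x E P 0 - (ħ / 2) • imH₀ n h 0 ^ 2, rootE n E l⁆ =
      -(imE₁ n ħ h x E P l + κ • rootE n E l) := by
  have h₀ := hr.rootE_lie_rootF_self hn (i := 0) (by omega)
  have ha := hr.imH₀_lie_rootE hn (i := 0) (j := l) (by omega) (by omega)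
  have ha₁ := hr.imH₀_lie_imE₁ hn (i := 0) (j := l) (by omega) (by omega)
  rw [cartanNat_of_adjacent (by omega) (by omega)] at ha ha₁
  rw [imH₁_zero, lie_ht_of_lie (d := κ) (hr.rootF_lie_rootE hn (by omega))
    (hr.rootF_lie_imE₁ hn (by omega)) h₀ ha ha₁ ?_]
  · module
  · rw [hr.imE₁_zero_lie_rootE_last hn hl]
    module

lemma imHt_zero_lie_rootF (hn : 3 ≤ n) (hr : SumRep n ħ κ h x E P) {j : ℕ} (hj : j + 1 < n) :
    ⁅imH₁ n ħ h x E P 0 - (ħ / 2) • imH₀ n h 0 ^ 2, rootF n E j⁆ =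
      -(cartanNat n 0 j • imF₁ n ħ h x E P j) := by
  have h₁ := hr.op.imHt_zero_lie_rootE hn hj
  rw [hr.op_imH₁ hn, op_imH₀, op_rootF, op_imF₁, ← op_pow, ← op_smul, ← op_sub, op_lie_op,
    ← op_smul, op_inj, ← lie_skew, neg_eq_iff_eq_neg] at h₁
  exact h₁

lemma imHt_lie_imH₁_zero (hn : 3 ≤ n) (hr : SumRep n ħ κ h x E P) {j : ℕ}
    (hj : 2 ≤ j ∧ j + 1 < n) : ⁅imHt ħ h P j, imH₁ n ħ h x E P 0⁆ = 0 := by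
  have h₁ := hr.op.imHt_lie_rootE_zero hn hj
  rw [op_imHt, op_rootF, op_lie_op, ← op_zero, op_inj, ← lie_skew, neg_eq_zero] at h₁
  rw [imH₁_zero, leibniz_lie, h₁, imE₁_zero, lie_neg, leibniz_lie,
    hr.imHt_lie_imHt hn (by omega) (by omega), hr.imHt_lie_rootE_zero hn hj]
  simp

/-- `H̃_1 - H̃_{n-1}` acts by opposite scalars on the images of `X^+_{0,1}` and `X^-_{0,0}`, whose
bracket is the image of `H_{0,1}`. -/
lemma imHt_one_lie_imH₁_zero (hn : 3 ≤ n) (hr : SumRep n ħ κ h x E P) {l : ℕ} (hl : l + 1 = n) :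
    ⁅imHt ħ h P 1, imH₁ n ħ h x E P 0⁆ = ⁅imHt ħ h P l, imH₁ n ħ h x E P 0⁆ := by
  have key : ⁅imHt ħ h P 1 - imHt ħ h P l, rootE n E 0⁆ = -(κ • rootE n E 0) := by
    rw [sub_lie, hr.imHt_last_lie_rootE_zero hn hl, imE₁_zero]
    abel
  have keyF : ⁅imHt ħ h P 1 - imHt ħ h P l, rootF n E 0⁆ = κ • rootF n E 0 := by
    have h₁ := hr.op.imHt_last_lie_rootE_zero hn hl
    rw [op_imHt, op_rootF, op_imF₁, op_lie_op, ← op_smul, ← op_sub, ← op_neg, op_inj, ← lie_skew,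
      neg_inj] at h₁
    rw [sub_lie, h₁, imF₁_zero]
    abel
  have h₁ : ⁅imHt ħ h P 1 - imHt ħ h P l, imHt ħ h P 1⁆ = 0 := by
    rw [sub_lie, hr.imHt_lie_imHt hn (by omega) (by omega),
      hr.imHt_lie_imHt hn (by omega) (by omega), sub_zero]
  have key₁ : ⁅imHt ħ h P 1 - imHt ħ h P l, imE₁ n ħ h x E P 0⁆ =
      -(κ • imE₁ n ħ h x E P 0) := by
    rw [imE₁_zero, lie_neg, leibniz_lie, h₁, key, lie_neg, lie_smul, zero_lie, zero_add, smul_neg]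
  rw [← sub_eq_zero, ← sub_lie, imH₁_zero, leibniz_lie, key₁, keyF, neg_lie, smul_lie, lie_smul,
    neg_add_cancel]

lemma imHt_one_lie_imH₁_zero_eq_zero (hn : 3 ≤ n) (hr : SumRep n ħ κ h x E P) :
    ⁅imHt ħ h P 1, imH₁ n ħ h x E P 0⁆ = 0 := by
  set T := imH₁ n ħ h x E P 0 - (ħ / 2) • imH₀ n h 0 ^ 2 with hT
  have hsq : ∀ j, 1 ≤ j ∧ j < n → ⁅imHt ħ h P j, imH₁ n ħ h x E P 0⁆ = -⁅T, imHt ħ h P j⁆ := by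
    intro j hj
    have := hr.imH₀_lie_imHt hn (i := 0) (by omega) hj
    rw [hT, sub_lie, smul_lie, pow_two, mul_lie_eq, this, ← lie_skew]
    simp
  have hTx := hr.imHt_zero_lie_rootE hn (j := 1) (by omega)
  have hTf := hr.imHt_zero_lie_rootF hn (j := 1) (by omega)
  have h2x := hr.imHt_lie_rootE (i := 2) (j := 1) (by omega) (by omega)
  have h2f := hr.imHt_lie_rootF (i := 2) (j := 1) (by omega) (by omega)
  have h1x := hr.imHt_lie_rootE (i := 1) (j := 1) (by omega) (by omega)
  rw [cartanNat_of_adjacent (by omega) (by omega), neg_smul, one_smul] at hTx hTf h2x h2f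
  rw [← hT] at hTx hTf
  rw [neg_neg] at hTf h2f
  rw [cartanNat_self] at h1x
  have hH : ⁅imE₁ n ħ h x E P 1, rootF n E 1⁆ = imH₁ n ħ h x E P 1 := by
    rw [hr.imE₁_lie_rootF hn (by omega) (by omega), if_pos rfl]
  have h2H : ⁅imHt ħ h P 2, imH₁ n ħ h x E P 1⁆ = 0 := by
    have h₁ := hr.imH₀_lie_imHt hn (i := 1) (j := 2) (by omega) (by omega)
    rw [← sub_add_cancel (imH₁ n ħ h x E P 1) ((ħ / 2) • imH₀ n h 1 ^ 2), imHt_eq_imH₁ le_rfl,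
      lie_add, hr.imHt_lie_imHt hn (by omega) (by omega), lie_smul, pow_two, lie_mul_eq,
      ← lie_skew, h₁]
    simp
  -- `H_{1,1} = -[[H̃_2, X^+_1], X^-_1]`, so that `[H̃_0, H_{1,1}]` is determined by `[H̃_0, H̃_2]`.
  have hTH : ⁅T, imH₁ n ħ h x E P 1⁆ =
      -⁅⁅⁅T, imHt ħ h P 2⁆, rootE n E 1⁆, rootF n E 1⁆ := by
    have h₁ : ⁅⁅T, imHt ħ h P 2⁆, rootE n E 1⁆ =
        -⁅T, imE₁ n ħ h x E P 1⁆ + ⁅imHt ħ h P 2, imE₁ n ħ h x E P 1⁆ := by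
      rw [lie_lie, h2x, hTx, lie_neg, lie_neg, sub_neg_eq_add]
    have h₂ : ⁅⁅T, imE₁ n ħ h x E P 1⁆, rootF n E 1⁆ =
        ⁅T, imH₁ n ħ h x E P 1⁆ - ⁅imE₁ n ħ h x E P 1, imF₁ n ħ h x E P 1⁆ := by
      rw [lie_lie, hH, hTf]
    have h₃ : ⁅⁅imHt ħ h P 2, imE₁ n ħ h x E P 1⁆, rootF n E 1⁆ =
        -⁅imE₁ n ħ h x E P 1, imF₁ n ħ h x E P 1⁆ := by
      rw [lie_lie, hH, h2f, h2H, zero_sub]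
    rw [h₁, add_lie, neg_lie, h₂, h₃]
    abel
  have hTH' : ⁅T, imHt ħ h P 1⁆ = ⁅T, imH₁ n ħ h x E P 1⁆ := by
    have h₁ : ⁅T, imH₀ n h 1⁆ = 0 := by
      have h₂ := hr.imH₀_lie_imH₁ hn (i := 1) (j := 0) (by omega) (by omega)
      have h₃ := hr.imH₀_lie_imH₀ (i := 1) (j := 0) (by omega) (by omega)
      rw [hT, ← lie_skew, lie_ht_eq_zero h₂ h₃, neg_zero]
    rw [← imHt_eq_imH₁ (n := n) (x := x) (E := E) le_rfl, lie_sub, lie_smul, pow_two, lie_mul_eq,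
      h₁]
    simp
  suffices hs : ⁅⁅T, imHt ħ h P 2⁆, rootE n E 1⁆ = 0 by
    rw [hsq 1 (by omega), hTH', hTH, hs, zero_lie, neg_zero, neg_zero]
  rcases Nat.lt_or_ge 3 n with h3 | h3
  · have h₁ := hr.imHt_lie_imH₁_zero hn (j := 2) (by omega)
    rw [hsq 2 (by omega), neg_eq_zero] at h₁
    rw [h₁, zero_lie]
  -- For `n = 3`, the element `H̃_1 + 2 H̃_2` commutes with `X^+_1`.
  · have h₁ := hr.imHt_one_lie_imH₁_zero hn (l := 2) (by omega)
    rw [hsq 1 (by omega), hsq 2 (by omega), neg_inj] at h₁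
    have h₂ : ⁅imHt ħ h P 1 + (2 : ℂ) • imHt ħ h P 2, rootE n E 1⁆ = 0 := by
      rw [add_lie, smul_lie, h1x, h2x]
      module
    have h₃ : ⁅imHt ħ h P 1 + (2 : ℂ) • imHt ħ h P 2, imE₁ n ħ h x E P 1⁆ = 0 := by
      have h₄ : ⁅imHt ħ h P 1 + (2 : ℂ) • imHt ħ h P 2, imHt ħ h P 2⁆ = 0 := by
        rw [add_lie, smul_lie, hr.imHt_lie_imHt hn (by omega) (by omega),
          hr.imHt_lie_imHt hn (by omega) (by omega), smul_zero, add_zero]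
      rw [← neg_eq_zero, ← lie_neg, ← h2x, leibniz_lie, h₂, h₄, zero_lie, lie_zero, add_zero]
    have h₅ : ⁅T, imHt ħ h P 1 + (2 : ℂ) • imHt ħ h P 2⁆ = (3 : ℂ) • ⁅T, imHt ħ h P 2⁆ := by
      rw [lie_add, lie_smul, h₁]
      module
    have h₆ : (3 : ℂ) • ⁅⁅T, imHt ħ h P 2⁆, rootE n E 1⁆ = 0 := by
      rw [← smul_lie, ← h₅, lie_lie, h₂, hTx, lie_neg, h₃]
      simp
    exact (smul_eq_zero.1 h₆).resolve_left three_ne_zero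

lemma imHt_lie_imH₁_zero_eq_zero (hn : 3 ≤ n) (hr : SumRep n ħ κ h x E P) {j : ℕ}
    (hj : 1 ≤ j ∧ j < n) : ⁅imHt ħ h P j, imH₁ n ħ h x E P 0⁆ = 0 := by
  have h₁ := hr.imHt_one_lie_imH₁_zero_eq_zero hn
  by_cases h1 : j = 1
  · rw [h1, h₁]
  by_cases h2 : j + 1 = n
  · rw [← hr.imHt_one_lie_imH₁_zero hn h2, h₁]
  · exact hr.imHt_lie_imH₁_zero hn (by omega)

lemma imH₁_lie_imH₁ (hn : 3 ≤ n) (hr : SumRep n ħ κ h x E P) {i j : ℕ} (hi : i < n)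
    (hj : j < n) : ⁅imH₁ n ħ h x E P i, imH₁ n ħ h x E P j⁆ = 0 := by
  -- Pass from `H̃_{i,1}` to `H_{i,1}` for `i ≠ 0`.
  have key : ∀ i j, 1 ≤ i → i < n → j < n → ⁅imHt ħ h P i, imH₁ n ħ h x E P j⁆ = 0 →
      ⁅imH₁ n ħ h x E P i, imH₁ n ħ h x E P j⁆ = 0 := by
    intro i j hi hi' hj hz
    rw [← sub_add_cancel (imH₁ n ħ h x E P i) ((ħ / 2) • imH₀ n h i ^ 2), imHt_eq_imH₁ hi,
      add_lie, hz, smul_lie, pow_two, mul_lie_eq, hr.imH₀_lie_imH₁ hn hi' hj]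
    simp
  have key₀ : ∀ i, 1 ≤ i → i < n → ⁅imH₁ n ħ h x E P i, imH₁ n ħ h x E P 0⁆ = 0 := fun i hi hi' =>
    key i 0 hi hi' (by omega) (hr.imHt_lie_imH₁_zero_eq_zero hn ⟨hi, hi'⟩)
  rcases Nat.eq_zero_or_pos i with rfl | hi0 <;> rcases Nat.eq_zero_or_pos j with rfl | hj0
  · rw [lie_self]
  · rw [← lie_skew, key₀ j hj0 hj, neg_zero]
  · exact key₀ i hi0 hi
  · refine key i j hi0 hi hj ?_
    have h₁ := hr.imH₀_lie_imHt hn hj ⟨hi0, hi⟩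
    rw [← sub_add_cancel (imH₁ n ħ h x E P j) ((ħ / 2) • imH₀ n h j ^ 2), imHt_eq_imH₁ hj0,
      lie_add, hr.imHt_lie_imHt hn ⟨hi0, hi⟩ ⟨hj0, hj⟩, lie_smul, pow_two, lie_mul_eq, ← lie_skew,
      h₁]
    simp

lemma halfRelations (hn : 3 ≤ n) (hr : SumRep n ħ κ h x E P) :
    HalfRelations n ħ κ (imH₀ n h) (imH₁ n ħ h x E P) (rootE n E) (imE₁ n ħ h x E P)
      (rootF n E) (imF₁ n ħ h x E P) where
  h0_h0 _ _ hi hj := hr.imH₀_lie_imH₀ hi hj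
  h0_h1 _ _ hi hj := hr.imH₀_lie_imH₁ hn hi hj
  h1_h1 _ _ hi hj := hr.imH₁_lie_imH₁ hn hi hj
  e0_f0 _ _ hi hj := hr.rootE_lie_rootF hn hi hj
  e1_f0 _ _ hi hj := hr.imE₁_lie_rootF hn hi hj
  e0_f1 _ _ hi hj := hr.rootE_lie_imF₁ hn hi hj
  h0_e0 _ _ hi hj := hr.imH₀_lie_rootE hn hi hj
  h0_e1 _ _ hi hj := hr.imH₀_lie_imE₁ hn hi hj
  ht_e0 i j hi hj hij hij' := by
    rcases Nat.eq_zero_or_pos i with rfl | hi0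
    · exact hr.imHt_zero_lie_rootE hn (by omega)
    rw [imHt_eq_imH₁ hi0]
    rcases Nat.eq_zero_or_pos j with rfl | hj0
    · by_cases h1 : i = 1
      · subst h1
        rw [imE₁_zero, cartanNat_of_adjacent (by omega) (by omega), neg_smul, one_smul, neg_neg]
      · rw [hr.imHt_lie_rootE_zero hn (by omega), cartanNat_of_not_adjacent (by omega) (by omega),
          zero_smul]
    · exact hr.imHt_lie_rootE ⟨hi0, hi⟩ ⟨hj0, hj⟩
  ht_e0_zero_last _ hl := hr.imHt_zero_lie_rootE_last hn hl
  ht_e0_last_zero l hl := by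
    rw [imHt_eq_imH₁ (by omega), hr.imHt_last_lie_rootE_zero hn hl]
  e_e _ _ hi hj hij hij' := hr.imE₁_lie_rootE hn hi hj hij hij'
  e_e_zero_last _ hl := hr.imE₁_zero_lie_rootE_last hn hl
  serre_far _ _ hi hj hij ha := hr.rootE_lie_rootE_of_not_adjacent hn hi hj hij ha
  serre _ _ hi hj _ ha := hr.rootE_lie_rootE_lie_rootE hn hi hj ha

/-- The images of the generators satisfy the relations of the Yangian of `sl(n)^`. -/
theorem relations (hn : 3 ≤ n) (hr : SumRep n ħ κ h x E P) :
    Relations n ħ κ (fun i => ![imH₀ n h i, imH₁ n ħ h x E P i])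
      fun σ i => if σ = 1 then ![rootE n E i, imE₁ n ħ h x E P i] else
        ![rootF n E i, imF₁ n ħ h x E P i] := by
  refine (hr.halfRelations hn).relations ?_
  have h₁ := hr.op.halfRelations hn
  simpa only [funext (hr.op_imH₁ hn), funext (op_imH₀ (n := n) (h := h)),
    funext (op_rootE (n := n) (E := E)), funext (op_rootF (n := n) (E := E)),
    funext (op_imE₁ (n := n) (ħ := ħ) (h := h) (x := x) (E := E) (P := P)),
    funext (op_imF₁ (n := n) (ħ := ħ) (h := h) (x := x) (E := E) (P := P))] using h₁

end SumRep

end AffineYangian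

end

noncomputable section

/-! ### Root vectors of the affine Lie algebra and their degrees -/

namespace AffineSl

open Steinberg

variable {N : ℕ} [NeZero N]

lemma natCast_label_inj {i j : ℕ} (h : 1 ≤ i ∧ i ≤ N ∧ 1 ≤ j ∧ j ≤ N) :
    (i : ZMod N) = j ↔ i = j := by
  rw [← label_inj, label_cast h.1 h.2.1, label_cast h.2.2.1 h.2.2.2]

lemma matProd_E (r s : ℤ) :
    MatProd 1 N (fun i j => E N i j r) (fun i j => E N i j s) fun i j => E N i j (r + s) := by
  intro i j k l h
  have hjk := natCast_label_inj (N := N) (i := j) (j := k) (by omega)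
  have hil := natCast_label_inj (N := N) (i := i) (j := l) (by omega)
  have hij := mt (natCast_label_inj (N := N) (i := i) (j := j) (by omega)).1 (by omega)
  have hkl := mt (natCast_label_inj (N := N) (i := k) (j := l) (by omega)).1 (by omega)
  have h₁ : ¬((j : ZMod N) = k ∧ (i : ZMod N) = l) := by
    rw [hjk, hil]
    omega
  simp only [← hjk, ← hil]
  generalize (i : ZMod N) = i, (j : ZMod N) = j, (k : ZMod N) = k, (l : ZMod N) = l at hij hkl h₁
  have ht : Matrix.trace ((LieAlgebra.SpecialLinear.single i j hij 1 : Base N).val *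
      (LieAlgebra.SpecialLinear.single k l hkl 1 : Base N).val) = (0 : ℂ) := by
    rw [LieAlgebra.SpecialLinear.val_single, LieAlgebra.SpecialLinear.val_single]
    by_cases hjk : j = k
    · subst hjk
      rw [Matrix.single_mul_single_same, Matrix.trace_single_eq_of_ne]
      exact fun hil => h₁ ⟨rfl, hil⟩
    · rw [Matrix.single_mul_single_of_ne _ _ _ _ hjk, Matrix.trace_zero]
  rw [E_of_ne hij, E_of_ne hkl, loop_lie_loop, ht, mul_zero, ite_self, zero_smul, add_zero]
  by_cases hjk : j = k
  · subst hjk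
    have hil : i ≠ l := fun hil => h₁ ⟨rfl, hil⟩
    rw [if_pos rfl, if_neg hil, sub_zero, E_of_ne hil]
    congr 1
    refine Subtype.ext ?_
    rw [LieAlgebra.SpecialLinear.sl_bracket]
    simp [Matrix.single_mul_single_of_ne _ _ _ _ hil.symm]
  by_cases hil : i = l
  · subst hil
    rw [if_neg hjk, if_pos rfl, zero_sub, E_of_ne (Ne.symm hjk), ← neg_one_smul ℂ, ← loop_smul]
    congr 1
    refine Subtype.ext ?_
    rw [LieAlgebra.SpecialLinear.sl_bracket]
    simp [Matrix.single_mul_single_of_ne _ _ _ _ hjk]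
  · rw [if_neg hjk, if_neg hil, sub_zero, ← zero_smul ℂ (loop N 0 (r + s)), ← loop_smul, zero_smul]
    congr 1
    refine Subtype.ext ?_
    rw [LieAlgebra.SpecialLinear.sl_bracket]
    simp [Matrix.single_mul_single_of_ne _ _ _ _ hjk,
      Matrix.single_mul_single_of_ne _ _ _ _ (Ne.symm hil)]

end AffineSl

namespace Steinberg

variable {L : Type*} [LieRing L] {N : ℕ} {Z : ℤ → ℕ → ℕ → L} {A : ℤ → AddSubgroup L}

lemma mem_of_mem (hN : 4 ≤ N) (hZ : ∀ r s, MatProd 1 N (Z r) (Z s) (Z (r + s)))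
    (hA : ∀ r s a b, a ∈ A r → b ∈ A s → ⁅a, b⁆ ∈ A (r + s))
    (h₀ : ∀ i j, (1 ≤ i ∧ i ≤ N ∧ 1 ≤ j ∧ j ≤ N ∧ i ≠ j) → Z 0 i j ∈ A 0) {r : ℤ} {k l : ℕ}
    (hk : 1 ≤ k ∧ k ≤ N ∧ 1 ≤ l ∧ l ≤ N ∧ k ≠ l) (h : Z r k l ∈ A r) {i j : ℕ}
    (hi : 1 ≤ i ∧ i ≤ N ∧ 1 ≤ j ∧ j ≤ N ∧ i ≠ j) : Z r i j ∈ A r := by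
  have left : ∀ i k l, (1 ≤ k ∧ k ≤ N ∧ 1 ≤ l ∧ l ≤ N ∧ k ≠ l ∧ 1 ≤ i ∧ i ≤ N ∧ i ≠ l) →
      Z r k l ∈ A r → Z r i l ∈ A r := by
    intro i k l hi h
    by_cases hik : i = k
    · rwa [hik]
    · have := hA 0 r _ _ (h₀ i k (by omega)) h
      rwa [(hZ 0 r).mul (by omega), zero_add] at this
  have right : ∀ j k l, (1 ≤ k ∧ k ≤ N ∧ 1 ≤ l ∧ l ≤ N ∧ k ≠ l ∧ 1 ≤ j ∧ j ≤ N ∧ k ≠ j) →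
      Z r k l ∈ A r → Z r k j ∈ A r := by
    intro j k l hi h
    by_cases hjl : j = l
    · rwa [hjl]
    · have := hA r 0 _ _ h (h₀ l j (by omega))
      rwa [(hZ r 0).mul (by omega), add_zero] at this
  obtain ⟨m, hm⟩ := exists_label hN i k k
  exact right j i m (by omega) (left i k m (by omega) (right m k l (by omega) h))

/-- The root vectors `E_ij t^r` have degree `r` with respect to a grading `A` compatible with the
bracket as soon as this holds for the Chevalley generators. -/
lemma mem_of_chevalley (hN : 4 ≤ N) (hZ : ∀ r s, MatProd 1 N (Z r) (Z s) (Z (r + s)))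
    (hA : ∀ r s a b, a ∈ A r → b ∈ A s → ⁅a, b⁆ ∈ A (r + s))
    (he : ∀ i, 1 ≤ i → i < N → Z 0 i (i + 1) ∈ A 0)
    (hf : ∀ i, 1 ≤ i → i < N → Z 0 (i + 1) i ∈ A 0)
    (he₀ : Z 1 N 1 ∈ A 1) (hf₀ : Z (-1) 1 N ∈ A (-1)) (r : ℤ) {i j : ℕ}
    (hi : 1 ≤ i ∧ i ≤ N ∧ 1 ≤ j ∧ j ≤ N ∧ i ≠ j) : Z r i j ∈ A r := by
  have up : ∀ i d, (1 ≤ i ∧ i + d + 1 ≤ N) →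
      Z 0 i (i + d + 1) ∈ A 0 ∧ Z 0 (i + d + 1) i ∈ A 0 := by
    intro i d
    induction d with
    | zero => exact fun h => ⟨he i h.1 (by omega), hf i h.1 (by omega)⟩
    | succ d ih =>
      intro h
      have h₁ := hA 0 0 _ _ (ih (by omega)).1 (he (i + d + 1) (by omega) (by omega))
      have h₂ := hA 0 0 _ _ (hf (i + d + 1) (by omega) (by omega)) (ih (by omega)).2
      rw [(hZ 0 0).mul (by omega)] at h₁ h₂
      exact ⟨h₁, h₂⟩
  have h₀ : ∀ i j, (1 ≤ i ∧ i ≤ N ∧ 1 ≤ j ∧ j ≤ N ∧ i ≠ j) → Z 0 i j ∈ A 0 := by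
    intro i j h
    rcases Nat.lt_or_ge i j with hij | hij
    · obtain ⟨d, rfl⟩ := Nat.exists_eq_add_of_lt hij
      exact (up i d (by omega)).1
    · obtain ⟨d, rfl⟩ := Nat.exists_eq_add_of_lt (show j < i by omega)
      exact (up j d (by omega)).2
  have step : ∀ r s, Z s 3 2 ∈ A s → Z r 1 3 ∈ A r → Z (r + s) 1 2 ∈ A (r + s) := by
    intro r s h₁ h₂
    have := hA r s _ _ h₂ h₁
    rwa [(hZ r s).mul (by omega)] at this
  have main : Z r 1 2 ∈ A r := by
    induction r using Int.induction_on with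
    | zero => exact h₀ 1 2 (by omega)
    | succ r ih =>
      exact step r 1 (mem_of_mem hN hZ hA h₀ (by omega) he₀ (by omega))
        (mem_of_mem hN hZ hA h₀ (k := 1) (l := 2) (by omega) ih (by omega))
    | pred r ih =>
      exact step _ (-1) (mem_of_mem hN hZ hA h₀ (by omega) hf₀ (by omega))
        (mem_of_mem hN hZ hA h₀ (k := 1) (l := 2) (by omega) ih (by omega))
  exact mem_of_mem hN hZ hA h₀ (k := 1) (l := 2) (by omega) main hi

end Steinberg

namespace AffineYangian

attribute [local instance] LieRing.ofAssociativeRing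

open Steinberg

section Natural

variable {N : ℕ} [NeZero N] {ħ ε : ℂ} (φ : Env N →ₐ[ℂ] AffineYangian N ħ ε)

/-- The image of `E_ij t^r` in the Yangian. -/
def loopE (r : ℤ) (i j : ℕ) : AffineYangian N ħ ε :=
  φ (UniversalEnvelopingAlgebra.ι ℂ (AffineSl.E N i j r))

lemma matProd_loopE (r s : ℤ) : MatProd 1 N (loopE φ r) (loopE φ s) (loopE φ (r + s)) := by
  intro i j k l h
  have h₁ := congrArg (fun z => φ (UniversalEnvelopingAlgebra.ι ℂ z))
    (AffineSl.matProd_E r s i j k l h)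
  simp only [LieHom.map_lie, Ring.lie_def, map_sub, map_mul] at h₁
  rw [Ring.lie_def, loopE, loopE, h₁]
  split_ifs <;> simp [loopE]

variable {φ}

lemma loopE_e (hφ : IsNatural φ) {i : ℕ} (hi : 1 ≤ i ∧ i < N) :
    loopE φ 0 i (i + 1) = X ħ ε 1 (i : ZMod N) 0 := by
  have h₀ : (i : ZMod N) ≠ 0 := by
    rw [← Nat.cast_zero, Ne, natCast_inj hi.2 (by omega)]
    omega
  rw [← (hφ i).1, AffineSl.e, if_neg h₀, loopE, Nat.cast_add, Nat.cast_one]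

lemma loopE_f (hφ : IsNatural φ) {i : ℕ} (hi : 1 ≤ i ∧ i < N) :
    loopE φ 0 (i + 1) i = X ħ ε (-1) (i : ZMod N) 0 := by
  have h₀ : (i : ZMod N) ≠ 0 := by
    rw [← Nat.cast_zero, Ne, natCast_inj hi.2 (by omega)]
    omega
  rw [← (hφ i).2.1, AffineSl.f, if_neg h₀, loopE, Nat.cast_add, Nat.cast_one]

lemma loopE_e_zero (hφ : IsNatural φ) : loopE φ 1 N 1 = X ħ ε 1 0 0 := by
  rw [← (hφ 0).1, AffineSl.e, if_pos rfl, loopE, ZMod.natCast_self, Nat.cast_one, zero_add]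

lemma loopE_f_zero (hφ : IsNatural φ) : loopE φ (-1) 1 N = X ħ ε (-1) 0 0 := by
  rw [← (hφ 0).2.1, AffineSl.f, if_pos rfl, loopE, ZMod.natCast_self, Nat.cast_one, zero_add]

/-- The image of `E_ij t^r` has degree `r`. -/
lemma loopE_mem_homogeneous (hN : 4 ≤ N) (hφ : IsNatural φ) (r : ℤ) {i j : ℕ}
    (hi : 1 ≤ i ∧ i ≤ N ∧ 1 ≤ j ∧ j ≤ N ∧ i ≠ j) : loopE φ r i j ∈ homogeneous N ħ ε r := by
  have hX : ∀ (σ : ℤˣ) (i : ℕ), 1 ≤ i → i < N →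
      X ħ ε σ (i : ZMod N) 0 ∈ homogeneous N ħ ε 0 := by
    intro σ i h₁ h₂
    have h₀ : (i : ZMod N) ≠ 0 := by
      rw [← Nat.cast_zero, Ne, natCast_inj h₂ (by omega)]
      omega
    have := gen_mem_homogeneous N ħ ε (Gen.X σ (i : ZMod N) 0)
    rwa [Gen.degree, if_neg h₀] at this
  refine mem_of_chevalley (A := fun r => (homogeneous N ħ ε r).toAddSubgroup) hN (matProd_loopE φ)
    ?_ ?_ ?_ ?_ ?_ r hi
  · intro r s a b ha hb
    rw [Ring.lie_def]
    refine sub_mem (mul_mem_homogeneous N ħ ε ha hb) ?_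
    rw [add_comm]
    exact mul_mem_homogeneous N ħ ε hb ha
  · intro i h₁ h₂
    rw [loopE_e hφ ⟨h₁, h₂⟩]
    exact hX 1 i h₁ h₂
  · intro i h₁ h₂
    rw [loopE_f hφ ⟨h₁, h₂⟩]
    exact hX (-1) i h₁ h₂
  · rw [loopE_e_zero hφ]
    have := gen_mem_homogeneous N ħ ε (Gen.X 1 0 0)
    rwa [Gen.degree, if_pos rfl, Units.val_one] at this
  · rw [loopE_f_zero hφ]
    have := gen_mem_homogeneous N ħ ε (Gen.X (-1) 0 0)
    rwa [Gen.degree, if_pos rfl, Units.val_neg, Units.val_one] at this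

end Natural

/-! ### Convergence in the degreewise completion -/

section Completion

variable (n : ℕ) (ħ ε : ℂ)

instance : NonarchimedeanRing (AffineYangian n ħ ε) := (J_basis n ħ ε).nonarchimedean

instance : IsTopologicalRing (DegreewiseCompletion n ħ ε) :=
  inferInstanceAs (IsTopologicalRing (DegreewiseCompletion n ħ ε).toSubring)

variable {n ħ ε}

/-- Products `u_s v_s` of degree `d` converge if the degree of `v_s` tends to infinity. -/
lemma summable_toCompletion {d : ℤ} {u v : ℕ → AffineYangian n ħ ε}
    (hu : ∀ s : ℕ, u s ∈ homogeneous n ħ ε (d - (s + 1)))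
    (hv : ∀ s : ℕ, v s ∈ homogeneous n ħ ε (s + 1)) :
    Summable fun s => toCompletion n ħ ε (u s * v s) := by
  have h₁ : Filter.Tendsto (fun s => u s * v s) Filter.cofinite (𝓝 0) := by
    refine (hasBasis_nhds_zero n ħ ε).tendsto_right_iff.2 fun k _ => ?_
    refine (Set.finite_lt_nat k).subset fun s hs => ?_
    by_contra hks
    refine hs (Ideal.mul_mem_left _ _ (Ideal.subset_span ⟨s + 1, ?_, hv s⟩))
    simp only [Set.mem_ofPred_eq] at hks
    omega
  have h₂ : Filter.Tendsto (fun s => toBig n ħ ε (u s * v s)) Filter.cofinite (𝓝 0) := by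
    have := ((continuous_toBig n ħ ε).tendsto 0).comp h₁
    rwa [map_zero] at this
  obtain ⟨z, hz⟩ := NonarchimedeanAddGroup.summable_of_tendsto_cofinite_zero h₂
  have h₃ : z ∈ completedPart n ħ ε d := by
    refine (Submodule.isClosed_topologicalClosure _).mem_of_tendsto hz
      (Filter.Eventually.of_forall fun S => sum_mem fun s _ => ?_)
    have := mul_mem_homogeneous n ħ ε (hu s) (hv s)
    rw [sub_add_cancel] at this
    exact toBig_mem_completedPart n ħ ε this
  have h₄ : z ∈ DegreewiseCompletion n ħ ε := Submodule.mem_iSup_of_mem d h₃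
  have h₅ : Topology.IsInducing (DegreewiseCompletion n ħ ε).val := Topology.IsInducing.subtypeVal
  exact ⟨⟨z, h₄⟩, (h₅.hasSum_iff _ _).1 hz⟩

end Completion

/-! ### Existence and uniqueness of `Ψ` -/

section Psi

variable {n : ℕ} {ħ ε : ℂ} {φ : Env (n + 1) →ₐ[ℂ] AffineYangian (n + 1) ħ ε}

/-- The series `P_ij` converges. -/
lemma summable_term (hn : 3 ≤ n) (hφ : IsNatural φ) {i j : ℕ}
    (hi : 1 ≤ i ∧ i ≤ n ∧ 1 ≤ j ∧ j ≤ n) : Summable (term φ i j) := by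
  have h₁ := summable_toCompletion (d := 0) (u := fun s : ℕ => loopE φ (-(s : ℤ) - 1) i (n + 1))
    (v := fun s : ℕ => loopE φ (s + 1) (n + 1) j)
    (fun s => by
      rw [show (0 : ℤ) - (s + 1) = -s - 1 by ring]
      exact loopE_mem_homogeneous (by omega) hφ _ (by omega))
    fun s => loopE_mem_homogeneous (by omega) hφ _ (by omega)
  simp only [map_mul] at h₁
  exact h₁

/-- The degreewise completion, with the root vectors and the series `P_ij`. -/
lemma sumRep (hn : 3 ≤ n) (hφ : IsNatural φ) :
    SumRep n ħ (ε + n / 2 * ħ) (fun i r => toCompletion _ ħ ε (H ħ ε (i : ZMod (n + 1)) r))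
      (fun σ i r => toCompletion _ ħ ε (X ħ ε σ (i : ZMod (n + 1)) r))
      (fun r i j => root φ i j r) (termSum φ) where
  rel := by
    have := relations_map (by omega) (toCompletion (n + 1) ħ ε)
    rwa [show ε + ((n + 1 : ℕ) : ℂ) / 2 * ħ = ε + n / 2 * ħ + ħ / 2 by push_cast; ring] at this
  prod r s i j k l h := by
    have h₁ := congrArg (toCompletion (n + 1) ħ ε) (matProd_loopE φ r s i j k l h)
    rw [map_lie, map_sub, apply_ite (toCompletion (n + 1) ħ ε),
      apply_ite (toCompletion (n + 1) ħ ε), map_zero] at h₁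
    exact h₁
  e i h₁ h₂ := congrArg _ (loopE_e hφ ⟨h₁, by omega⟩).symm
  f i h₁ h₂ := congrArg _ (loopE_f hφ ⟨h₁, by omega⟩).symm
  e₀ := by
    rw [Nat.cast_zero]
    exact congrArg _ (loopE_e_zero hφ).symm
  f₀ := by
    rw [Nat.cast_zero]
    exact congrArg _ (loopE_f_zero hφ).symm
  hasSum i j hi := (summable_term hn hφ hi).hasSum

lemma exists_isPsi (hn : 3 ≤ n) (hφ : IsNatural φ) :
    ∃ Ψ : AffineYangian n ħ ε →ₐ[ℂ] DegreewiseCompletion (n + 1) ħ ε, IsPsi φ Ψ := by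
  obtain ⟨Ψ, hH, hX⟩ := exists_lift hn ((sumRep hn hφ).relations hn)
  have hne : ¬((-1 : ℤˣ) = 1) := by decide
  refine ⟨Ψ, ?_, ?_, ?_, ?_, ?_, ?_, ?_, ?_, ?_⟩
  · have h₁ := hH 0 0 (by omega)
    rw [Nat.cast_zero] at h₁
    rw [h₁, map_add]
    simp [imH₀_zero]
  · intro i h₁ h₂
    rw [hH i 0 h₂]
    simp [imH₀_of_pos h₁]
  · have h₁ := hX 1 0 0 (by omega)
    rw [Nat.cast_zero] at h₁
    rw [h₁]
    simp [rootE_zero]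
  · intro i h₁ h₂
    rw [hX 1 i 0 h₂]
    simp [rootE_of_pos h₁]
  · have h₁ := hX (-1) 0 0 (by omega)
    rw [Nat.cast_zero] at h₁
    rw [h₁]
    simp [hne, rootF_zero]
  · intro i h₁ h₂
    rw [hX (-1) i 0 h₂]
    simp [hne, rootF_of_pos h₁]
  · intro i h₁ h₂
    rw [hH i 1 h₂]
    simp [imH₁_of_pos h₁]
  · intro i h₁ h₂
    rw [hX 1 i 1 h₂]
    simp [imE₁_of_pos h₁]
  · intro i h₁ h₂
    rw [hX (-1) i 1 h₂]
    simp [hne, imF₁_of_pos h₁]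

/-- A homomorphism from the Yangian is determined by its values on the generators `H_{i,0}`,
`X^±_{i,0}` and on the generators `H_{i,1}`, `X^±_{i,1}` with `i ≠ 0`. -/
lemma algHom_ext_of_ne_zero {R : Type*} [Ring R] [Algebra ℂ R] (hn : 3 ≤ n)
    {f g : AffineYangian n ħ ε →ₐ[ℂ] R}
    (hH : ∀ i : ℕ, i < n → f (H ħ ε i 0) = g (H ħ ε i 0))
    (hX : ∀ σ, ∀ i : ℕ, i < n → f (X ħ ε σ i 0) = g (X ħ ε σ i 0))
    (hH₁ : ∀ i : ℕ, 1 ≤ i → i < n → f (H ħ ε i 1) = g (H ħ ε i 1))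
    (hX₁ : ∀ σ, ∀ i : ℕ, 1 ≤ i → i < n → f (X ħ ε σ i 1) = g (X ħ ε σ i 1)) : f = g := by
  have : NeZero n := ⟨by omega⟩
  have hr := relations_map hn f
  have hr' := relations_map hn g
  have hX₀ : ∀ σ, f (X ħ ε σ ((0 : ℕ) : ZMod n) 1) = g (X ħ ε σ ((0 : ℕ) : ZMod n) 1) := by
    intro σ
    have h₁ := hr.ht_x σ 1 0 (by omega) (by omega) (by omega) (by omega)
    have h₂ := hr'.ht_x σ 1 0 (by omega) (by omega) (by omega) (by omega)
    rw [hH 1 (by omega), hX σ 0 (by omega), hH₁ 1 le_rfl (by omega), h₂,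
      cartanNat_of_adjacent (by omega) (by omega)] at h₁
    refine (smul_right_injective R (r := sgn σ * -1) ?_ h₁).symm
    rcases Int.units_eq_one_or σ with rfl | rfl <;> simp [sgn]
  have hH₀ : f (H ħ ε ((0 : ℕ) : ZMod n) 1) = g (H ħ ε ((0 : ℕ) : ZMod n) 1) := by
    have h₁ := hr.x1_x0 0 0 (by omega) (by omega)
    have h₂ := hr'.x1_x0 0 0 (by omega) (by omega)
    rw [if_pos rfl] at h₁ h₂
    rw [← h₁, ← h₂, hX₀, hX _ 0 (by omega)]
  have key : ∀ a : Gen n, f (gen n ħ ε a) = g (gen n ħ ε a) := by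
    rintro (⟨i, r⟩ | ⟨σ, i, r⟩)
    · rw [← ZMod.natCast_zmod_val i]
      have hi := ZMod.val_lt i
      match r, Nat.eq_zero_or_pos i.val with
      | 0, _ => exact hH _ hi
      | 1, .inl h => rw [h]; exact hH₀
      | 1, .inr h => exact hH₁ _ h hi
    · rw [← ZMod.natCast_zmod_val i]
      have hi := ZMod.val_lt i
      match r, Nat.eq_zero_or_pos i.val with
      | 0, _ => exact hX _ _ hi
      | 1, .inl h => rw [h]; exact hX₀ σ
      | 1, .inr h => exact hX₁ _ _ h hi
  refine AlgHom.ext fun y => ?_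
  induction y using induction with
  | hs c => rw [AlgHom.commutes, AlgHom.commutes]
  | hg a => exact key a
  | hm a b ha hb => rw [map_mul, map_mul, ha, hb]
  | ha a b ha hb => rw [map_add, map_add, ha, hb]

lemma IsPsi.unique (hn : 3 ≤ n)
    {Ψ Ψ' : AffineYangian n ħ ε →ₐ[ℂ] DegreewiseCompletion (n + 1) ħ ε}
    (h : IsPsi φ Ψ) (h' : IsPsi φ Ψ') : Ψ = Ψ' := by
  refine algHom_ext_of_ne_zero hn ?_ ?_ ?_ ?_
  · intro i hi
    rcases Nat.eq_zero_or_pos i with rfl | h0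
    · rw [Nat.cast_zero, h.H_zero, h'.H_zero]
    · rw [h.H_ne_zero i h0 hi, h'.H_ne_zero i h0 hi]
  · intro σ i hi
    rcases Int.units_eq_one_or σ with rfl | rfl <;> rcases Nat.eq_zero_or_pos i with rfl | h0
    · rw [Nat.cast_zero, h.Xp_zero, h'.Xp_zero]
    · rw [h.Xp_ne_zero i h0 hi, h'.Xp_ne_zero i h0 hi]
    · rw [Nat.cast_zero, h.Xm_zero, h'.Xm_zero]
    · rw [h.Xm_ne_zero i h0 hi, h'.Xm_ne_zero i h0 hi]
  · intro i h0 hi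
    rw [h.H_one i h0 hi, h'.H_one i h0 hi]
  · intro σ i h0 hi
    rcases Int.units_eq_one_or σ with rfl | rfl
    · rw [h.Xp_one i h0 hi, h'.Xp_one i h0 hi]
    · rw [h.Xm_one i h0 hi, h'.Xm_one i h0 hi]

lemma IsPsi.map_Ht {Ψ : AffineYangian n ħ ε →ₐ[ℂ] DegreewiseCompletion (n + 1) ħ ε}
    (h : IsPsi φ Ψ) {i : ℕ} (h0 : 1 ≤ i) (hi : i < n) :
    Ψ (Ht ħ ε i) = toCompletion _ ħ ε (Ht ħ ε i) - ħ • termSum φ i i +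
      ħ • termSum φ (i + 1) (i + 1) := by
  rw [Ht, Ht, map_sub, map_smul, map_pow, h.H_one i h0 hi, h.H_ne_zero i h0 hi, map_sub, map_smul,
    map_pow]
  abel

end Psi

end AffineYangian

end

theorem theorem3p1 (n : ℕ) (hn : 3 ≤ n) (ħ ε : ℂ) :
    (∃ φ : AffineYangian.Env (n + 1) →ₐ[ℂ] AffineYangian (n + 1) ħ ε, AffineYangian.IsNatural φ) ∧
    ∀ φ : AffineYangian.Env (n + 1) →ₐ[ℂ] AffineYangian (n + 1) ħ ε, AffineYangian.IsNatural φ →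
      (∀ i j : ℕ, 1 ≤ i → i ≤ n → 1 ≤ j → j ≤ n → Summable (AffineYangian.term φ i j)) ∧
      (∃! Ψ : AffineYangian n ħ ε →ₐ[ℂ] AffineYangian.DegreewiseCompletion (n + 1) ħ ε,
        AffineYangian.IsPsi φ Ψ) ∧
      ∀ Ψ : AffineYangian n ħ ε →ₐ[ℂ] AffineYangian.DegreewiseCompletion (n + 1) ħ ε,
        AffineYangian.IsPsi φ Ψ → ∀ i : ℕ, 1 ≤ i → i < n →
          Ψ (AffineYangian.Ht ħ ε i) =
            AffineYangian.toCompletion _ ħ ε (AffineYangian.Ht ħ ε i)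
              - ħ • AffineYangian.termSum φ i i
              + ħ • AffineYangian.termSum φ (i + 1) (i + 1) := by
  refine ⟨AffineYangian.exists_isNatural (by omega) ħ ε, fun φ hφ => ⟨?_, ?_, ?_⟩⟩
  · exact fun i j h₁ h₂ h₃ h₄ => AffineYangian.summable_term hn hφ ⟨h₁, h₂, h₃, h₄⟩
  · obtain ⟨Ψ, hΨ⟩ := AffineYangian.exists_isPsi hn hφ
    exact ⟨Ψ, hΨ, fun Ψ' hΨ' => hΨ'.unique hn hΨ⟩
  · exact fun Ψ hΨ i h₁ h₂ => hΨ.map_Ht h₁ h₂
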